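/- Let $d\ge 1$, $p\in[2,\infty)$, $\alpha\in(0,2)$, $\nu>0$, $\lambda>0$, $\delta\ge \alpha/2$ and $K\in\mathbb{R}$. Then there is a constant $N$, depending only on $d,p,\alpha,\nu,\lambda,\delta$ and $K$, such that the following holds. Let $H$ be a Hilbert space over $\mathbb{K}\in\{\mathbb{R},\mathbb{C}\}$ and let $\psi:\mathbb{R}^d\to\mathbb{K}$ be a $C^1$ function such that, for $\hat\psi(\xi)=(2\pi)^{-d}\int_{\mathbb{R}^d}e^{-i\xi\cdot x}\psi(x)\,dx$ and all $\xi\in\mathbb{R}^d$, $$|\hat\psi(\xi)|\le K|\xi|^{\nu},\qquad |\xi|^{\lambda}|\hat\psi(\xi)|\le K.$$ Assume that there is a continuously differentiable function $\overline\psi:[0,\infty)\to\mathbb{R}$ with $\lim_{\rho\to\infty}\overline\psi(\rho)=0$ such that $$|\psi(x)|+|\nabla\psi(x)|+|x||\nabla\psi(x)|\le\overline\psi(|x|)\quad (x\in\mathbb{R}^d),\qquad \int_0^\infty|\overline\psi'(\rho)|\,d\rho\le K,$$ $$\int_r^\infty|\overline\psi'(\rho)|\rho^d\,d\rho\le K r^{-\delta}\quad\text{for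 all } r\ge 10^{-1/\alpha}.$$ For $t>0$ put $$\Psi_t h(x)=t^{-d/\alpha}\int_{\mathbb{R}^d}\psi\big((x-y)/t^{1/\alpha}\big)h(y)\,dy .$$ Let $-\infty\le a<b\le\infty$, let $f\in C_0^\infty((a,b)\times\mathbb{R}^d,H)$ (smooth with compact support in $(a,b)\times\mathbb{R}^d$), and for $t>a$, $x\in\mathbb{R}^d$ put $$\mathcal{G}_af(t,x)=\Big[\int_a^t|\Psi_{t-s}f(s,\cdot)(x)|_H^2\,\frac{ds}{t-s}\Big]^{1/2}.$$ Then $$\int_{\mathbb{R}^d}\int_a^b[\mathcal{G}_af(t,x)]^p\,dt\,dx\le N\int_{\mathbb{R}^d}\int_a^b|f(t,x)|_H^p\,dt\,dx .$$ -/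

import Mathlib

open Filter Topology MeasureTheory Set
open scoped NNReal ENNReal ContDiff

namespace LittlewoodPaley

noncomputable section

/-- The Fourier transform `ψ̂(ξ) = (2π)⁻ᵈ ∫ exp(-i ξ · x) ψ(x) dx` of a real- or complex-valued
function on `ℝᵈ`. Here `RCLike.map 𝕜 ℂ` is the inclusion `ℝ ⊆ ℂ` if `𝕜 = ℝ`, and the identity if
`𝕜 = ℂ`. -/
def fourierHat {𝕜 : Type*} [RCLike 𝕜] {d : ℕ} (ψ : EuclideanSpace ℝ (Fin d) → 𝕜)
    (ξ : EuclideanSpace ℝ (Fin d)) : ℂ :=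
  ((2 * Real.pi : ℝ) : ℂ)⁻¹ ^ d *
    ∫ x, Complex.exp (-Complex.I * ((inner ℝ ξ x : ℝ) : ℂ)) * RCLike.map 𝕜 ℂ (ψ x)

/-- `ψbar` is a `C¹` function on `[0, ∞)` which vanishes at infinity, its composition with the norm
dominates `|ψ| + |∇ψ| + |x||∇ψ|`, and its derivative has the integrability
`∫₀^∞ |ψbar'| ≤ K` and `∫_r^∞ |ψbar'(ρ)| ρᵈ dρ ≤ K / r^δ` for `r ≥ 10^(-1/α)`.
(`‖fderiv ℝ ψ x‖` is the Euclidean norm of the gradient if `ψ` is real-valued, and at most that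
norm if `ψ` is complex-valued. The integrals of nonnegative functions are Lebesgue integrals with
values in `[0, ∞]`, so that the bounds contain the finiteness.) -/
structure IsRadialMajorant {𝕜 : Type*} [RCLike 𝕜] {d : ℕ} (α δ K : ℝ)
    (ψ : EuclideanSpace ℝ (Fin d) → 𝕜) (ψbar : ℝ → ℝ) : Prop where
  contDiffOn : ContDiffOn ℝ 1 ψbar (Ici 0)
  le_majorant : ∀ x, ‖ψ x‖ + ‖fderiv ℝ ψ x‖ + ‖x‖ * ‖fderiv ℝ ψ x‖ ≤ ψbar ‖x‖
  lintegral_deriv_le : ∫⁻ ρ in Ioi (0 : ℝ), ENNReal.ofReal |deriv ψbar ρ| ≤ ENNReal.ofReal K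
  tendsto_zero : Tendsto ψbar atTop (𝓝 0)
  lintegral_tail_le : ∀ r : ℝ, (10 : ℝ) ^ (-1 / α) ≤ r →
    ∫⁻ ρ in Ioi r, ENNReal.ofReal (|deriv ψbar ρ| * ρ ^ d) ≤ ENNReal.ofReal (K / r ^ δ)

/-- The assumptions on the kernel `ψ`. -/
structure IsAdmissibleKernel {𝕜 : Type*} [RCLike 𝕜] {d : ℕ} (α ν lam δ K : ℝ)
    (ψ : EuclideanSpace ℝ (Fin d) → 𝕜) : Prop where
  contDiff : ContDiff ℝ 1 ψ
  fourier_le : ∀ ξ, ‖fourierHat ψ ξ‖ ≤ K * ‖ξ‖ ^ ν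
  fourier_decay : ∀ ξ, ‖ξ‖ ^ lam * ‖fourierHat ψ ξ‖ ≤ K
  exists_majorant : ∃ ψbar : ℝ → ℝ, IsRadialMajorant α δ K ψ ψbar

/-- `Ψ_t h(x) = t^(-d/α) ∫ ψ((x - y) / t^(1/α)) h(y) dy`. -/
def scaledConv {𝕜 : Type*} [RCLike 𝕜] {H : Type*} [NormedAddCommGroup H]
    [InnerProductSpace 𝕜 H] [NormedSpace ℝ H] {d : ℕ} (α : ℝ)
    (ψ : EuclideanSpace ℝ (Fin d) → 𝕜) (t : ℝ) (h : EuclideanSpace ℝ (Fin d) → H)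
    (x : EuclideanSpace ℝ (Fin d)) : H :=
  (t ^ (-(d : ℝ) / α)) • ∫ y, ψ ((t ^ (1 / α))⁻¹ • (x - y)) • h y

/-- The parabolic square function
`𝒢_a f(t, x) = (∫_a^t |Ψ_{t-s} f(s, ·)(x)|² ds / (t - s))^(1/2)`, with values in `[0, ∞]`. -/
def squareFunction {𝕜 : Type*} [RCLike 𝕜] {H : Type*} [NormedAddCommGroup H]
    [InnerProductSpace 𝕜 H] [NormedSpace ℝ H] {d : ℕ} (α : ℝ)
    (ψ : EuclideanSpace ℝ (Fin d) → 𝕜) (a : EReal) (f : ℝ × EuclideanSpace ℝ (Fin d) → H)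
    (t : ℝ) (x : EuclideanSpace ℝ (Fin d)) : ℝ≥0∞ :=
  (∫⁻ s in {s : ℝ | a < (s : EReal) ∧ s < t},
    ENNReal.ofReal (‖scaledConv α ψ (t - s) (fun y => f (s, y)) x‖ ^ 2 / (t - s))) ^ (1 / 2 : ℝ)

end

end LittlewoodPaley

/-!
The proof uses neither the Fourier transform nor sharp functions. Of the two bounds on `ψ̂` only the
vanishing of `∫ ψ`, which is the value of the first one at the origin, enters. The radial majorant
writes the bounds for `ψ` and `∇ψ` as superpositions of indicator functions of balls
(`IsRadiallyDominated`) with a power-decaying tail (`IsMajorantMeasure`).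

The heart of the matter is the weighted inequality
`∫∫ F G ≤ C ∫∫ |f|² M G` (`exists_lintegral_parabolicSquare_mul_le`), where `F` is the square of the
square function, `G ≥ 0` is any weight, and `M` is the composition of the Hardy–Littlewood maximal
functions in space and in time. With `G = 1` it is the case `p = 2`. For `p > 2`, the norm of `F` in
`L^(p/2)` is found by duality (`lintegral_rpow_le_of_forall_lintegral_mul_le`), from Hölder's
inequality and the maximal theorem for the conjugate exponent.

For the weighted inequality, by Tonelli's theorem and the substitution `t = s + τ`, the source time
`s` may be fixed (`exists_lintegral_sq_mul_le`). Let `aᵢ` be convolution with a tent of radius `βⁱ`.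
The telescoping identity for `3a² - 2a³` gives a reproducing formula `h = ∑ dᵢ' dᵢ h`, in which
`dᵢ = aᵢ - aᵢ₊₁` and `dᵢ'`, a polynomial in `aᵢ` and `aᵢ₊₁`, both have compactly supported kernels
of mean zero (`conv_tentDual_conv_tentDiff`, `enorm_integral_smul_le_tsum`). The kernel of `Ψ_τ dᵢ'`
decays geometrically in the distance between the scales `τ^(1/α)` and `βⁱ`, through the cancellation
of the narrower factor against the smoothness of the wider one (`exists_lintegral_conv_dilate_le`).
Hence, by Cauchy–Schwarz, the left-hand side is at most `∑ ∫ |dᵢ h|² Wᵢ`, where `Wᵢ` is dominated by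
`M G` throughout balls of radius comparable to `βⁱ`.

As the kernels of `dᵢ` are supported in such balls, the unweighted inequality
`∑ ‖dᵢ h‖² ≤ C ‖h‖²` for the restrictions of `h` to the level sets of `M G` may be integrated over
the levels (`exists_tsum_lintegral_conv_sq_mul_le`). The unweighted inequality is almost orthogonality:
`dᵢ dₗ` has norm of order `β^(-|i - l|)` (`exists_sum_integral_conv_sq_le`).
-/

set_option linter.unusedSectionVars false

namespace LittlewoodPaley

/-! ### The dyadic-radius Hardy–Littlewood maximal function -/

/-- The average of `g` over the ball of radius `2 ^ n` around `x`. -/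
noncomputable def ballAverage {X : Type*} [PseudoMetricSpace X] [MeasurableSpace X] (μ : Measure X)
    (g : X → ℝ≥0∞) (n : ℤ) (x : X) : ℝ≥0∞ :=
  (μ (Metric.ball x (2 ^ n : ℝ)))⁻¹ * ∫⁻ y in Metric.ball x (2 ^ n : ℝ), g y ∂μ

/-- The centred Hardy–Littlewood maximal function, where the supremum is taken over the radii
`2 ^ n`, `n ∈ ℤ`, only. It is comparable to the full one, and as a countable supremum it is
measurable for trivial reasons, also in the presence of parameters. -/
noncomputable def maximalFn {X : Type*} [PseudoMetricSpace X] [MeasurableSpace X] (μ : Measure X)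
    (g : X → ℝ≥0∞) (x : X) : ℝ≥0∞ :=
  ⨆ n : ℤ, ballAverage μ g n x

theorem ballAverage_le_maximalFn {X : Type*} [PseudoMetricSpace X] [MeasurableSpace X]
    (μ : Measure X) (g : X → ℝ≥0∞) (n : ℤ) (x : X) : ballAverage μ g n x ≤ maximalFn μ g x :=
  le_iSup (fun n => ballAverage μ g n x) n

section

variable {X : Type*} [PseudoMetricSpace X] [MeasurableSpace X] (μ : Measure X)

theorem maximalFn_add_le {g₁ g₂ : X → ℝ≥0∞} (h : Measurable g₁) (x : X) :
    maximalFn μ (g₁ + g₂) x ≤ maximalFn μ g₁ x + maximalFn μ g₂ x := by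
  refine iSup_le fun n => ?_
  simp only [ballAverage, Pi.add_apply]
  rw [lintegral_add_left h, mul_add]
  exact add_le_add (ballAverage_le_maximalFn μ g₁ n x) (ballAverage_le_maximalFn μ g₂ n x)

theorem maximalFn_mono {g₁ g₂ : X → ℝ≥0∞} (h : g₁ ≤ g₂) (x : X) :
    maximalFn μ g₁ x ≤ maximalFn μ g₂ x := by
  refine iSup_mono fun n => ?_
  unfold ballAverage
  gcongr with y
  exact h y

theorem maximalFn_const_le (c : ℝ≥0∞) (x : X) : maximalFn μ (fun _ => c) x ≤ c := by
  refine iSup_le fun n => ?_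
  rw [ballAverage, setLIntegral_const, mul_comm c, ← mul_assoc]
  exact (mul_le_mul_left (ENNReal.inv_mul_le_one _) c).trans (one_mul c).le

end

/-- The layer cake formula for the `q`-th power of a single number. -/
theorem ofReal_rpow_eq_lintegral {q : ℝ} (hq : 0 < q) (y : ℝ≥0∞) :
    ∫⁻ l in Ioi (0 : ℝ), ENNReal.ofReal (l ^ (q - 1)) * {l : ℝ | ENNReal.ofReal l < y}.indicator 1 l
      = (ENNReal.ofReal q)⁻¹ * y ^ q := by
  have key : ∀ z : ℝ, 0 ≤ z → ∫⁻ l in Ioi (0 : ℝ), ENNReal.ofReal (l ^ (q - 1)) *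
      {l : ℝ | ENNReal.ofReal l < ENNReal.ofReal z}.indicator 1 l
      = (ENNReal.ofReal q)⁻¹ * ENNReal.ofReal z ^ q := by
    intro z hz
    have h1 : ∀ l ∈ Ioi (0 : ℝ), ENNReal.ofReal (l ^ (q - 1)) *
      {l : ℝ | ENNReal.ofReal l < ENNReal.ofReal z}.indicator 1 l
        = (Iio z).indicator (fun l => ENNReal.ofReal (l ^ (q - 1))) l := by
      intro l hl
      have : ENNReal.ofReal l < ENNReal.ofReal z ↔ l < z :=
        ENNReal.ofReal_lt_ofReal_iff_of_nonneg (le_of_lt hl)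
      by_cases hlz : l < z <;> simp [this, hlz, indicator]
    rw [setLIntegral_congr_fun measurableSet_Ioi h1, setLIntegral_indicator measurableSet_Iio,
      inter_comm, Ioi_inter_Iio, ← ENNReal.ofReal_rpow_of_nonneg (p := q) hz hq.le |>.symm,
      setLIntegral_congr Ioo_ae_eq_Ioc]
    rw [← ofReal_integral_eq_lintegral_ofReal, ← intervalIntegral.integral_of_le hz,
      integral_rpow (Or.inl (by linarith))]
    · simp only [sub_add_cancel, Real.zero_rpow hq.ne', sub_zero]
      rw [div_eq_inv_mul, ENNReal.ofReal_mul (by positivity), ENNReal.ofReal_inv_of_pos hq]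
    · exact (intervalIntegrable_iff_integrableOn_Ioc_of_le hz).1
        (intervalIntegral.intervalIntegrable_rpow' (by linarith))
    · filter_upwards [ae_restrict_mem measurableSet_Ioc] with l hl
      exact Real.rpow_nonneg hl.1.le _
  rcases eq_or_ne y ⊤ with rfl | hy
  · rw [ENNReal.top_rpow_of_pos hq, ENNReal.mul_top (by simp)]
    refine ENNReal.eq_top_of_forall_nnreal_le fun r => ?_
    -- compare with the value at `z`, where `z ^ q / q = r`
    have hz : 0 ≤ (q * r : ℝ) ^ (1 / q) := by positivity
    have h2 := key _ hz
    have h3 : (r : ℝ≥0∞) = (ENNReal.ofReal q)⁻¹ * ENNReal.ofReal ((q * r : ℝ) ^ (1 / q)) ^ q := by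
      rw [ENNReal.ofReal_rpow_of_nonneg hz hq.le, ← Real.rpow_mul (by positivity),
        one_div_mul_cancel hq.ne', Real.rpow_one, ENNReal.ofReal_mul hq.le, ← mul_assoc,
        ENNReal.inv_mul_cancel (by simpa using hq) (by simp)]
      simp
    rw [h3, ← h2]
    gcongr with l
    simp
  · have := key y.toReal ENNReal.toReal_nonneg
    rwa [ENNReal.ofReal_toReal hy] at this

section maximal

variable {X : Type*} [NormedAddCommGroup X] [NormedSpace ℝ X] [MeasurableSpace X] [BorelSpace X]
  [FiniteDimensional ℝ X] (μ : Measure X) [μ.IsAddHaarMeasure]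

theorem measure_ball_mul (x y : X) {r s : ℝ} (hr : 0 < r) (hs : 0 ≤ s) :
    μ (Metric.closedBall x (s * r)) =
      ENNReal.ofReal s ^ Module.finrank ℝ X * μ (Metric.ball y r) := by
  rw [Measure.addHaar_closedBall μ _ (by positivity), Measure.addHaar_ball_of_pos μ _ hr, mul_pow,
    ENNReal.ofReal_mul (by positivity), ENNReal.ofReal_pow hs, mul_assoc]

/-- The integral over a ball is controlled by the maximal function at the centre `y` of any larger
ball. The factor 2 is lost when the larger radius is rounded up to a power of 2. -/
theorem lintegral_closedBall_le_maximalFn (g : X → ℝ≥0∞) {x y : X} {r s : ℝ} (hs : 0 < s)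
    (h : Metric.closedBall x r ⊆ Metric.closedBall y s) :
    ∫⁻ z in Metric.closedBall x r, g z ∂μ ≤
      μ (Metric.ball 0 1) * ENNReal.ofReal (2 * s) ^ Module.finrank ℝ X * maximalFn μ g y := by
  obtain ⟨n, hn1, hn2⟩ := exists_mem_Ico_zpow hs (one_lt_two (α := ℝ))
  have hpos : (0 : ℝ) < 2 ^ (n + 1) := by positivity
  have hle : (2 : ℝ) ^ (n + 1) ≤ 2 * s := by
    rw [zpow_add_one₀ (by norm_num)]; linarith
  have hsub : Metric.closedBall x r ⊆ Metric.ball y (2 ^ (n + 1) : ℝ) :=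
    h.trans (Metric.closedBall_subset_ball hn2)
  have hM : (μ (Metric.ball y (2 ^ (n + 1) : ℝ)))⁻¹ *
      ∫⁻ z in Metric.ball y (2 ^ (n + 1) : ℝ), g z ∂μ ≤ maximalFn μ g y :=
    ballAverage_le_maximalFn μ g (n + 1) y
  have hB : μ (Metric.ball y (2 ^ (n + 1) : ℝ)) ≤
      μ (Metric.ball 0 1) * ENNReal.ofReal (2 * s) ^ Module.finrank ℝ X := by
    rw [Measure.addHaar_ball_of_pos μ _ hpos, mul_comm, ← ENNReal.ofReal_pow (by positivity)]
    gcongr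
  calc ∫⁻ z in Metric.closedBall x r, g z ∂μ
      ≤ ∫⁻ z in Metric.ball y (2 ^ (n + 1) : ℝ), g z ∂μ := lintegral_mono_set hsub
    _ = μ (Metric.ball y (2 ^ (n + 1) : ℝ)) * ((μ (Metric.ball y (2 ^ (n + 1) : ℝ)))⁻¹ *
        ∫⁻ z in Metric.ball y (2 ^ (n + 1) : ℝ), g z ∂μ) := by
        rw [← mul_assoc, ENNReal.mul_inv_cancel (Metric.measure_ball_pos μ y hpos).ne'
          measure_ball_lt_top.ne, one_mul]
    _ ≤ _ := mul_le_mul' hB hM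

/-- Joint measurability of the maximal function in the second of two variables. -/
theorem measurable_maximalFn_prod {Y : Type*} [MeasurableSpace Y] {g : Y × X → ℝ≥0∞}
    (hg : Measurable g) : Measurable fun z : Y × X => maximalFn μ (fun x => g (z.1, x)) z.2 := by
  refine Measurable.iSup fun n => ?_
  refine Measurable.mul ?_ ?_
  · simp_rw [Measure.addHaar_ball_center]
    exact measurable_const
  · have h1 : ∀ z : Y × X, ∫⁻ y in Metric.ball z.2 (2 ^ n : ℝ), g (z.1, y) ∂μ =
        ∫⁻ y, {w : (Y × X) × X | dist w.2 w.1.2 < (2 : ℝ) ^ n}.indicator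
          (fun w => g (w.1.1, w.2)) (z, y) ∂μ := by
      intro z
      rw [← lintegral_indicator measurableSet_ball]
      rfl
    simp_rw [h1]
    refine Measurable.lintegral_prod_right ?_
    refine Measurable.indicator (by fun_prop) ?_
    exact measurableSet_lt (by fun_prop) measurable_const

theorem measurable_maximalFn {g : X → ℝ≥0∞} (hg : Measurable g) :
    Measurable fun x => maximalFn μ g x := by
  have h := measurable_maximalFn_prod μ (Y := X) (g := fun z => g z.2) (hg.comp measurable_snd)
  have h2 : Measurable fun x : X => (x, x) := measurable_id.prodMk measurable_id
  have h3 := h.comp h2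
  simp only [Function.comp_def] at h3
  exact h3

/-- The weak type `(1, 1)` inequality. -/
theorem mul_measure_maximalFn_gt_le (g : X → ℝ≥0∞) {l : ℝ≥0∞}
    (hl : l ≠ 0) :
    l * μ {x | l < maximalFn μ g x} ≤ 4 ^ Module.finrank ℝ X * ∫⁻ x, g x ∂μ := by
  rcases eq_or_ne l ⊤ with rfl | hl'
  · simp
  -- Truncate the radii, so that Vitali's covering lemma applies.
  have key : ∀ N : ℕ, l * μ {x | ∃ n : ℤ, n ≤ N ∧ l < ballAverage μ g n x} ≤
      4 ^ Module.finrank ℝ X * ∫⁻ x, g x ∂μ := by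
    intro N
    set O := {x | ∃ n : ℤ, n ≤ N ∧ l < ballAverage μ g n x} with hO
    have hn : ∀ x : X, ∃ n : ℤ, x ∈ O → n ≤ N ∧ l < ballAverage μ g n x := by
      intro x
      by_cases hx : x ∈ O
      · obtain ⟨n, hn⟩ := hx
        exact ⟨n, fun _ => hn⟩
      · exact ⟨0, fun h => absurd h hx⟩
    choose n hn using hn
    obtain ⟨u, huO, hdisj, hcov⟩ := Vitali.exists_disjoint_subfamily_covering_enlargement_ball
      O id (fun x => (2 : ℝ) ^ n x) ((2 : ℝ) ^ (N : ℤ))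
      (fun x hx => zpow_le_zpow_right₀ one_le_two (hn x hx).1) 4 (by norm_num)
    have hucount : u.Countable := by
      refine hdisj.countable_of_isOpen (fun x _ => Metric.isOpen_ball) fun x _ => ?_
      exact ⟨x, Metric.mem_ball_self (by positivity)⟩
    have hball : ∀ x ∈ u, l * μ (Metric.ball x (4 * 2 ^ n x : ℝ)) ≤
        4 ^ Module.finrank ℝ X * ∫⁻ y in Metric.ball x (2 ^ n x : ℝ), g y ∂μ := by
      intro x hx
      have h1 := (hn x (huO hx)).2
      have hpos : (0 : ℝ) < 2 ^ n x := by positivity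
      have h0 := (Metric.measure_ball_pos μ x hpos).ne'
      have ht : μ (Metric.ball x (2 ^ n x : ℝ)) ≠ ⊤ := measure_ball_lt_top.ne
      have h2 : l * μ (Metric.ball x (2 ^ n x : ℝ)) ≤
          ∫⁻ y in Metric.ball x (2 ^ n x : ℝ), g y ∂μ := by
        rw [← ENNReal.le_div_iff_mul_le (Or.inl h0) (Or.inl ht), ENNReal.div_eq_inv_mul]
        exact h1.le
      calc l * μ (Metric.ball x (4 * 2 ^ n x : ℝ))
          ≤ l * μ (Metric.closedBall x (4 * 2 ^ n x : ℝ)) := by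
            gcongr
            exact Metric.ball_subset_closedBall
        _ = 4 ^ Module.finrank ℝ X * (l * μ (Metric.ball x (2 ^ n x : ℝ))) := by
            rw [measure_ball_mul μ x x hpos (by norm_num)]
            simp only [ENNReal.ofReal_ofNat]
            ring
        _ ≤ _ := by gcongr
    have hsub : O ⊆ ⋃ x ∈ u, Metric.ball x (4 * 2 ^ n x : ℝ) := by
      intro x hx
      obtain ⟨b, hb, hxb⟩ := hcov x hx
      exact mem_biUnion hb (hxb (Metric.mem_ball_self (by positivity)))
    calc l * μ O ≤ l * ∑' x : u, μ (Metric.ball (x : X) (4 * 2 ^ n x : ℝ)) := by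
          gcongr
          exact (measure_mono hsub).trans (measure_biUnion_le μ hucount _)
      _ = ∑' x : u, l * μ (Metric.ball (x : X) (4 * 2 ^ n x : ℝ)) := ENNReal.tsum_mul_left.symm
      _ ≤ ∑' x : u, 4 ^ Module.finrank ℝ X * ∫⁻ y in Metric.ball (x : X) (2 ^ n x : ℝ), g y ∂μ :=
          ENNReal.tsum_le_tsum fun x => hball x x.2
      _ = 4 ^ Module.finrank ℝ X * ∫⁻ y in ⋃ x ∈ u, Metric.ball x (2 ^ n x : ℝ), g y ∂μ := by
          rw [ENNReal.tsum_mul_left]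
          congr 1
          exact (lintegral_biUnion hucount (fun x _ => measurableSet_ball) hdisj _).symm
      _ ≤ _ := by
          gcongr
          exact Measure.restrict_le_self
  have hU : {x | l < maximalFn μ g x} =
      ⋃ N : ℕ, {x | ∃ n : ℤ, n ≤ N ∧ l < ballAverage μ g n x} := by
    ext x
    simp only [mem_ofPred_eq, mem_iUnion, maximalFn, lt_iSup_iff]
    constructor
    · rintro ⟨n, hn⟩
      exact ⟨n.toNat, n, Int.self_le_toNat n, hn⟩
    · rintro ⟨N, n, -, hn⟩
      exact ⟨n, hn⟩
  have hmono : Monotone fun N : ℕ => {x | ∃ n : ℤ, n ≤ N ∧ l < ballAverage μ g n x} := by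
    rintro N N' h x ⟨n, hn, hx⟩
    exact ⟨n, hn.trans (by exact_mod_cast h), hx⟩
  rw [hU, hmono.measure_iUnion, ENNReal.mul_iSup]
  exact iSup_le key

/-- The Hardy–Littlewood maximal theorem: `M` is bounded on `L^q`, `q > 1`. -/
theorem exists_lintegral_maximalFn_rpow_le {q : ℝ} (hq : 1 < q) :
    ∃ C : ℝ≥0, ∀ g : X → ℝ≥0∞, Measurable g →
      ∫⁻ x, maximalFn μ g x ^ q ∂μ ≤ C * ∫⁻ x, g x ^ q ∂μ := by
  set D := Module.finrank ℝ X
  have hq0 : 0 < q := by linarith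
  have hq1 : 0 < q - 1 := by linarith
  have hCtop : ENNReal.ofReal q * (2 * 4 ^ D * ((ENNReal.ofReal (q - 1))⁻¹ * 2 ^ (q - 1))) ≠ ⊤ := by
    refine ENNReal.mul_ne_top (by simp) (ENNReal.mul_ne_top ?_ (ENNReal.mul_ne_top ?_ ?_))
    · exact ENNReal.mul_ne_top (by simp) (by simp)
    · simpa using hq1
    · exact ENNReal.rpow_ne_top_of_nonneg hq1.le (by simp)
  refine ⟨ENNReal.toNNReal
    (ENNReal.ofReal q * (2 * 4 ^ D * ((ENNReal.ofReal (q - 1))⁻¹ * 2 ^ (q - 1)))), fun g hg => ?_⟩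
  rw [ENNReal.coe_toNNReal hCtop]
  have hM := measurable_maximalFn μ hg
  -- Only the part of `g` above `l / 2` contributes to the level set `{M g > l}`.
  have hweak : ∀ l : ℝ, 0 < l → μ {x | ENNReal.ofReal l < maximalFn μ g x} ≤
      2 * 4 ^ D * (ENNReal.ofReal l)⁻¹ *
        ∫⁻ x, {x | ENNReal.ofReal l < 2 * g x}.indicator g x ∂μ := by
    intro l hl
    set g₁ : X → ℝ≥0∞ := {x | ENNReal.ofReal l < 2 * g x}.indicator g
    have hg₁ : Measurable g₁ := hg.indicator (measurableSet_lt measurable_const (by fun_prop))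
    have hle : g ≤ g₁ + fun _ => ENNReal.ofReal (l / 2) := by
      intro x
      by_cases hx : ENNReal.ofReal l < 2 * g x
      · simp [g₁, hx]
      · have h3 : 2 * g x ≤ ENNReal.ofReal l := not_lt.1 hx
        have : g x ≤ ENNReal.ofReal (l / 2) := by
          rw [ENNReal.ofReal_div_of_pos two_pos, ENNReal.le_div_iff_mul_le (by simp) (by simp),
            mul_comm]
          simpa using h3
        simpa [g₁, hx] using this
    have hsub : {x | ENNReal.ofReal l < maximalFn μ g x} ⊆
        {x | ENNReal.ofReal (l / 2) < maximalFn μ g₁ x} := by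
      intro x hx
      by_contra hcon
      simp only [mem_ofPred_eq, not_lt] at hcon hx
      have h4 : maximalFn μ g x ≤ ENNReal.ofReal (l / 2) + ENNReal.ofReal (l / 2) :=
        (maximalFn_mono μ hle x).trans ((maximalFn_add_le μ hg₁ x).trans
          (add_le_add hcon (maximalFn_const_le μ _ x)))
      rw [← ENNReal.ofReal_add (by positivity) (by positivity), add_halves] at h4
      exact absurd hx (not_lt.2 h4)
    have hl2 : ENNReal.ofReal (l / 2) ≠ 0 := by simpa using hl
    have h5 := mul_measure_maximalFn_gt_le μ g₁ hl2
    calc μ {x | ENNReal.ofReal l < maximalFn μ g x}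
        ≤ μ {x | ENNReal.ofReal (l / 2) < maximalFn μ g₁ x} := measure_mono hsub
      _ = (ENNReal.ofReal (l / 2))⁻¹ * (ENNReal.ofReal (l / 2) *
          μ {x | ENNReal.ofReal (l / 2) < maximalFn μ g₁ x}) := by
          rw [← mul_assoc, ENNReal.inv_mul_cancel hl2 (by simp), one_mul]
      _ ≤ (ENNReal.ofReal (l / 2))⁻¹ * (4 ^ D * ∫⁻ x, g₁ x ∂μ) := by gcongr
      _ = _ := by
          rw [ENNReal.ofReal_div_of_pos two_pos, ENNReal.inv_div (by simp) (by simp),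
            ENNReal.div_eq_inv_mul]
          simp only [ENNReal.ofReal_ofNat]
          ring
  have hmeas1 : Measurable fun z : X × ℝ => ENNReal.ofReal (z.2 ^ (q - 1)) *
      {l : ℝ | ENNReal.ofReal l < maximalFn μ g z.1}.indicator (1 : ℝ → ℝ≥0∞) z.2 := by
    refine Measurable.mul (by fun_prop) ?_
    have : MeasurableSet {z : X × ℝ | ENNReal.ofReal z.2 < maximalFn μ g z.1} :=
      measurableSet_lt (by fun_prop) (by fun_prop)
    exact (measurable_const (a := (1 : ℝ≥0∞))).indicator this
  have hmeas2 : Measurable fun z : X × ℝ => ENNReal.ofReal (z.2 ^ (q - 1 - 1)) *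
      {l : ℝ | ENNReal.ofReal l < 2 * g z.1}.indicator (1 : ℝ → ℝ≥0∞) z.2 := by
    refine Measurable.mul (by fun_prop) ?_
    have : MeasurableSet {z : X × ℝ | ENNReal.ofReal z.2 < 2 * g z.1} :=
      measurableSet_lt (by fun_prop) (by fun_prop)
    exact (measurable_const (a := (1 : ℝ≥0∞))).indicator this
  have hcake : ∀ x, maximalFn μ g x ^ q = ENNReal.ofReal q * ∫⁻ l in Ioi (0 : ℝ),
      ENNReal.ofReal (l ^ (q - 1)) *
        {l : ℝ | ENNReal.ofReal l < maximalFn μ g x}.indicator 1 l := by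
    intro x
    rw [ofReal_rpow_eq_lintegral hq0, ← mul_assoc,
      ENNReal.mul_inv_cancel (by simpa using hq0) (by simp), one_mul]
  simp_rw [hcake]
  rw [lintegral_const_mul' _ _ (by simp), mul_assoc]
  gcongr
  rw [lintegral_lintegral_swap hmeas1.aemeasurable]
  calc ∫⁻ l in Ioi (0 : ℝ), ∫⁻ x, ENNReal.ofReal (l ^ (q - 1)) *
        {l : ℝ | ENNReal.ofReal l < maximalFn μ g x}.indicator 1 l ∂μ
      ≤ ∫⁻ l in Ioi (0 : ℝ), ∫⁻ x, 2 * 4 ^ D * (g x * (ENNReal.ofReal (l ^ (q - 1 - 1)) *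
        {l : ℝ | ENNReal.ofReal l < 2 * g x}.indicator 1 l)) ∂μ := by
        refine setLIntegral_mono_ae' measurableSet_Ioi (Eventually.of_forall fun l hl => ?_)
        have hl : 0 < l := hl
        have e1 : ∫⁻ x, {l : ℝ | ENNReal.ofReal l < maximalFn μ g x}.indicator 1 l ∂μ
            = μ {x | ENNReal.ofReal l < maximalFn μ g x} := by
          rw [← lintegral_indicator_one (measurableSet_lt measurable_const hM)]
          rfl
        have e2 : ∫⁻ x, g x * (ENNReal.ofReal (l ^ (q - 1 - 1)) *
            {l : ℝ | ENNReal.ofReal l < 2 * g x}.indicator 1 l) ∂μ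
            = ENNReal.ofReal (l ^ (q - 1 - 1)) *
              ∫⁻ x, {x | ENNReal.ofReal l < 2 * g x}.indicator g x ∂μ := by
          rw [← lintegral_const_mul' _ _ (by simp)]
          congr 1 with x
          by_cases hx : ENNReal.ofReal l < 2 * g x <;> simp [indicator, mul_comm]
        have hpow : l ^ (q - 1 - 1) = l ^ (q - 1) * l⁻¹ := by
          rw [Real.rpow_sub_one hl.ne', div_eq_mul_inv]
        rw [lintegral_const_mul' _ _ (by simp), e1, lintegral_const_mul' _ _
          (ENNReal.mul_ne_top (by simp) (by simp)), e2, hpow,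
          ENNReal.ofReal_mul (by positivity), ENNReal.ofReal_inv_of_pos hl]
        calc _ ≤ ENNReal.ofReal (l ^ (q - 1)) * _ := mul_le_mul_right (hweak l hl) _
          _ = _ := by ring
    _ = ∫⁻ x, (∫⁻ l in Ioi (0 : ℝ), 2 * 4 ^ D * (g x * (ENNReal.ofReal (l ^ (q - 1 - 1)) *
        {l : ℝ | ENNReal.ofReal l < 2 * g x}.indicator 1 l))) ∂μ := by
        refine (lintegral_lintegral_swap ?_).symm
        exact (measurable_const.mul ((hg.comp measurable_fst).mul hmeas2)).aemeasurable
    _ = ∫⁻ x, 2 * 4 ^ D * ((ENNReal.ofReal (q - 1))⁻¹ * 2 ^ (q - 1)) * g x ^ q ∂μ := by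
        refine lintegral_congr fun x => ?_
        have hm : Measurable fun l : ℝ => ENNReal.ofReal (l ^ (q - 1 - 1)) *
            {l : ℝ | ENNReal.ofReal l < 2 * g x}.indicator (1 : ℝ → ℝ≥0∞) l :=
          hmeas2.comp (measurable_const.prodMk measurable_id)
        rw [lintegral_const_mul _ (by fun_prop), lintegral_const_mul _ hm,
          ofReal_rpow_eq_lintegral hq1, ENNReal.mul_rpow_of_nonneg _ _ hq1.le]
        have : g x ^ q = g x * g x ^ (q - 1) := by
          conv_lhs => rw [show q = 1 + (q - 1) by ring]
          rw [ENNReal.rpow_add_of_nonneg _ _ zero_le_one hq1.le, ENNReal.rpow_one]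
        rw [this]
        ring
    _ = _ := lintegral_const_mul _ (hg.pow_const q)
    _ ≤ _ := by rw [mul_assoc]

end maximal

/-! ### Bounded functions with bounded support and their convolutions -/

section conv

variable {E : Type*} [NormedAddCommGroup E] [NormedSpace ℝ E] [MeasureSpace E] [BorelSpace E]
  [FiniteDimensional ℝ E] [(volume : Measure E).IsAddHaarMeasure]
  {F : Type*} [NormedAddCommGroup F] [NormedSpace ℝ F]

/-- Strongly measurable bounded functions with bounded support. On this class convolutions exist
everywhere, and Fubini's theorem applies without further ado. -/
structure IsBoundedBddSupport (q : E → F) : Prop where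
  stronglyMeasurable : StronglyMeasurable q
  exists_bound : ∃ M, ∀ x, ‖q x‖ ≤ M
  exists_radius : ∃ R, ∀ x, R < ‖x‖ → q x = 0

/-- The convolution `∫ φ(z) q(x - z) dz` of a scalar with a vector valued function. -/
noncomputable def conv (φ : E → ℝ) (q : E → F) (x : E) : F := ∫ z, φ z • q (x - z)

theorem _root_.Continuous.isBoundedBddSupport {q : E → F}
    (hq : Continuous q) (hs : HasCompactSupport q) : IsBoundedBddSupport q where
  stronglyMeasurable := hq.stronglyMeasurable
  exists_bound := hs.exists_bound_of_continuous hq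
  exists_radius := by
    obtain ⟨R, hR⟩ := hs.isCompact.isBounded.subset_closedBall (0 : E)
    refine ⟨R, fun x hx => by_contra fun h => ?_⟩
    have := hR (subset_tsupport q h)
    simp at this
    linarith

namespace IsBoundedBddSupport

variable {q q' : E → F} {φ φ' : E → ℝ}

theorem integrable (hq : IsBoundedBddSupport q) : Integrable q := by
  obtain ⟨M, hM⟩ := hq.exists_bound
  obtain ⟨R, hR⟩ := hq.exists_radius
  have h : IntegrableOn q (Metric.closedBall 0 R) :=
    Measure.integrableOn_of_bounded (M := M) measure_closedBall_lt_top.ne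
      hq.stronglyMeasurable.aestronglyMeasurable (Eventually.of_forall hM)
  refine (integrableOn_iff_integrable_of_support_subset fun x hx => ?_).1 h
  by_contra hcon
  exact hx (hR x (by simpa using hcon))

theorem norm_sq (hq : IsBoundedBddSupport q) : IsBoundedBddSupport fun x => ‖q x‖ ^ 2 where
  stronglyMeasurable := hq.stronglyMeasurable.norm.pow 2
  exists_bound := by
    obtain ⟨M, hM⟩ := hq.exists_bound
    exact ⟨M ^ 2, fun x => by simpa using pow_le_pow_left₀ (norm_nonneg _) (hM x) 2⟩
  exists_radius := by simpa using hq.exists_radius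

theorem add (hq : IsBoundedBddSupport q) (hq' : IsBoundedBddSupport q') :
    IsBoundedBddSupport fun x => q x + q' x where
  stronglyMeasurable := hq.stronglyMeasurable.add hq'.stronglyMeasurable
  exists_bound := by
    obtain ⟨M, hM⟩ := hq.exists_bound
    obtain ⟨M', hM'⟩ := hq'.exists_bound
    exact ⟨M + M', fun x => (norm_add_le _ _).trans (add_le_add (hM x) (hM' x))⟩
  exists_radius := by
    obtain ⟨R, hR⟩ := hq.exists_radius
    obtain ⟨R', hR'⟩ := hq'.exists_radius
    refine ⟨max R R', fun x hx => ?_⟩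
    rw [hR x ((le_max_left _ _).trans_lt hx), hR' x ((le_max_right _ _).trans_lt hx), add_zero]

theorem const_smul (hq : IsBoundedBddSupport q) (c : ℝ) :
    IsBoundedBddSupport fun x => c • q x where
  stronglyMeasurable := hq.stronglyMeasurable.const_smul c
  exists_bound := by
    obtain ⟨M, hM⟩ := hq.exists_bound
    exact ⟨|c| * M, fun x => by
      rw [norm_smul, Real.norm_eq_abs]; exact mul_le_mul_of_nonneg_left (hM x) (abs_nonneg c)⟩
  exists_radius := by
    obtain ⟨R, hR⟩ := hq.exists_radius
    exact ⟨R, fun x hx => by rw [hR x hx, smul_zero]⟩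

theorem sub (hq : IsBoundedBddSupport q) (hq' : IsBoundedBddSupport q') :
    IsBoundedBddSupport fun x => q x - q' x := by
  simpa [sub_eq_add_neg] using hq.add (hq'.const_smul (-1))

theorem sum {ι : Type*} (s : Finset ι) {q : ι → E → F} (hq : ∀ i, IsBoundedBddSupport (q i)) :
    IsBoundedBddSupport fun x => ∑ i ∈ s, q i x := by
  classical
  induction s using Finset.induction_on with
  | empty => exact ⟨by simpa using stronglyMeasurable_const, ⟨0, by simp⟩, ⟨0, by simp⟩⟩
  | insert i s hi ih =>
    simp only [Finset.sum_insert hi]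
    exact (hq i).add ih

theorem indicator (hq : IsBoundedBddSupport q) {s : Set E} (hs : MeasurableSet s) :
    IsBoundedBddSupport (s.indicator q) where
  stronglyMeasurable := hq.stronglyMeasurable.indicator hs
  exists_bound := by
    obtain ⟨M, hM⟩ := hq.exists_bound
    exact ⟨M, fun x => (norm_indicator_le_norm_self q x).trans (hM x)⟩
  exists_radius := by
    obtain ⟨R, hR⟩ := hq.exists_radius
    refine ⟨R, fun x hx => ?_⟩
    by_cases h : x ∈ s <;> simp [h, hR x hx]

theorem integrable_smul_comp_sub (hφ : IsBoundedBddSupport φ) (hq : IsBoundedBddSupport q) (x : E) :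
    Integrable fun z => φ z • q (x - z) := by
  obtain ⟨M, hM⟩ := hq.exists_bound
  refine Integrable.mono' (hφ.integrable.norm.mul_const M) ?_ (Eventually.of_forall fun z => ?_)
  · exact (hφ.stronglyMeasurable.smul
      (hq.stronglyMeasurable.comp_measurable (by fun_prop))).aestronglyMeasurable
  · rw [norm_smul]
    exact mul_le_mul_of_nonneg_left (hM _) (norm_nonneg _)

theorem conv (hφ : IsBoundedBddSupport φ) (hq : IsBoundedBddSupport q) :
    IsBoundedBddSupport (conv φ q) where
  stronglyMeasurable := by
    have : StronglyMeasurable fun w : E × E => φ w.2 • q (w.1 - w.2) :=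
      (hφ.stronglyMeasurable.comp_measurable measurable_snd).smul
        (hq.stronglyMeasurable.comp_measurable (by fun_prop))
    exact this.integral_prod_right
  exists_bound := by
    obtain ⟨M, hM⟩ := hq.exists_bound
    refine ⟨∫ z, ‖φ z‖ * M, fun x => norm_integral_le_of_norm_le (hφ.integrable.norm.mul_const M)
      (Eventually.of_forall fun z => ?_)⟩
    rw [norm_smul]
    exact mul_le_mul_of_nonneg_left (hM _) (norm_nonneg _)
  exists_radius := by
    obtain ⟨R, hR⟩ := hφ.exists_radius
    obtain ⟨R', hR'⟩ := hq.exists_radius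
    refine ⟨R + R', fun x hx => ?_⟩
    have : ∀ z, φ z • q (x - z) = 0 := by
      intro z
      by_cases hz : R < ‖z‖
      · rw [hR z hz, zero_smul]
      · rw [hR' (x - z), smul_zero]
        have := norm_sub_norm_le x z
        linarith
    simp [LittlewoodPaley.conv, this]

end IsBoundedBddSupport

variable {q q' : E → F} {φ φ' : E → ℝ}

theorem conv_add_left (hφ : IsBoundedBddSupport φ) (hφ' : IsBoundedBddSupport φ')
    (hq : IsBoundedBddSupport q) (x : E) :
    conv (fun z => φ z + φ' z) q x = conv φ q x + conv φ' q x := by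
  simp only [conv, add_smul]
  exact integral_add (hφ.integrable_smul_comp_sub hq x) (hφ'.integrable_smul_comp_sub hq x)

theorem conv_sub_left (hφ : IsBoundedBddSupport φ) (hφ' : IsBoundedBddSupport φ')
    (hq : IsBoundedBddSupport q) (x : E) :
    conv (fun z => φ z - φ' z) q x = conv φ q x - conv φ' q x := by
  simp only [conv, sub_smul]
  exact integral_sub (hφ.integrable_smul_comp_sub hq x) (hφ'.integrable_smul_comp_sub hq x)

theorem conv_sub_right (hφ : IsBoundedBddSupport φ) (hq : IsBoundedBddSupport q)
    (hq' : IsBoundedBddSupport q') (x : E) :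
    conv φ (fun z => q z - q' z) x = conv φ q x - conv φ q' x := by
  simp only [conv, smul_sub]
  exact integral_sub (hφ.integrable_smul_comp_sub hq x) (hφ.integrable_smul_comp_sub hq' x)

theorem conv_const_smul_left (c : ℝ) (x : E) :
    conv (fun z => c * φ z) q x = c • conv φ q x := by
  simp only [conv, mul_smul]
  exact integral_smul c _

theorem conv_comm (φ φ' : E → ℝ) : conv φ φ' = conv φ' φ := by
  ext x
  simp only [conv]
  rw [← integral_sub_left_eq_self _ _ x]
  simp [mul_comm]

variable [CompleteSpace F]

theorem conv_assoc (hφ : IsBoundedBddSupport φ) (hφ' : IsBoundedBddSupport φ')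
    (hq : IsBoundedBddSupport q) : conv (conv φ φ') q = conv φ (conv φ' q) := by
  ext x
  have hint : Integrable (fun p : E × E => (φ p.2 * φ' (p.1 - p.2)) • q (x - p.1))
      (volume.prod volume) := by
    obtain ⟨M, hM⟩ := hφ'.exists_bound
    have h1 : Integrable (fun p : E × E => ‖q (x - p.1)‖ * ‖φ p.2‖) (volume.prod volume) :=
      (hq.integrable.comp_sub_left x).norm.mul_prod hφ.integrable.norm
    refine (h1.const_mul M).mono' ?_ (Eventually.of_forall fun p => ?_)
    · refine StronglyMeasurable.aestronglyMeasurable ?_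
      exact ((hφ.stronglyMeasurable.comp_measurable measurable_snd).mul
        (hφ'.stronglyMeasurable.comp_measurable (by fun_prop))).smul
        (hq.stronglyMeasurable.comp_measurable (by fun_prop))
    · rw [norm_smul, norm_mul]
      have := mul_le_mul_of_nonneg_left (hM (p.1 - p.2))
        (mul_nonneg (norm_nonneg (q (x - p.1))) (norm_nonneg (φ p.2)))
      linarith
  calc conv (conv φ φ') q x = ∫ w, ∫ z, (φ z * φ' (w - z)) • q (x - w) := by
        simp only [conv, smul_eq_mul]
        refine integral_congr_ae (Eventually.of_forall fun w => ?_)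
        exact (integral_smul_const _ _).symm
    _ = ∫ z, ∫ w, (φ z * φ' (w - z)) • q (x - w) := integral_integral_swap hint
    _ = conv φ (conv φ' q) x := by
        simp only [conv]
        refine integral_congr_ae (Eventually.of_forall fun z => ?_)
        simp only [mul_smul]
        rw [integral_smul, ← integral_add_right_eq_self _ z]
        simp only [add_sub_cancel_right, sub_add_eq_sub_sub_swap]

end conv

section inner

open scoped InnerProductSpace

variable {E : Type*} [NormedAddCommGroup E] [NormedSpace ℝ E] [MeasureSpace E] [BorelSpace E]
  [FiniteDimensional ℝ E] [(volume : Measure E).IsAddHaarMeasure]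
  {H : Type*} [NormedAddCommGroup H] [InnerProductSpace ℝ H] {q q' : E → H} {φ : E → ℝ}

theorem IsBoundedBddSupport.inner (hq : IsBoundedBddSupport q) (hq' : IsBoundedBddSupport q') :
    IsBoundedBddSupport fun x => ⟪q x, q' x⟫_ℝ where
  stronglyMeasurable := hq.stronglyMeasurable.inner hq'.stronglyMeasurable
  exists_bound := by
    obtain ⟨M, hM⟩ := hq.exists_bound
    obtain ⟨M', hM'⟩ := hq'.exists_bound
    exact ⟨M * M', fun x => (norm_inner_le_norm _ _).trans
      (mul_le_mul (hM x) (hM' x) (norm_nonneg _) ((norm_nonneg _).trans (hM x)))⟩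
  exists_radius := by
    obtain ⟨R, hR⟩ := hq.exists_radius
    exact ⟨R, fun x hx => by rw [hR x hx, inner_zero_left]⟩

variable [CompleteSpace H]

theorem integral_inner_conv (hφ : IsBoundedBddSupport φ) (hq : IsBoundedBddSupport q)
    (hq' : IsBoundedBddSupport q') :
    ∫ x, ⟪conv φ q x, q' x⟫_ℝ = ∫ z, φ z * ∫ x, ⟪q (x - z), q' x⟫_ℝ := by
  have hint : Integrable (fun p : E × E => φ p.2 * ⟪q (p.1 - p.2), q' p.1⟫_ℝ)
      (volume.prod volume) := by
    obtain ⟨M, hM⟩ := hq.exists_bound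
    have h1 : Integrable (fun p : E × E => ‖q' p.1‖ * ‖φ p.2‖) (volume.prod volume) :=
      hq'.integrable.norm.mul_prod hφ.integrable.norm
    refine (h1.const_mul M).mono' ?_ (Eventually.of_forall fun p => ?_)
    · refine StronglyMeasurable.aestronglyMeasurable ?_
      exact (hφ.stronglyMeasurable.comp_measurable measurable_snd).mul
        ((hq.stronglyMeasurable.comp_measurable (by fun_prop)).inner
        (hq'.stronglyMeasurable.comp_measurable measurable_fst))
    · rw [norm_mul]
      have h2 : ‖⟪q (p.1 - p.2), q' p.1⟫_ℝ‖ ≤ M * ‖q' p.1‖ :=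
        (norm_inner_le_norm _ _).trans (mul_le_mul_of_nonneg_right (hM _) (norm_nonneg _))
      have := mul_le_mul_of_nonneg_left h2 (norm_nonneg (φ p.2))
      linarith
  calc ∫ x, ⟪conv φ q x, q' x⟫_ℝ = ∫ x, ∫ z, φ z * ⟪q (x - z), q' x⟫_ℝ := by
        refine integral_congr_ae (Eventually.of_forall fun x => ?_)
        simp only [conv]
        rw [real_inner_comm, ← integral_inner (hφ.integrable_smul_comp_sub hq x)]
        refine integral_congr_ae (Eventually.of_forall fun z => ?_)
        simp only [inner_smul_right, real_inner_comm]
    _ = ∫ z, ∫ x, φ z * ⟪q (x - z), q' x⟫_ℝ := integral_integral_swap hint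
    _ = _ := by simp only [integral_const_mul]

/-- Convolution with an even function is symmetric. -/
theorem integral_inner_conv_comm (hφ : IsBoundedBddSupport φ) (heven : ∀ x, φ (-x) = φ x)
    (hq : IsBoundedBddSupport q) (hq' : IsBoundedBddSupport q') :
    ∫ x, ⟪conv φ q x, q' x⟫_ℝ = ∫ x, ⟪q x, conv φ q' x⟫_ℝ := by
  simp_rw [fun x => real_inner_comm (conv φ q' x) (q x)]
  rw [integral_inner_conv hφ hq hq', integral_inner_conv hφ hq' hq, ← integral_neg_eq_self]
  refine integral_congr_ae (Eventually.of_forall fun z => ?_)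
  simp only [heven, sub_neg_eq_add]
  rw [← integral_sub_right_eq_self _ z]
  simp only [sub_add_cancel, real_inner_comm]

/-- Schur's test in bilinear form. -/
theorem integral_inner_conv_le (hφ : IsBoundedBddSupport φ) (hq : IsBoundedBddSupport q)
    (hq' : IsBoundedBddSupport q') {c : ℝ} (hc : ∫ z, ‖φ z‖ ≤ c) :
    ∫ x, ⟪conv φ q x, q' x⟫_ℝ ≤ c * ((∫ x, ‖q x‖ ^ 2) / 2 + (∫ x, ‖q' x‖ ^ 2) / 2) := by
  rw [integral_inner_conv hφ hq hq']
  set N := (∫ x, ‖q x‖ ^ 2) / 2 + (∫ x, ‖q' x‖ ^ 2) / 2 with hN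
  have hN0 : 0 ≤ N := add_nonneg (by positivity) (by positivity)
  have h : ∀ z, ‖∫ x, ⟪q (x - z), q' x⟫_ℝ‖ ≤ N := by
    intro z
    have h1 : Integrable fun x => ‖q (x - z)‖ ^ 2 := hq.norm_sq.integrable.comp_sub_right z
    calc ‖∫ x, ⟪q (x - z), q' x⟫_ℝ‖ ≤ ∫ x, (‖q (x - z)‖ ^ 2 / 2 + ‖q' x‖ ^ 2 / 2) := by
          refine norm_integral_le_of_norm_le
            ((h1.div_const 2).add (hq'.norm_sq.integrable.div_const 2))
            (Eventually.of_forall fun x => (norm_inner_le_norm _ _).trans ?_)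
          nlinarith [sq_nonneg (‖q (x - z)‖ - ‖q' x‖)]
      _ = N := by
          rw [integral_add (h1.div_const 2) (hq'.norm_sq.integrable.div_const 2),
            integral_div, integral_div, integral_sub_right_eq_self (fun x => ‖q x‖ ^ 2) z]
  calc ∫ z, φ z * ∫ x, ⟪q (x - z), q' x⟫_ℝ ≤ ∫ z, ‖φ z‖ * N := by
        refine (le_abs_self _).trans ?_
        rw [← Real.norm_eq_abs]
        refine norm_integral_le_of_norm_le (hφ.integrable.norm.mul_const N)
          (Eventually.of_forall fun z => ?_)
        rw [norm_mul]
        exact mul_le_mul_of_nonneg_left (h z) (norm_nonneg _)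
    _ = (∫ z, ‖φ z‖) * N := integral_mul_const _ _
    _ ≤ c * N := mul_le_mul_of_nonneg_right hc hN0

end inner

/-! ### Lipschitz bumps at a given scale -/

section bump

variable {E : Type*} [NormedAddCommGroup E] [NormedSpace ℝ E] [MeasureSpace E] [BorelSpace E]
  [FiniteDimensional ℝ E] [(volume : Measure E).IsAddHaarMeasure]

/-- `φ` has the size, the Lipschitz constant and the support of the dilation
`v ^ (-d) * Φ (x / v)` of a fixed Lipschitz function `Φ` with bounded support; the constant `A`
measures all three. -/
structure IsBump (A v : ℝ) (φ : E → ℝ) : Prop where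
  abs_le : ∀ x, |φ x| ≤ A / v ^ Module.finrank ℝ E
  abs_sub_le : ∀ x y, |φ x - φ y| ≤ A / v ^ Module.finrank ℝ E * (‖x - y‖ / v)
  eq_zero : ∀ x, A * v < ‖x‖ → φ x = 0

namespace IsBump

variable {A B v : ℝ} {φ φ' : E → ℝ}

theorem nonneg (hv : 0 < v) (h : IsBump A v φ) : 0 ≤ A := by
  by_contra hA
  have h1 := (abs_nonneg _).trans (h.abs_le 0)
  have h2 : 0 < v ^ Module.finrank ℝ E := by positivity
  have := div_neg_of_neg_of_pos (not_le.1 hA) h2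
  linarith

theorem continuous (hv : 0 < v) (h : IsBump A v φ) : Continuous φ := by
  have hA := h.nonneg hv
  refine (LipschitzWith.of_dist_le_mul (K := ⟨A / v ^ Module.finrank ℝ E / v, by positivity⟩)
    fun x y => ?_).continuous
  rw [Real.dist_eq, dist_eq_norm]
  refine (h.abs_sub_le x y).trans (le_of_eq ?_)
  change _ = A / v ^ Module.finrank ℝ E / v * ‖x - y‖
  ring

theorem isBoundedBddSupport (hv : 0 < v) (h : IsBump A v φ) : IsBoundedBddSupport φ where
  stronglyMeasurable := (h.continuous hv).stronglyMeasurable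
  exists_bound := ⟨_, h.abs_le⟩
  exists_radius := ⟨_, h.eq_zero⟩

theorem mono (hv : 0 < v) (h : IsBump A v φ) (hAB : A ≤ B) : IsBump B v φ where
  abs_le x := (h.abs_le x).trans (by gcongr)
  abs_sub_le x y := (h.abs_sub_le x y).trans (by gcongr)
  eq_zero x hx := h.eq_zero x (lt_of_le_of_lt (by gcongr) hx)

theorem add (hv : 0 < v) (h : IsBump A v φ) (h' : IsBump B v φ') :
    IsBump (A + B) v fun x => φ x + φ' x where
  abs_le x := by
    rw [add_div]
    exact (abs_add_le _ _).trans (add_le_add (h.abs_le x) (h'.abs_le x))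
  abs_sub_le x y := by
    rw [add_div, add_mul, add_sub_add_comm]
    exact (abs_add_le _ _).trans (add_le_add (h.abs_sub_le x y) (h'.abs_sub_le x y))
  eq_zero x hx := by
    have hA := mul_nonneg (h.nonneg hv) hv.le
    have hB := mul_nonneg (h'.nonneg hv) hv.le
    rw [add_mul] at hx
    rw [h.eq_zero x (by linarith), h'.eq_zero x (by linarith), add_zero]

theorem const_mul (hv : 0 < v) (h : IsBump A v φ) {c : ℝ} (hc : 1 ≤ |c|) :
    IsBump (|c| * A) v fun x => c * φ x where
  abs_le x := by
    rw [abs_mul, mul_div_assoc]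
    exact mul_le_mul_of_nonneg_left (h.abs_le x) (abs_nonneg c)
  abs_sub_le x y := by
    rw [← mul_sub, abs_mul, mul_div_assoc, mul_assoc]
    exact mul_le_mul_of_nonneg_left (h.abs_sub_le x y) (abs_nonneg c)
  eq_zero x hx := by
    have hA := mul_nonneg (h.nonneg hv) hv.le
    rw [h.eq_zero x (by nlinarith), mul_zero]

theorem sub (hv : 0 < v) (h : IsBump A v φ) (h' : IsBump B v φ') :
    IsBump (A + B) v fun x => φ x - φ' x := by
  have := h.add hv (h'.const_mul hv (c := -1) (by simp))
  simpa [sub_eq_add_neg] using this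

/-- A bump at a larger, comparable scale is a bump at the given scale. -/
theorem of_scale_mul {s : ℝ} (hv : 0 < v) (hs : 1 ≤ s) (h : IsBump A (s * v) φ) :
    IsBump (s * A) v φ := by
  have hsv : 0 < s * v := by positivity
  have hA := h.nonneg hsv
  have hle : v ≤ s * v := le_mul_of_one_le_left hv.le hs
  have h1 : A / (s * v) ^ Module.finrank ℝ E ≤ s * A / v ^ Module.finrank ℝ E := by
    gcongr
    exact le_mul_of_one_le_left hA hs
  refine ⟨fun x => (h.abs_le x).trans h1, fun x y => (h.abs_sub_le x y).trans ?_, fun x hx => ?_⟩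
  · gcongr
  · exact h.eq_zero x (by linarith)

end IsBump

theorem integral_norm_le_of_bound {F : Type*} [NormedAddCommGroup F] {φ : E → F} {M R : ℝ}
    (hR : 0 ≤ R) (h : ∀ x, ‖φ x‖ ≤ M)
    (h0 : ∀ x, R < ‖x‖ → φ x = 0) :
    ∫ x, ‖φ x‖ ≤ M * (R ^ Module.finrank ℝ E * volume.real (Metric.ball (0 : E) 1)) := by
  have h1 : ∫ x, ‖φ x‖ = ∫ x in Metric.closedBall 0 R, ‖φ x‖ := by
    refine (setIntegral_eq_integral_of_forall_compl_eq_zero fun x hx => ?_).symm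
    rw [h0 x (by simpa using hx), norm_zero]
  rw [h1, ← Measure.addHaar_real_closedBall volume (0 : E) hR]
  refine (le_abs_self _).trans ?_
  rw [← Real.norm_eq_abs]
  exact norm_setIntegral_le_of_norm_le_const measure_closedBall_lt_top fun x _ => by simpa using h x

variable {A B v w : ℝ} {φ φ' : E → ℝ}

theorem IsBump.integral_norm_le (hv : 0 < v) (h : IsBump A v φ) :
    ∫ x, ‖φ x‖ ≤ A ^ (Module.finrank ℝ E + 1) * volume.real (Metric.ball (0 : E) 1) := by
  have hA := h.nonneg hv
  refine (integral_norm_le_of_bound (by positivity) h.abs_le h.eq_zero).trans (le_of_eq ?_)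
  rw [mul_pow]
  field_simp
  ring

theorem IsBump.conv (hv : 0 < v) (h : IsBump A v φ) (h' : IsBump B v φ') :
    IsBump (A * (B ^ (Module.finrank ℝ E + 1) * volume.real (Metric.ball (0 : E) 1)) + A + B) v
      (conv φ φ') := by
  set D := Module.finrank ℝ E
  set I := B ^ (D + 1) * volume.real (Metric.ball (0 : E) 1)
  have hA := h.nonneg hv
  have hB := h'.nonneg hv
  have hI : 0 ≤ I := by positivity
  have hq := h.isBoundedBddSupport hv
  have hq' := h'.isBoundedBddSupport hv
  have hle : A / v ^ D * I ≤ (A * I + A + B) / v ^ D := by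
    rw [div_mul_eq_mul_div]
    gcongr
    linarith
  rw [conv_comm]
  refine ⟨fun x => ?_, fun x y => ?_, fun x hx => ?_⟩
  · refine le_trans ?_ hle
    rw [← Real.norm_eq_abs]
    calc ‖LittlewoodPaley.conv φ' φ x‖ ≤ ∫ z, A / v ^ D * ‖φ' z‖ := by
          refine norm_integral_le_of_norm_le (hq'.integrable.norm.const_mul _)
            (Eventually.of_forall fun z => ?_)
          rw [norm_smul, mul_comm]
          exact mul_le_mul_of_nonneg_right (h.abs_le _) (norm_nonneg _)
      _ ≤ A / v ^ D * I := by
          rw [integral_const_mul]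
          exact mul_le_mul_of_nonneg_left (h'.integral_norm_le hv) (by positivity)
  · have hxy : 0 ≤ ‖x - y‖ / v := by positivity
    refine le_trans ?_ (mul_le_mul_of_nonneg_right hle hxy)
    rw [← Real.norm_eq_abs, LittlewoodPaley.conv, LittlewoodPaley.conv,
      ← integral_sub (hq'.integrable_smul_comp_sub hq x) (hq'.integrable_smul_comp_sub hq y)]
    calc ‖∫ z, φ' z • φ (x - z) - φ' z • φ (y - z)‖
        ≤ ∫ z, A / v ^ D * (‖x - y‖ / v) * ‖φ' z‖ := by
          refine norm_integral_le_of_norm_le (hq'.integrable.norm.const_mul _)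
            (Eventually.of_forall fun z => ?_)
          rw [← smul_sub, norm_smul, mul_comm]
          refine mul_le_mul_of_nonneg_right ?_ (norm_nonneg _)
          have := h.abs_sub_le (x - z) (y - z)
          rwa [sub_sub_sub_cancel_right] at this
      _ ≤ A / v ^ D * (‖x - y‖ / v) * I := by
          rw [integral_const_mul]
          exact mul_le_mul_of_nonneg_left (h'.integral_norm_le hv) (by positivity)
      _ = _ := by ring
  · have : ∀ z, φ' z • φ (x - z) = 0 := by
      intro z
      by_cases hz : B * v < ‖z‖
      · rw [h'.eq_zero z hz, zero_smul]
      · rw [h.eq_zero (x - z), smul_zero]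
        have h2 := norm_sub_norm_le x z
        have h3 : 0 ≤ A * I * v := by positivity
        nlinarith
    simp only [LittlewoodPaley.conv, this, integral_zero]

/-- The cancellation of the narrower bump against the smoothness of the wider one. -/
theorem IsBump.integral_norm_conv_le (hv : 0 < v) (hvw : v ≤ w) (h : IsBump A v φ)
    (h0 : ∫ x, φ x = 0) (h' : IsBump A w φ') :
    ∫ x, ‖LittlewoodPaley.conv φ φ' x‖ ≤ A ^ 2 * (A ^ (Module.finrank ℝ E + 1) *
      volume.real (Metric.ball (0 : E) 1)) *
      ((2 * A) ^ Module.finrank ℝ E * volume.real (Metric.ball (0 : E) 1)) * (v / w) := by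
  set D := Module.finrank ℝ E
  set I := A ^ (D + 1) * volume.real (Metric.ball (0 : E) 1)
  have hw : 0 < w := hv.trans_le hvw
  have hA := h.nonneg hv
  have hq := h.isBoundedBddSupport hv
  have hq' := h'.isBoundedBddSupport hw
  have hb : ∀ x, ‖LittlewoodPaley.conv φ φ' x‖ ≤ A / w ^ D * (A * v / w) * I := by
    intro x
    have e : LittlewoodPaley.conv φ φ' x = ∫ z, φ z * (φ' (x - z) - φ' x) := by
      have h1 : ∫ z, φ z * φ' x = 0 := by rw [integral_mul_const, h0, zero_mul]
      simp only [mul_sub]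
      refine Eq.trans ?_
        (integral_sub (hq.integrable_smul_comp_sub hq' x) (hq.integrable.mul_const _)).symm
      rw [h1, sub_zero]
      rfl
    rw [e]
    calc ‖∫ z, φ z * (φ' (x - z) - φ' x)‖ ≤ ∫ z, A / w ^ D * (A * v / w) * ‖φ z‖ := by
          refine norm_integral_le_of_norm_le (hq.integrable.norm.const_mul _)
            (Eventually.of_forall fun z => ?_)
          by_cases hz : A * v < ‖z‖
          · simp [h.eq_zero z hz]
          · rw [norm_mul, mul_comm]
            refine mul_le_mul_of_nonneg_right ?_ (norm_nonneg _)
            refine (h'.abs_sub_le (x - z) x).trans ?_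
            have : ‖x - z - x‖ ≤ A * v := by simpa using hz
            gcongr
      _ ≤ A / w ^ D * (A * v / w) * I := by
          rw [integral_const_mul]
          exact mul_le_mul_of_nonneg_left (h.integral_norm_le hv) (by positivity)
  have hs : ∀ x, 2 * A * w < ‖x‖ → LittlewoodPaley.conv φ φ' x = 0 := by
    intro x hx
    have : ∀ z, φ z • φ' (x - z) = 0 := by
      intro z
      by_cases hz : A * v < ‖z‖
      · rw [h.eq_zero z hz, zero_smul]
      · rw [h'.eq_zero (x - z), smul_zero]
        have h2 := norm_sub_norm_le x z
        nlinarith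
    simp only [LittlewoodPaley.conv, this, integral_zero]
  refine (integral_norm_le_of_bound (by positivity) hb hs).trans (le_of_eq ?_)
  rw [mul_pow]
  field_simp
  ring

variable (E) in
/-- The mass of the tent `max 0 (1 - ‖x‖)`. -/
noncomputable def tentMass : ℝ := ∫ x : E, max 0 (1 - ‖x‖)

/-- The tent of radius `v`, normalized to have integral one. -/
noncomputable def tent (v : ℝ) (x : E) : ℝ :=
  (tentMass E)⁻¹ / v ^ Module.finrank ℝ E * max 0 (1 - ‖x‖ / v)

theorem tentMass_pos : 0 < tentMass E := by
  have hc : Continuous fun x : E => max 0 (1 - ‖x‖) := by fun_prop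
  refine hc.integral_pos_of_hasCompactSupport_nonneg_nonzero (x := 0) ?_
    (fun x => le_max_left _ _) (by simp)
  refine HasCompactSupport.intro (isCompact_closedBall (0 : E) 1) fun x hx => ?_
  have : 1 < ‖x‖ := by simpa using hx
  exact max_eq_left (by linarith)

theorem tent_nonneg (hv : 0 < v) (x : E) : 0 ≤ tent v x := by
  have := tentMass_pos (E := E)
  unfold tent
  positivity

theorem tent_neg (x : E) : tent v (-x) = tent v x := by simp [tent]

theorem tent_eq_zero (hv : 0 < v) {x : E} (hx : v ≤ ‖x‖) : tent v x = 0 := by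
  have : 1 ≤ ‖x‖ / v := (one_le_div hv).2 hx
  rw [tent, max_eq_left (by linarith), mul_zero]

theorem integral_tent (hv : 0 < v) : ∫ x : E, tent v x = 1 := by
  have h1 : ∀ x : E, tent v x =
      (tentMass E)⁻¹ / v ^ Module.finrank ℝ E * max 0 (1 - ‖v⁻¹ • x‖) := by
    intro x
    rw [tent, norm_smul, Real.norm_eq_abs, abs_of_pos (inv_pos.2 hv), div_eq_inv_mul ‖x‖]
  simp_rw [h1]
  rw [integral_const_mul, Measure.integral_comp_inv_smul_of_nonneg volume
    (fun x : E => max 0 (1 - ‖x‖)) hv.le]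
  have := (tentMass_pos (E := E)).ne'
  change (tentMass E)⁻¹ / v ^ Module.finrank ℝ E * (v ^ Module.finrank ℝ E * tentMass E) = 1
  field_simp

theorem isBump_tent (hv : 0 < v) : IsBump ((tentMass E)⁻¹ + 1) v (tent v : E → ℝ) := by
  have hm := tentMass_pos (E := E)
  have hle : (tentMass E)⁻¹ / v ^ Module.finrank ℝ E ≤
      ((tentMass E)⁻¹ + 1) / v ^ Module.finrank ℝ E := by gcongr; linarith
  refine ⟨fun x => ?_, fun x y => ?_, fun x hx => ?_⟩
  · rw [abs_of_nonneg (tent_nonneg hv x)]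
    refine le_trans ?_ hle
    refine mul_le_of_le_one_right (by positivity) (max_le zero_le_one ?_)
    have : 0 ≤ ‖x‖ / v := by positivity
    linarith
  · rw [tent, tent, ← mul_sub, abs_mul, abs_of_nonneg (by positivity)]
    refine mul_le_mul hle ?_ (abs_nonneg _) (by positivity)
    refine (abs_max_sub_max_le_max _ _ _ _).trans ?_
    rw [sub_self, abs_zero, max_eq_right (abs_nonneg _), sub_sub_sub_cancel_left, ← sub_div,
      abs_div, abs_of_pos hv, abs_sub_comm]
    gcongr
    exact abs_norm_sub_norm_le x y
  · refine tent_eq_zero hv ?_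
    have : 0 < (tentMass E)⁻¹ := by positivity
    nlinarith

end bump

/-! ### A square function with compactly supported kernels -/

theorem summable_pow_natAbs {r : ℝ} (h0 : 0 ≤ r) (h1 : r < 1) :
    Summable fun n : ℤ => r ^ n.natAbs := by
  refine Summable.of_nat_of_neg ?_ ?_ <;> simpa using summable_geometric_of_lt_one h0 h1

theorem sum_pow_natAbs_sub_le {r : ℝ} (h0 : 0 ≤ r) (h1 : r < 1) (s : Finset ℤ) (i : ℤ) :
    ∑ l ∈ s, r ^ (i - l).natAbs ≤ ∑' n : ℤ, r ^ n.natAbs := by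
  have h := (Equiv.subLeft i).summable_iff.2 (summable_pow_natAbs h0 h1)
  rw [← (Equiv.subLeft i).tsum_eq]
  exact h.sum_le_tsum s fun _ _ => by positivity

section square

open scoped InnerProductSpace

variable {E : Type*} [NormedAddCommGroup E] [NormedSpace ℝ E] [MeasureSpace E] [BorelSpace E]
  [FiniteDimensional ℝ E] [(volume : Measure E).IsAddHaarMeasure]

variable (E) in
/-- Even mean-zero bumps at geometrically spaced scales are almost orthogonal. -/
theorem exists_sum_integral_conv_sq_le {β : ℝ} (hβ : 1 < β) (A : ℝ) :
    ∃ C : ℝ, 0 < C ∧ ∀ (H : Type*) [NormedAddCommGroup H] [InnerProductSpace ℝ H] [CompleteSpace H]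
      (φ : ℤ → E → ℝ), (∀ i, IsBump A (β ^ i) (φ i)) → (∀ i, ∫ x, φ i x = 0) →
      (∀ i x, φ i (-x) = φ i x) → ∀ q : E → H, IsBoundedBddSupport q → ∀ s : Finset ℤ,
      ∑ i ∈ s, ∫ x, ‖conv (φ i) q x‖ ^ 2 ≤ C * ∫ x, ‖q x‖ ^ 2 := by
  have hβ0 : 0 < β := by linarith
  set c₀ : ℝ := A ^ 2 * (A ^ (Module.finrank ℝ E + 1) *
      volume.real (Metric.ball (0 : E) 1)) *
      ((2 * A) ^ Module.finrank ℝ E * volume.real (Metric.ball (0 : E) 1)) with hc₀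
  set S : ℝ := ∑' n : ℤ, β⁻¹ ^ n.natAbs
  refine ⟨|c₀| * S + 1, ?_, ?_⟩
  · have : 0 ≤ S := tsum_nonneg fun n => by positivity
    positivity
  intro H _ _ _ φ hφ hφ0 heven q hq s
  have hS : 0 ≤ S := tsum_nonneg fun n => by positivity
  set C := |c₀| * S + 1
  have hC : 0 < C := by positivity
  have hpos : ∀ i : ℤ, (0 : ℝ) < β ^ i := fun i => by positivity
  have hn : ∀ i, IsBoundedBddSupport (φ i) := fun i => (hφ i).isBoundedBddSupport (hpos i)
  have hL1 : ∀ i l : ℤ, ∫ x, ‖conv (φ l) (φ i) x‖ ≤ |c₀| * β⁻¹ ^ (i - l).natAbs := by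
    intro i l
    have hquot : ∀ a b : ℤ, a ≤ b → β ^ a / β ^ b = β⁻¹ ^ (b - a).natAbs := by
      intro a b hab
      rw [← zpow_sub₀ hβ0.ne', inv_pow, ← zpow_natCast, ← zpow_neg,
        Int.natAbs_of_nonneg (by omega), neg_sub]
    rcases le_total l i with hli | hil
    · have := (hφ l).integral_norm_conv_le (hpos l) (zpow_le_zpow_right₀ hβ.le hli) (hφ0 l) (hφ i)
      rw [hquot l i hli, ← hc₀] at this
      exact this.trans (by gcongr; exact le_abs_self _)
    · have := (hφ i).integral_norm_conv_le (hpos i) (zpow_le_zpow_right₀ hβ.le hil) (hφ0 i) (hφ l)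
      rw [hquot i l hil, ← hc₀, ← Int.natAbs_neg, neg_sub] at this
      rw [conv_comm]
      exact this.trans (by gcongr; exact le_abs_self _)
  set g : ℤ → E → H := fun i => conv (φ i) q
  have hg : ∀ i, IsBoundedBddSupport (g i) := fun i => (hn i).conv hq
  set G : E → H := fun x => ∑ i ∈ s, conv (φ i) (g i) x
  have hG : IsBoundedBddSupport G := IsBoundedBddSupport.sum s fun i => (hn i).conv (hg i)
  set N : ℝ := ∑ i ∈ s, ∫ x, ‖g i x‖ ^ 2 with hN
  -- `N = ⟪q, G⟫` where `G = ∑ φᵢ ⋆ φᵢ ⋆ q`, and `‖G‖² ≤ C N` by Schur's test.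
  have h1 : N = ∫ x, ⟪q x, G x⟫_ℝ := by
    simp only [G, inner_sum]
    rw [integral_finsetSum _ fun i _ => (hq.inner ((hn i).conv (hg i))).integrable]
    refine Finset.sum_congr rfl fun i _ => ?_
    rw [← integral_inner_conv_comm (hn i) (heven i) hq (hg i)]
    simp only [real_inner_self_eq_norm_sq, g]
  have h2 : ∫ x, ‖G x‖ ^ 2 ≤ C * N := by
    have e : ∫ x, ‖G x‖ ^ 2 =
        ∑ i ∈ s, ∑ l ∈ s, ∫ x, ⟪conv (conv (φ l) (φ i)) (g i) x, g l x⟫_ℝ := by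
      simp only [← real_inner_self_eq_norm_sq, G, sum_inner, inner_sum]
      rw [integral_finsetSum _ fun i _ => ?_, Finset.sum_comm]
      · refine Finset.sum_congr rfl fun i _ => ?_
        rw [integral_finsetSum _ fun l _ =>
          (((hn l).conv (hg l)).inner ((hn i).conv (hg i))).integrable]
        refine Finset.sum_congr rfl fun l _ => ?_
        rw [← integral_inner_conv_comm (hn i) (heven i) ((hn l).conv (hg l)) (hg i),
          conv_assoc (hn i) (hn l) (hg l)]
      · exact integrable_finsetSum _ fun l _ =>
          (((hn l).conv (hg l)).inner ((hn i).conv (hg i))).integrable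
    rw [e]
    set n : ℤ → ℝ := fun i => ∫ x, ‖g i x‖ ^ 2 with hn_def
    have hn0 : ∀ i, 0 ≤ n i := fun i => by positivity
    calc ∑ i ∈ s, ∑ l ∈ s, ∫ x, ⟪conv (conv (φ l) (φ i)) (g i) x, g l x⟫_ℝ
        ≤ ∑ i ∈ s, ∑ l ∈ s, (|c₀| * β⁻¹ ^ (i - l).natAbs) * (n i / 2 + n l / 2) :=
          Finset.sum_le_sum fun i _ => Finset.sum_le_sum fun l _ =>
            integral_inner_conv_le ((hn l).conv (hn i)) (hg i) (hg l) (hL1 i l)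
      _ = |c₀| * ((∑ i ∈ s, (∑ l ∈ s, β⁻¹ ^ (i - l).natAbs) * (n i / 2)) +
          ∑ l ∈ s, (∑ i ∈ s, β⁻¹ ^ (l - i).natAbs) * (n l / 2)) := by
          simp only [mul_add, Finset.sum_add_distrib, Finset.mul_sum, Finset.sum_mul, mul_assoc]
          congr 1
          rw [Finset.sum_comm]
          refine Finset.sum_congr rfl fun l _ => Finset.sum_congr rfl fun i _ => ?_
          rw [← Int.natAbs_neg, neg_sub]
      _ ≤ |c₀| * ((∑ i ∈ s, S * (n i / 2)) + ∑ l ∈ s, S * (n l / 2)) := by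
          have hr1 : β⁻¹ < 1 := inv_lt_one_of_one_lt₀ hβ
          have hr0 : 0 ≤ β⁻¹ := by positivity
          have hle : ∀ i ∈ s, (∑ l ∈ s, β⁻¹ ^ (i - l).natAbs) * (n i / 2) ≤ S * (n i / 2) :=
            fun i _ => mul_le_mul_of_nonneg_right (sum_pow_natAbs_sub_le hr0 hr1 s i)
              (by have := hn0 i; positivity)
          exact mul_le_mul_of_nonneg_left
            (add_le_add (Finset.sum_le_sum hle) (Finset.sum_le_sum hle)) (abs_nonneg _)
      _ = |c₀| * S * N := by
          simp only [← Finset.mul_sum, ← Finset.sum_div, hN, hn_def]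
          ring
      _ ≤ C * N := by
          gcongr
          simp [C]
  have h3 : N ≤ ∫ x, (C / 2 * ‖q x‖ ^ 2 + 1 / (2 * C) * ‖G x‖ ^ 2) := by
    rw [h1]
    refine integral_mono (hq.inner hG).integrable
      ((hq.norm_sq.integrable.const_mul _).add (hG.norm_sq.integrable.const_mul _)) fun x => ?_
    refine (real_inner_le_norm _ _).trans ?_
    have : C / 2 * ‖q x‖ ^ 2 + 1 / (2 * C) * ‖G x‖ ^ 2 - ‖q x‖ * ‖G x‖ =
        1 / (2 * C) * (C * ‖q x‖ - ‖G x‖) ^ 2 := by field_simp; ring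
    have h4 : 0 ≤ 1 / (2 * C) * (C * ‖q x‖ - ‖G x‖) ^ 2 := by positivity
    linarith
  rw [integral_add (hq.norm_sq.integrable.const_mul _) (hG.norm_sq.integrable.const_mul _),
    integral_const_mul, integral_const_mul] at h3
  have h5 : 1 / (2 * C) * ∫ x, ‖G x‖ ^ 2 ≤ 1 / (2 * C) * (C * N) := by gcongr
  have h6 : 1 / (2 * C) * (C * N) = N / 2 := by field_simp
  linarith

end square

/-! ### A discrete Calderón reproducing formula -/

section calderon

variable {E : Type*} [NormedAddCommGroup E] [NormedSpace ℝ E] [MeasureSpace E] [BorelSpace E]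
  [FiniteDimensional ℝ E] [(volume : Measure E).IsAddHaarMeasure]
  {F : Type*} [NormedAddCommGroup F] [NormedSpace ℝ F]

/-- The difference of the averages at two consecutive scales. -/
noncomputable def tentDiff (β : ℝ) (i : ℤ) (x : E) : ℝ := tent (β ^ i) x - tent (β ^ (i + 1)) x

/-- The kernel of `3a + 3b - 2a² - 2ab - 2b²`, where `a` and `b` are the averages at two consecutive
scales. As `(a - b)(3a + 3b - 2a² - 2ab - 2b²) = (3a² - 2a³) - (3b² - 2b³)`, it complements
`tentDiff` to a telescoping sum; and as the polynomial vanishes at `a = b = 1`, it has mean zero. -/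
noncomputable def tentDual (β : ℝ) (i : ℤ) (x : E) : ℝ :=
  3 * tent (β ^ i) x + 3 * tent (β ^ (i + 1)) x - 2 * conv (tent (β ^ i)) (tent (β ^ i)) x
    - 2 * conv (tent (β ^ i)) (tent (β ^ (i + 1))) x
    - 2 * conv (tent (β ^ (i + 1))) (tent (β ^ (i + 1))) x

/-- The approximate identity `3a² - 2a³`, where `a` is the average at scale `v`. -/
noncomputable def tentApprox (v : ℝ) (h : E → F) (x : E) : F :=
  (3 : ℝ) • conv (tent v) (conv (tent v) h) x -
    (2 : ℝ) • conv (tent v) (conv (tent v) (conv (tent v) h)) x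

variable (E) in
theorem exists_isBump_tentDiff {β : ℝ} (hβ : 1 < β) :
    ∃ A, ∀ i : ℤ, IsBump A (β ^ i) (tentDiff β i : E → ℝ) := by
  refine ⟨((tentMass E)⁻¹ + 1) + β * ((tentMass E)⁻¹ + 1), fun i => ?_⟩
  have hv : (0 : ℝ) < β ^ i := by positivity
  have hw : (0 : ℝ) < β * β ^ i := by positivity
  have h2 : IsBump (β * ((tentMass E)⁻¹ + 1)) (β ^ i) (tent (β ^ (i + 1)) : E → ℝ) := by
    rw [zpow_add_one₀ (by positivity), mul_comm (β ^ i)]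
    exact (isBump_tent hw).of_scale_mul hv hβ.le
  exact (isBump_tent hv).sub hv h2

variable (E) in
theorem exists_isBump_tentDual {β : ℝ} (hβ : 1 < β) :
    ∃ A, ∀ i : ℤ, IsBump A (β ^ i) (tentDual β i : E → ℝ) := by
  let m : ℝ := (tentMass E)⁻¹ + 1
  let c : ℝ → ℝ → ℝ := fun a b =>
    a * (b ^ (Module.finrank ℝ E + 1) * volume.real (Metric.ball (0 : E) 1)) + a + b
  refine ⟨|3| * m + |3| * (β * m) + |2| * c m m + |2| * c m (β * m) + |2| * c (β * m) (β * m),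
    fun i => ?_⟩
  have hv : (0 : ℝ) < β ^ i := by positivity
  have hw : (0 : ℝ) < β * β ^ i := by positivity
  have h1 : IsBump ((tentMass E)⁻¹ + 1) (β ^ i) (tent (β ^ i) : E → ℝ) := isBump_tent hv
  have h2 : IsBump (β * ((tentMass E)⁻¹ + 1)) (β ^ i) (tent (β ^ (i + 1)) : E → ℝ) := by
    rw [zpow_add_one₀ (by positivity), mul_comm (β ^ i)]
    exact (isBump_tent hw).of_scale_mul hv hβ.le
  have h3 : (1 : ℝ) ≤ |3| := by norm_num
  have h4 : (1 : ℝ) ≤ |2| := by norm_num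
  exact ((((h1.const_mul hv h3).add hv (h2.const_mul hv h3)).sub hv
    ((h1.conv hv h1).const_mul hv h4)).sub hv ((h1.conv hv h2).const_mul hv h4)).sub hv
    ((h2.conv hv h2).const_mul hv h4)

theorem isBoundedBddSupport_tent {v : ℝ} (hv : 0 < v) :
    IsBoundedBddSupport (tent v : E → ℝ) := (isBump_tent hv).isBoundedBddSupport hv

theorem integral_conv {φ φ' : E → ℝ} (hφ : IsBoundedBddSupport φ) (hφ' : IsBoundedBddSupport φ') :
    ∫ x, conv φ φ' x = (∫ x, φ x) * ∫ x, φ' x :=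
  integral_convolution (ContinuousLinearMap.lsmul ℝ ℝ) hφ.integrable hφ'.integrable

theorem integral_tentDiff {β : ℝ} (hβ : 0 < β) (i : ℤ) : ∫ x : E, tentDiff β i x = 0 := by
  have hv : (0 : ℝ) < β ^ i := by positivity
  have hw : (0 : ℝ) < β ^ (i + 1) := by positivity
  simp only [tentDiff]
  rw [integral_sub (isBoundedBddSupport_tent hv).integrable
    (isBoundedBddSupport_tent hw).integrable, integral_tent hv, integral_tent hw, sub_self]

theorem tentDiff_neg (β : ℝ) (i : ℤ) (x : E) : tentDiff β i (-x) = tentDiff β i x := by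
  simp [tentDiff, tent_neg]

theorem integral_tentDual {β : ℝ} (hβ : 0 < β) (i : ℤ) : ∫ x : E, tentDual β i x = 0 := by
  have hv : (0 : ℝ) < β ^ i := by positivity
  have hw : (0 : ℝ) < β ^ (i + 1) := by positivity
  have ha : IsBoundedBddSupport (tent (β ^ i) : E → ℝ) := isBoundedBddSupport_tent hv
  have hb : IsBoundedBddSupport (tent (β ^ (i + 1)) : E → ℝ) := isBoundedBddSupport_tent hw
  have i1 := ha.integrable.const_mul 3
  have i2 := hb.integrable.const_mul 3
  have i3 := (ha.conv ha).integrable.const_mul 2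
  have i4 := (ha.conv hb).integrable.const_mul 2
  have i5 := (hb.conv hb).integrable.const_mul 2
  simp only [tentDual]
  have j2 : Integrable fun x : E => 3 * tent (β ^ i) x + 3 * tent (β ^ (i + 1)) x := i1.add i2
  have j3 : Integrable fun x : E => 3 * tent (β ^ i) x + 3 * tent (β ^ (i + 1)) x
      - 2 * conv (tent (β ^ i)) (tent (β ^ i)) x := j2.sub i3
  have j4 : Integrable fun x : E => 3 * tent (β ^ i) x + 3 * tent (β ^ (i + 1)) x
      - 2 * conv (tent (β ^ i)) (tent (β ^ i)) x
      - 2 * conv (tent (β ^ i)) (tent (β ^ (i + 1))) x := j3.sub i4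
  rw [integral_sub j4 i5, integral_sub j3 i4, integral_sub j2 i3, integral_add i1 i2]
  simp only [integral_const_mul, integral_conv ha ha, integral_conv ha hb, integral_conv hb hb,
    integral_tent hv, integral_tent hw]
  norm_num

variable [CompleteSpace F]

/-- The telescoping identity behind the reproducing formula. -/
theorem conv_tentDual_conv_tentDiff {β : ℝ} (hβ : 0 < β) (i : ℤ) {h : E → F}
    (hh : IsBoundedBddSupport h) (x : E) :
    conv (tentDual β i) (conv (tentDiff β i) h) x =
      tentApprox (β ^ i) h x - tentApprox (β ^ (i + 1)) h x := by
  have hv : (0 : ℝ) < β ^ i := by positivity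
  have hw : (0 : ℝ) < β ^ (i + 1) := by positivity
  have ha : IsBoundedBddSupport (tent (β ^ i) : E → ℝ) := isBoundedBddSupport_tent hv
  have hb : IsBoundedBddSupport (tent (β ^ (i + 1)) : E → ℝ) := isBoundedBddSupport_tent hw
  unfold tentApprox tentDual tentDiff
  set a : E → ℝ := tent (β ^ i)
  set b : E → ℝ := tent (β ^ (i + 1))
  have e1 : conv (fun x => a x - b x) h = fun x => conv a h x - conv b h x :=
    funext fun x => conv_sub_left ha hb hh x
  have hah := ha.conv hh
  have hbh := hb.conv hh
  have e2 : ∀ q : E → F, IsBoundedBddSupport q → ∀ x,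
      conv (fun x => 3 * a x + 3 * b x - 2 * conv a a x - 2 * conv a b x - 2 * conv b b x) q x =
        (3 : ℝ) • conv a q x + (3 : ℝ) • conv b q x - (2 : ℝ) • conv a (conv a q) x
          - (2 : ℝ) • conv a (conv b q) x - (2 : ℝ) • conv b (conv b q) x := by
    intro q hq x
    have j1 : IsBoundedBddSupport fun x => 3 * a x := ha.const_smul 3
    have j2 : IsBoundedBddSupport fun x => 3 * b x := hb.const_smul 3
    have j3 : IsBoundedBddSupport fun x => 2 * conv a a x := (ha.conv ha).const_smul 2
    have j4 : IsBoundedBddSupport fun x => 2 * conv a b x := (ha.conv hb).const_smul 2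
    have j5 : IsBoundedBddSupport fun x => 2 * conv b b x := (hb.conv hb).const_smul 2
    rw [conv_sub_left (((j1.add j2).sub j3).sub j4) j5 hq, conv_sub_left ((j1.add j2).sub j3) j4 hq,
      conv_sub_left (j1.add j2) j3 hq, conv_add_left j1 j2 hq]
    simp only [conv_const_smul_left]
    rw [conv_assoc ha ha hq, conv_assoc ha hb hq, conv_assoc hb hb hq]
  have hcomm : ∀ q : E → F, IsBoundedBddSupport q → conv b (conv a q) = conv a (conv b q) := by
    intro q hq
    rw [← conv_assoc hb ha hq, conv_comm, conv_assoc ha hb hq]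
  have e3 : ∀ φ : E → ℝ, IsBoundedBddSupport φ →
      conv φ (fun x => conv a h x - conv b h x) =
        fun x => conv φ (conv a h) x - conv φ (conv b h) x :=
    fun φ hφ => funext fun x => conv_sub_right hφ hah hbh x
  rw [e1, e2 _ (hah.sub hbh), e3 a ha, e3 b hb,
    conv_sub_right ha (ha.conv hah) (ha.conv hbh), conv_sub_right ha (hb.conv hah) (hb.conv hbh),
    conv_sub_right hb (hb.conv hah) (hb.conv hbh), hcomm h hh, hcomm _ hbh]
  module

theorem norm_conv_tent_sub_le {v ε η : ℝ} (hv : 0 < v) {g h : E → F} (hg : IsBoundedBddSupport g)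
    (hgh : ∀ x, ‖g x - h x‖ ≤ ε) (hη : ∀ x z, ‖z‖ < v → ‖h (x - z) - h x‖ ≤ η) (x : E) :
    ‖conv (tent v) g x - h x‖ ≤ ε + η := by
  have hT := isBoundedBddSupport_tent (E := E) hv
  have e : conv (tent v) g x - h x = ∫ z, tent v z • (g (x - z) - h x) := by
    simp only [smul_sub]
    rw [integral_sub (hT.integrable_smul_comp_sub hg x) (hT.integrable.smul_const _),
      integral_smul_const, integral_tent hv, one_smul]
    rfl
  rw [e]
  calc _ ≤ ∫ z, tent v z * (ε + η) := by
        refine norm_integral_le_of_norm_le (hT.integrable.mul_const _)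
          (Eventually.of_forall fun z => ?_)
        rcases lt_or_ge ‖z‖ v with hz | hz
        · rw [norm_smul, Real.norm_eq_abs, abs_of_nonneg (tent_nonneg hv z)]
          refine mul_le_mul_of_nonneg_left ?_ (tent_nonneg hv z)
          calc ‖g (x - z) - h x‖ = ‖(g (x - z) - h (x - z)) + (h (x - z) - h x)‖ := by
                rw [sub_add_sub_cancel]
            _ ≤ _ := (norm_add_le _ _).trans (add_le_add (hgh _) (hη x z hz))
        · simp [tent_eq_zero hv hz]
    _ = ε + η := by rw [integral_mul_const, integral_tent hv, one_mul]

theorem norm_conv_tent_le {v M : ℝ} (hv : 0 < v) {g : E → F} (hM : ∀ x, ‖g x‖ ≤ M) (x : E) :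
    ‖conv (tent v) g x‖ ≤ M := by
  have hT := isBoundedBddSupport_tent (E := E) hv
  calc _ ≤ ∫ z : E, tent v z * M := by
        refine norm_integral_le_of_norm_le (hT.integrable.mul_const _)
          (Eventually.of_forall fun z => ?_)
        rw [norm_smul, Real.norm_eq_abs, abs_of_nonneg (tent_nonneg hv z)]
        exact mul_le_mul_of_nonneg_left (hM _) (tent_nonneg hv z)
    _ = M := by rw [integral_mul_const, integral_tent hv, one_mul]

/-- The approximate identity converges uniformly at small scales. -/
theorem eventually_norm_tentApprox_sub_le {h : E → F} (hc : Continuous h) (hs : HasCompactSupport h)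
    {ε : ℝ} (hε : 0 < ε) : ∀ᶠ v in 𝓝[>] (0 : ℝ), ∀ x, ‖tentApprox v h x - h x‖ ≤ ε := by
  have hh := hc.isBoundedBddSupport hs
  obtain ⟨ρ, hρ, hρh⟩ := Metric.uniformContinuous_iff.1
    (hs.uniformContinuous_of_continuous hc) (ε / 12) (by positivity)
  filter_upwards [Ioo_mem_nhdsGT hρ] with v hv x
  have hv0 := hv.1
  have hη : ∀ x z, ‖z‖ < v → ‖h (x - z) - h x‖ ≤ ε / 12 := by
    intro x z hz
    rw [← dist_eq_norm]
    exact (hρh (by simpa [dist_eq_norm] using hz.trans hv.2)).le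
  have hT := isBoundedBddSupport_tent (E := E) hv0
  have h0 : ∀ x, ‖h x - h x‖ ≤ 0 := by simp
  have h1 := norm_conv_tent_sub_le hv0 hh h0 hη
  have h2 := norm_conv_tent_sub_le hv0 (hT.conv hh) h1 hη
  have h3 := norm_conv_tent_sub_le hv0 (hT.conv (hT.conv hh)) h2 hη
  have e : tentApprox v h x - h x = (3 : ℝ) • (conv (tent v) (conv (tent v) h) x - h x) -
      (2 : ℝ) • (conv (tent v) (conv (tent v) (conv (tent v) h)) x - h x) := by
    unfold tentApprox
    module
  rw [e]
  refine (norm_sub_le _ _).trans ?_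
  rw [norm_smul, norm_smul]
  have := h2 x
  have := h3 x
  norm_num
  linarith

/-- The averages of an integrable function vanish uniformly at large scales, by the `L¹`-`L^∞` bound
for the innermost one. In dimension zero the averages do not spread out, and this fails. -/
theorem eventually_norm_tentApprox_le [Nontrivial E] {h : E → F} (hh : IsBoundedBddSupport h)
    {ε : ℝ} (hε : 0 < ε) : ∀ᶠ v in atTop, ∀ x, ‖tentApprox v h x‖ ≤ ε := by
  set A := (tentMass E)⁻¹ + 1
  have hd : Module.finrank ℝ E ≠ 0 := Module.finrank_pos.ne'
  have hlim : Tendsto (fun v : ℝ => 5 * (A / v ^ Module.finrank ℝ E * ∫ x, ‖h x‖)) atTop (𝓝 0) := by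
    have := ((tendsto_pow_atTop (α := ℝ) hd).const_div_atTop A).mul_const (∫ x, ‖h x‖)
    simpa using this.const_mul 5
  filter_upwards [eventually_gt_atTop 0, hlim.eventually (gt_mem_nhds hε)] with v hv hvε x
  have hT := isBoundedBddSupport_tent (E := E) hv
  set M := A / v ^ Module.finrank ℝ E * ∫ x, ‖h x‖
  have h1 : ∀ x, ‖conv (tent v) h x‖ ≤ M := by
    intro x
    calc _ ≤ ∫ z, A / v ^ Module.finrank ℝ E * ‖h (x - z)‖ := by
          refine norm_integral_le_of_norm_le ((hh.integrable.comp_sub_left x).norm.const_mul _)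
            (Eventually.of_forall fun z => ?_)
          rw [norm_smul]
          exact mul_le_mul_of_nonneg_right ((isBump_tent hv).abs_le z) (norm_nonneg _)
      _ = M := by
          rw [integral_const_mul, integral_sub_left_eq_self (fun z => ‖h z‖) volume x]
  have h2 := norm_conv_tent_le hv h1
  have h3 := norm_conv_tent_le hv h2
  unfold tentApprox
  refine (norm_sub_le _ _).trans ?_
  rw [norm_smul, norm_smul]
  have := h2 x
  have := h3 x
  norm_num
  linarith

end calderon

section representation

variable {E : Type*} [NormedAddCommGroup E] [NormedSpace ℝ E] [MeasureSpace E] [BorelSpace E]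
  [FiniteDimensional ℝ E] [(volume : Measure E).IsAddHaarMeasure]
  {𝕜 : Type*} [RCLike 𝕜] {H : Type*} [NormedAddCommGroup H] [NormedSpace 𝕜 H] [NormedSpace ℝ H]
  [IsScalarTower ℝ 𝕜 H] [CompleteSpace H]

theorem integrable_smul_bounded {k : E → 𝕜} (hk : Integrable k) {q : E → H}
    (hq : IsBoundedBddSupport q) (x : E) : Integrable fun y => k (x - y) • q y := by
  obtain ⟨M, hM⟩ := hq.exists_bound
  have hk' := hk.comp_sub_left x
  refine (hk'.norm.mul_const M).mono' ?_ (Eventually.of_forall fun y => ?_)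
  · exact hk'.aestronglyMeasurable.smul hq.stronglyMeasurable.aestronglyMeasurable
  · rw [norm_smul]
    exact mul_le_mul_of_nonneg_left (hM _) (norm_nonneg _)

theorem integral_smul_conv {k : E → 𝕜} (hk : Integrable k) (hkm : StronglyMeasurable k)
    {φ : E → ℝ} (hφ : IsBoundedBddSupport φ) {q : E → H} (hq : IsBoundedBddSupport q) (x : E) :
    ∫ y, k (x - y) • conv φ q y = ∫ w, conv φ k (x - w) • q w := by
  have hint : Integrable (fun p : E × E => k (x - p.1) • φ (p.1 - p.2) • q p.2)
      (volume.prod volume) := by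
    obtain ⟨M, hM⟩ := hφ.exists_bound
    have h1 : Integrable (fun p : E × E => ‖k (x - p.1)‖ * ‖q p.2‖) (volume.prod volume) :=
      (hk.comp_sub_left x).norm.mul_prod hq.integrable.norm
    refine (h1.const_mul M).mono' ?_ (Eventually.of_forall fun p => ?_)
    · refine StronglyMeasurable.aestronglyMeasurable ?_
      exact (hkm.comp_measurable (by fun_prop)).smul
        ((hφ.stronglyMeasurable.comp_measurable (by fun_prop)).smul
        (hq.stronglyMeasurable.comp_measurable measurable_snd))
    · rw [norm_smul, norm_smul]
      have := mul_le_mul_of_nonneg_right (hM (p.1 - p.2))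
        (mul_nonneg (norm_nonneg (k (x - p.1))) (norm_nonneg (q p.2)))
      linarith
  calc ∫ y, k (x - y) • conv φ q y = ∫ y, ∫ w, k (x - y) • φ (y - w) • q w := by
        refine integral_congr_ae (Eventually.of_forall fun y => ?_)
        simp only [conv]
        rw [integral_smul, ← integral_sub_left_eq_self _ _ y]
        simp only [sub_sub_cancel]
    _ = ∫ w, ∫ y, k (x - y) • φ (y - w) • q w := integral_integral_swap hint
    _ = _ := by
        refine integral_congr_ae (Eventually.of_forall fun w => ?_)
        simp only [conv]
        rw [← integral_smul_const, ← integral_add_right_eq_self _ w]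
        refine integral_congr_ae (Eventually.of_forall fun z => ?_)
        simp only [add_sub_cancel_right, sub_add_eq_sub_sub_swap]
        rw [smul_comm, smul_assoc]

/-- The reproducing formula for `h`, applied inside a convolution with an integrable kernel. -/
theorem enorm_integral_smul_le_tsum [Nontrivial E] {β : ℝ} (hβ : 1 < β) {k : E → 𝕜}
    (hk : Integrable k)
    (hkm : StronglyMeasurable k) {h : E → H} (hc : Continuous h) (hs : HasCompactSupport h)
    (x : E) :
    ‖∫ y, k (x - y) • h y‖ₑ ≤
      ∑' i : ℤ, ∫⁻ y, ‖conv (tentDual β i) k (x - y)‖ₑ * ‖conv (tentDiff β i) h y‖ₑ := by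
  have hβ0 : 0 < β := by linarith
  have hh := hc.isBoundedBddSupport hs
  obtain ⟨A, hA⟩ := exists_isBump_tentDiff E hβ
  obtain ⟨B, hB⟩ := exists_isBump_tentDual E hβ
  have hpos : ∀ i : ℤ, (0 : ℝ) < β ^ i := fun i => by positivity
  have hdiff : ∀ i, IsBoundedBddSupport (tentDiff β i : E → ℝ) :=
    fun i => (hA i).isBoundedBddSupport (hpos i)
  have hdual : ∀ i, IsBoundedBddSupport (tentDual β i : E → ℝ) :=
    fun i => (hB i).isBoundedBddSupport (hpos i)
  set g : ℕ → E → H := fun n y => tentApprox (β ^ (-(n : ℤ))) h y - tentApprox (β ^ (n : ℤ)) h y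
    with hg
  have hsum : ∀ (n : ℕ) (y : E), g n y = ∑ j ∈ Finset.range (2 * n),
      conv (tentDual β ((j : ℤ) - n)) (conv (tentDiff β ((j : ℤ) - n)) h) y := by
    intro n y
    simp only [conv_tentDual_conv_tentDiff hβ0 _ hh]
    have := Finset.sum_range_sub' (fun j : ℕ => tentApprox (β ^ ((j : ℤ) - n)) h y) (2 * n)
    simp only [Nat.cast_add, Nat.cast_one] at this
    simp only [hg, sub_add_eq_add_sub, this]
    congr 3 <;> push_cast <;> ring_nf
  have hgn : ∀ n, IsBoundedBddSupport (g n) := by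
    intro n
    have : g n = fun y => ∑ j ∈ Finset.range (2 * n),
      conv (tentDual β ((j : ℤ) - n)) (conv (tentDiff β ((j : ℤ) - n)) h) y := funext (hsum n)
    rw [this]
    exact IsBoundedBddSupport.sum _ fun j => (hdual _).conv ((hdiff _).conv hh)
  have hle : ∀ n, ‖∫ y, k (x - y) • g n y‖ₑ ≤
      ∑' i : ℤ, ∫⁻ y, ‖conv (tentDual β i) k (x - y)‖ₑ * ‖conv (tentDiff β i) h y‖ₑ := by
    intro n
    have e : ∫ y, k (x - y) • g n y = ∑ j ∈ Finset.range (2 * n),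
        ∫ y, conv (tentDual β ((j : ℤ) - n)) k (x - y) • conv (tentDiff β ((j : ℤ) - n)) h y := by
      simp only [hsum, Finset.smul_sum]
      rw [integral_finsetSum _ fun j _ =>
        integrable_smul_bounded hk ((hdual _).conv ((hdiff _).conv hh)) x]
      exact Finset.sum_congr rfl fun j _ =>
        integral_smul_conv hk hkm (hdual _) ((hdiff _).conv hh) x
    rw [e]
    refine (enorm_sum_le _ _).trans ?_
    have hinj : Function.Injective fun j : ℕ => (j : ℤ) - n := fun a b hab => by
      simpa using hab
    calc _ ≤ ∑ j ∈ Finset.range (2 * n), ∫⁻ y, ‖conv (tentDual β ((j : ℤ) - n)) k (x - y)‖ₑ *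
            ‖conv (tentDiff β ((j : ℤ) - n)) h y‖ₑ := by
          refine Finset.sum_le_sum fun j _ => (enorm_integral_le_lintegral_enorm _).trans ?_
          simp only [enorm_smul, le_refl]
      _ = ∑ i ∈ (Finset.range (2 * n)).map ⟨fun j : ℕ => (j : ℤ) - n, hinj⟩,
            ∫⁻ y, ‖conv (tentDual β i) k (x - y)‖ₑ * ‖conv (tentDiff β i) h y‖ₑ := by
          rw [Finset.sum_map]
          rfl
      _ ≤ _ := ENNReal.sum_le_tsum _
  have hlim : Tendsto (fun n => ∫ y, k (x - y) • g n y) atTop (𝓝 (∫ y, k (x - y) • h y)) := by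
    rw [Metric.tendsto_nhds]
    intro ε hε
    set I := ∫ y, ‖k (x - y)‖
    have hI : 0 ≤ I := by positivity
    have hε' : 0 < ε / (4 * (I + 1)) := by positivity
    have t1 : Tendsto (fun n : ℕ => β ^ (-(n : ℤ))) atTop (𝓝[>] 0) := by
      refine tendsto_nhdsWithin_iff.2 ⟨?_, Eventually.of_forall fun n => hpos _⟩
      simpa using tendsto_pow_atTop_nhds_zero_of_lt_one (inv_nonneg.2 hβ0.le)
        (inv_lt_one_of_one_lt₀ hβ)
    have t2 : Tendsto (fun n : ℕ => β ^ (n : ℤ)) atTop atTop := by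
      simpa using tendsto_pow_atTop_atTop_of_one_lt hβ
    filter_upwards [t1.eventually (eventually_norm_tentApprox_sub_le hc hs hε'),
      t2.eventually (eventually_norm_tentApprox_le hh hε')] with n h1 h2
    rw [dist_eq_norm, ← integral_sub (integrable_smul_bounded hk (hgn n) x)
      (integrable_smul_bounded hk hh x)]
    calc _ ≤ ∫ y, ‖k (x - y)‖ * (2 * (ε / (4 * (I + 1)))) := by
          refine norm_integral_le_of_norm_le ((hk.comp_sub_left x).norm.mul_const _)
            (Eventually.of_forall fun y => ?_)
          rw [← smul_sub, norm_smul]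
          refine mul_le_mul_of_nonneg_left ?_ (norm_nonneg _)
          have e : g n y - h y = (tentApprox (β ^ (-(n : ℤ))) h y - h y) -
              tentApprox (β ^ (n : ℤ)) h y := by simp only [hg]; abel
          rw [e, two_mul]
          exact (norm_sub_le _ _).trans (add_le_add (h1 y) (h2 y))
      _ = I / (I + 1) * (ε / 2) := by
          rw [integral_mul_const]
          change I * _ = _
          field_simp
          norm_num
      _ < ε := by
          have : I / (I + 1) ≤ 1 := (div_le_one (by positivity)).2 (by linarith)
          nlinarith
  exact le_of_tendsto (continuous_enorm.continuousAt.tendsto.comp hlim) (Eventually.of_forall hle)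

end representation

/-! ### Averages of the weight against the mollified kernel -/

section kernel

variable {E : Type*} [NormedAddCommGroup E] [NormedSpace ℝ E] [MeasureSpace E] [BorelSpace E]
  [FiniteDimensional ℝ E] [(volume : Measure E).IsAddHaarMeasure]
  {𝕜 : Type*} [RCLike 𝕜]

/-- The `L¹`-normalized dilation `u ^ (-d) ψ(z / u)`. -/
noncomputable def dilate (u : ℝ) (ψ : E → 𝕜) (z : E) : 𝕜 :=
  (u ^ Module.finrank ℝ E)⁻¹ • ψ (u⁻¹ • z)

/-- A mean-zero `C¹` kernel which, with its gradient, is dominated by the decreasing radial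
function `x ↦ m (‖x‖, ∞)`, a superposition of indicator functions of balls. -/
structure IsRadiallyDominated (m : Measure ℝ) (ψ : E → 𝕜) : Prop where
  contDiff : ContDiff ℝ 1 ψ
  norm_le : ∀ x, ‖ψ x‖ ≤ m.real (Ioi ‖x‖)
  norm_fderiv_le : ∀ x, ‖fderiv ℝ ψ x‖ ≤ m.real (Ioi ‖x‖)
  integrable : Integrable ψ
  integral_eq_zero : ∫ x, ψ x = 0

variable {m : Measure ℝ} {ψ : E → 𝕜}

theorem integrable_dilate (hψ : Integrable ψ) {u : ℝ} (hu : 0 < u) : Integrable (dilate u ψ) :=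
  (hψ.comp_smul (inv_ne_zero hu.ne')).smul (u ^ Module.finrank ℝ E)⁻¹

theorem IsRadiallyDominated.continuous_dilate (hψ : IsRadiallyDominated m ψ) (u : ℝ) :
    Continuous (dilate u ψ) := by
  have := hψ.contDiff.continuous
  unfold dilate
  fun_prop

theorem IsRadiallyDominated.integral_dilate (hψ : IsRadiallyDominated m ψ) (u : ℝ) :
    ∫ z, dilate u ψ z = 0 := by
  simp only [dilate]
  rw [integral_smul, Measure.integral_comp_smul, hψ.integral_eq_zero, smul_zero, smul_zero]

theorem IsRadiallyDominated.norm_dilate_le (hψ : IsRadiallyDominated m ψ) {u : ℝ} (hu : 0 < u)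
    (z : E) : ‖dilate u ψ z‖ ≤ (u ^ Module.finrank ℝ E)⁻¹ * m.real (Ioi (‖z‖ / u)) := by
  rw [dilate, norm_smul, Real.norm_eq_abs, abs_of_pos (by positivity)]
  refine mul_le_mul_of_nonneg_left ((hψ.norm_le _).trans (le_of_eq ?_)) (by positivity)
  rw [norm_smul, Real.norm_eq_abs, abs_of_pos (by positivity), div_eq_inv_mul]

theorem IsRadiallyDominated.norm_fderiv_dilate_le (hψ : IsRadiallyDominated m ψ) {u : ℝ}
    (hu : 0 < u) (z : E) : DifferentiableAt ℝ (dilate u ψ) z ∧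
      ‖fderiv ℝ (dilate u ψ) z‖ ≤ (u ^ Module.finrank ℝ E)⁻¹ * u⁻¹ * m.real (Ioi (‖z‖ / u)) := by
  have h1 : HasFDerivAt ψ (fderiv ℝ ψ (u⁻¹ • z)) (u⁻¹ • z) :=
    (hψ.contDiff.differentiable one_ne_zero _).hasFDerivAt
  have h2 : HasFDerivAt (fun z : E => u⁻¹ • z) (u⁻¹ • ContinuousLinearMap.id ℝ E) z :=
    (hasFDerivAt_id z).const_smul u⁻¹
  have h3 := (h1.comp z h2).const_smul (u ^ Module.finrank ℝ E)⁻¹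
  have h4 : HasFDerivAt (dilate u ψ) _ z := h3
  refine ⟨h4.differentiableAt, ?_⟩
  rw [h4.fderiv, norm_smul, Real.norm_eq_abs, abs_of_pos (by positivity), mul_assoc]
  refine mul_le_mul_of_nonneg_left ?_ (by positivity)
  rw [ContinuousLinearMap.comp_smul, ContinuousLinearMap.comp_id, norm_smul, Real.norm_eq_abs,
    abs_of_pos (by positivity)]
  refine mul_le_mul_of_nonneg_left ((hψ.norm_fderiv_le _).trans (le_of_eq ?_)) (by positivity)
  rw [norm_smul, Real.norm_eq_abs, abs_of_pos (by positivity), div_eq_inv_mul]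

variable [IsFiniteMeasure m]

/-- When the bump is narrower than the kernel, its mean value zero works against the gradient
of the kernel. -/
theorem IsRadiallyDominated.norm_conv_dilate_le (hψ : IsRadiallyDominated m ψ) {A u v : ℝ}
    {φ : E → ℝ} (hu : 0 < u) (hv : 0 < v) (hφ : IsBump A v φ) (h0 : ∫ x, φ x = 0) (x : E) :
    ‖conv φ (dilate u ψ) x‖ ≤ A ^ (Module.finrank ℝ E + 1) * volume.real (Metric.ball (0 : E) 1) *
      (A * (v / u)) * ((u ^ Module.finrank ℝ E)⁻¹ * m.real (Ioi ((‖x‖ - A * v) / u))) := by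
  have hA := hφ.nonneg hv
  have hb := hφ.isBoundedBddSupport hv
  set k := dilate u ψ
  set D := Module.finrank ℝ E
  set L := (u ^ D)⁻¹ * u⁻¹ * m.real (Ioi ((‖x‖ - A * v) / u)) with hL
  have hL0 : 0 ≤ L := by positivity
  have hmv : ∀ z, ‖z‖ ≤ A * v → ‖k (x - z) - k x‖ ≤ L * (A * v) := by
    intro z hz
    have hx : x ∈ Metric.closedBall x (A * v) := Metric.mem_closedBall_self (by positivity)
    have hxz : x - z ∈ Metric.closedBall x (A * v) := by simpa using hz
    have := (convex_closedBall x (A * v)).norm_image_sub_le_of_norm_fderiv_le (𝕜 := ℝ) (f := k)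
      (C := L) (fun y _ => (hψ.norm_fderiv_dilate_le hu y).1) (fun y hy => ?_) hx hxz
    · refine this.trans (mul_le_mul_of_nonneg_left ?_ hL0)
      simpa using hz
    · refine (hψ.norm_fderiv_dilate_le hu y).2.trans ?_
      refine mul_le_mul_of_nonneg_left (measureReal_mono (Ioi_subset_Ioi ?_)) (by positivity)
      have h1 : ‖y - x‖ ≤ A * v := by simpa [dist_eq_norm] using hy
      have h2 := norm_sub_norm_le x y
      rw [norm_sub_rev] at h2
      gcongr
      linarith
  have hint : Integrable fun z => φ z • k (x - z) := by
    have hk := (integrable_dilate hψ.integrable hu).comp_sub_left x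
    obtain ⟨M, hM⟩ := hb.exists_bound
    refine (hk.norm.const_mul M).mono' ?_ (Eventually.of_forall fun z => ?_)
    · exact hb.stronglyMeasurable.aestronglyMeasurable.smul hk.aestronglyMeasurable
    · rw [norm_smul]
      exact mul_le_mul_of_nonneg_right (hM z) (norm_nonneg _)
  have e : conv φ k x = ∫ z, φ z • (k (x - z) - k x) := by
    simp only [smul_sub]
    rw [integral_sub hint (hb.integrable.smul_const _), integral_smul_const, h0, zero_smul,
      sub_zero]
    rfl
  rw [e]
  calc _ ≤ ∫ z, ‖φ z‖ * (L * (A * v)) := by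
        refine norm_integral_le_of_norm_le (hb.integrable.norm.mul_const _)
          (Eventually.of_forall fun z => ?_)
        rw [norm_smul]
        by_cases hz : A * v < ‖z‖
        · simp [hφ.eq_zero z hz]
        · exact mul_le_mul_of_nonneg_left (hmv z (not_lt.1 hz)) (norm_nonneg _)
    _ ≤ A ^ (D + 1) * volume.real (Metric.ball (0 : E) 1) * (L * (A * v)) := by
        rw [integral_mul_const]
        exact mul_le_mul_of_nonneg_right (hφ.integral_norm_le hv) (by positivity)
    _ = _ := by
        rw [hL]
        ring

/-- The layer cake formula for a radial majorant. -/
theorem lintegral_measure_Ioi_mul {f : E → ℝ} (hf : Measurable f) {g : E → ℝ≥0∞}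
    (hg : Measurable g) :
    ∫⁻ x, m (Ioi (f x)) * g x = ∫⁻ r, (∫⁻ x in {x | f x < r}, g x) ∂m := by
  have hs : MeasurableSet {p : E × ℝ | f p.1 < p.2} := measurableSet_lt (by fun_prop) (by fun_prop)
  have e1 : ∀ x, m (Ioi (f x)) * g x =
      ∫⁻ r, {p : E × ℝ | f p.1 < p.2}.indicator (fun p => g p.1) (x, r) ∂m := by
    intro x
    rw [mul_comm, ← setLIntegral_const, ← lintegral_indicator measurableSet_Ioi]
    rfl
  have e2 : ∀ r, ∫⁻ x in {x | f x < r}, g x =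
      ∫⁻ x, {p : E × ℝ | f p.1 < p.2}.indicator (fun p => g p.1) (x, r) := by
    intro r
    rw [← lintegral_indicator (measurableSet_lt hf measurable_const)]
    rfl
  simp_rw [e1, e2]
  exact lintegral_lintegral_swap
    (f := fun x r => {p : E × ℝ | f p.1 < p.2}.indicator (fun p => g p.1) (x, r))
    ((hg.comp measurable_fst).indicator hs).aemeasurable

variable (E) in
/-- If the bump is narrower than the kernel, its cancellation gains the factor `v / u`. -/
theorem exists_lintegral_conv_dilate_le_of_le (A : ℝ) (C₀ : ℝ≥0) :
    ∃ C : ℝ≥0, ∀ (𝕜 : Type*) [RCLike 𝕜] (ψ : E → 𝕜) (m : Measure ℝ) [IsFiniteMeasure m],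
      IsRadiallyDominated m ψ → (∀ᵐ r ∂m, 0 < r) →
      ∫⁻ r, ENNReal.ofReal (1 + r) ^ Module.finrank ℝ E ∂m ≤ C₀ →
      ∀ (u v : ℝ) (φ : E → ℝ), 0 < v → v ≤ u → IsBump A v φ → ∫ x, φ x = 0 →
      ∀ g : E → ℝ≥0∞, Measurable g → ∀ y y' : E, ‖y' - y‖ ≤ A * v →
      ∫⁻ x, ‖conv φ (dilate u ψ) (x - y')‖ₑ * g x ≤
        C * ENNReal.ofReal (v / u) * maximalFn volume g y := by
  set D := Module.finrank ℝ E with hD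
  set c : ℝ := A ^ (D + 1) * volume.real (Metric.ball (0 : E) 1) * A
  refine ⟨ENNReal.toNNReal (ENNReal.ofReal c * volume (Metric.ball (0 : E) 1) *
    ENNReal.ofReal (4 * (1 + A)) ^ D * C₀), ?_⟩
  intro 𝕜 _ ψ m _ hψ hm hC₀ u v φ hv hvu hφ h0 g hg y y' hy
  have hu : 0 < u := hv.trans_le hvu
  have hA := hφ.nonneg hv
  have hc : 0 ≤ c := by positivity
  have hω : volume (Metric.ball (0 : E) 1) ≠ ⊤ := measure_ball_lt_top.ne
  rw [ENNReal.coe_toNNReal (by finiteness)]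
  have h1 : ∀ x, ‖conv φ (dilate u ψ) (x - y')‖ₑ * g x ≤
      ENNReal.ofReal c * ENNReal.ofReal (v / u) * ENNReal.ofReal (u ^ D)⁻¹ *
        (m (Ioi ((‖x - y'‖ - A * v) / u)) * g x) := by
    intro x
    rw [← mul_assoc]
    refine mul_le_mul_left ?_ _
    rw [← ofReal_norm]
    refine (ENNReal.ofReal_le_ofReal (hψ.norm_conv_dilate_le hu hv hφ h0 (x - y'))).trans
      (le_of_eq ?_)
    rw [← ofReal_measureReal (μ := m), ← ENNReal.ofReal_mul hc,
      ← ENNReal.ofReal_mul (by positivity), ← ENNReal.ofReal_mul (by positivity)]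
    congr 1
    ring
  calc ∫⁻ x, ‖conv φ (dilate u ψ) (x - y')‖ₑ * g x
      ≤ ∫⁻ x, ENNReal.ofReal c * ENNReal.ofReal (v / u) * ENNReal.ofReal (u ^ D)⁻¹ *
        (m (Ioi ((‖x - y'‖ - A * v) / u)) * g x) := lintegral_mono h1
    _ = ENNReal.ofReal c * ENNReal.ofReal (v / u) * ENNReal.ofReal (u ^ D)⁻¹ *
        ∫⁻ r, (∫⁻ x in {x | (‖x - y'‖ - A * v) / u < r}, g x) ∂m := by
        rw [lintegral_const_mul' _ _ (by finiteness), lintegral_measure_Ioi_mul (by fun_prop) hg]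
    _ ≤ ENNReal.ofReal c * ENNReal.ofReal (v / u) * ENNReal.ofReal (u ^ D)⁻¹ *
        ∫⁻ r, volume (Metric.ball (0 : E) 1) * (ENNReal.ofReal (4 * (1 + A)) ^ D *
          ENNReal.ofReal (u ^ D)) * maximalFn volume g y * ENNReal.ofReal (1 + r) ^ D ∂m := by
        refine mul_le_mul_right ?_ _
        refine lintegral_mono_ae (hm.mono fun r hr => ?_)
        have hs : 0 < u * r + 2 * A * v := by positivity
        have hsub : Metric.closedBall y' (u * r + A * v) ⊆
            Metric.closedBall y (u * r + 2 * A * v) := by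
          refine Metric.closedBall_subset_closedBall' ?_
          rw [dist_eq_norm]
          linarith
        calc ∫⁻ x in {x | (‖x - y'‖ - A * v) / u < r}, g x
            ≤ ∫⁻ x in Metric.closedBall y' (u * r + A * v), g x := by
              refine lintegral_mono_set fun x hx => ?_
              have hx : (‖x - y'‖ - A * v) / u < r := hx
              rw [div_lt_iff₀ hu] at hx
              rw [Metric.mem_closedBall, dist_eq_norm]
              linarith
          _ ≤ _ := lintegral_closedBall_le_maximalFn volume g hs hsub
          _ ≤ volume (Metric.ball (0 : E) 1) * (ENNReal.ofReal (4 * (1 + A)) ^ D *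
              ENNReal.ofReal (u ^ D) * ENNReal.ofReal (1 + r) ^ D) * maximalFn volume g y := by
              gcongr
              rw [ENNReal.ofReal_pow hu.le, ← mul_pow, ← mul_pow,
                ← ENNReal.ofReal_mul (by positivity), ← ENNReal.ofReal_mul (by positivity)]
              refine pow_le_pow_left' (ENNReal.ofReal_le_ofReal ?_) _
              nlinarith [mul_le_mul_of_nonneg_left hvu hA, mul_nonneg hA hu.le,
                mul_nonneg (mul_nonneg hA hu.le) hr.le, mul_nonneg hu.le hr.le]
          _ = _ := by ring
    _ = ENNReal.ofReal c * ENNReal.ofReal (v / u) * (ENNReal.ofReal (u ^ D)⁻¹ *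
          ENNReal.ofReal (u ^ D)) * volume (Metric.ball (0 : E) 1) *
          ENNReal.ofReal (4 * (1 + A)) ^ D * maximalFn volume g y *
          ∫⁻ r, ENNReal.ofReal (1 + r) ^ D ∂m := by
        rw [lintegral_const_mul _ (by fun_prop)]
        ring
    _ ≤ ENNReal.ofReal c * ENNReal.ofReal (v / u) * 1 * volume (Metric.ball (0 : E) 1) *
          ENNReal.ofReal (4 * (1 + A)) ^ D * maximalFn volume g y * C₀ := by
        gcongr
        rw [← ENNReal.ofReal_mul (by positivity), inv_mul_cancel₀ (by positivity),
          ENNReal.ofReal_one]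
    _ = _ := by ring

/-- The convolution of the indicator functions of a ball of radius `ρ` and of one of radius `A * v`,
tested against `g`. Of the two integrations, the one over the smaller ball is trivial, and the one
over the larger ball yields the maximal function. -/
theorem lintegral_ball_lintegral_closedBall_le {A v ρ : ℝ} (hA : 0 ≤ A) (hv : 0 < v) (hρ : 0 < ρ)
    {g : E → ℝ≥0∞} (hg : Measurable g) {y y' : E} (hy : ‖y' - y‖ ≤ A * v) :
    ∫⁻ z in Metric.ball (0 : E) ρ, ∫⁻ x in Metric.closedBall (y' + z) (A * v), g x ≤
      volume (Metric.ball (0 : E) 1) ^ 2 * ENNReal.ofReal (2 * (2 * A + 1)) ^ Module.finrank ℝ E *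
        ENNReal.ofReal (A + 1) ^ Module.finrank ℝ E * ENNReal.ofReal ρ ^ Module.finrank ℝ E *
        ENNReal.ofReal v ^ Module.finrank ℝ E * maximalFn volume g y := by
  set D := Module.finrank ℝ E
  rcases le_total ρ v with hρv | hvρ
  · calc ∫⁻ z in Metric.ball (0 : E) ρ, ∫⁻ x in Metric.closedBall (y' + z) (A * v), g x
        ≤ ∫⁻ z in Metric.ball (0 : E) ρ, volume (Metric.ball (0 : E) 1) *
            ENNReal.ofReal (2 * ((2 * A + 1) * v)) ^ D * maximalFn volume g y := by
          refine setLIntegral_mono_ae' measurableSet_ball (Eventually.of_forall fun z hz => ?_)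
          refine lintegral_closedBall_le_maximalFn volume g (by positivity)
            (Metric.closedBall_subset_closedBall' ?_)
          have hz : ‖z‖ < ρ := by simpa using hz
          have : dist (y' + z) y ≤ ‖y' - y‖ + ‖z‖ := by
            rw [dist_eq_norm, add_sub_right_comm]
            exact norm_add_le _ _
          linarith
      _ = volume (Metric.ball (0 : E) 1) ^ 2 * ENNReal.ofReal (2 * (2 * A + 1)) ^ D *
            1 * ENNReal.ofReal ρ ^ D * ENNReal.ofReal v ^ D * maximalFn volume g y := by
          rw [setLIntegral_const, Measure.addHaar_ball_of_pos _ _ hρ, ← mul_assoc 2,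
            ENNReal.ofReal_mul (by positivity), mul_pow, ENNReal.ofReal_pow hρ.le]
          ring
      _ ≤ _ := by
          gcongr
          refine one_le_pow₀ ?_
          rw [ENNReal.one_le_ofReal]
          linarith
  · set s : Set (E × E) := {p | ‖p.2 - (y' + p.1)‖ ≤ A * v ∧ ‖p.1‖ < ρ} with hs_def
    have hs : MeasurableSet s := by
      have h1 : MeasurableSet {p : E × E | ‖p.2 - (y' + p.1)‖ ≤ A * v} :=
        measurableSet_le (by fun_prop) (by fun_prop)
      have h2 : MeasurableSet {p : E × E | ‖p.1‖ < ρ} :=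
        measurableSet_lt (by fun_prop) (by fun_prop)
      exact h1.inter h2
    have e1 : ∫⁻ z in Metric.ball (0 : E) ρ, ∫⁻ x in Metric.closedBall (y' + z) (A * v), g x =
        ∫⁻ z, ∫⁻ x, s.indicator (fun p => g p.2) (z, x) := by
      rw [← lintegral_indicator measurableSet_ball]
      refine lintegral_congr fun z => ?_
      by_cases hz : ‖z‖ < ρ
      · rw [indicator_of_mem (by simpa using hz), ← lintegral_indicator measurableSet_closedBall]
        refine lintegral_congr fun x => ?_
        simp [indicator, hs_def, hz, dist_eq_norm]
      · rw [indicator_of_notMem (by simpa using hz)]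
        simp [indicator, hs_def, hz]
    rw [e1, lintegral_lintegral_swap
      (f := fun z x => s.indicator (fun p => g p.2) (z, x))
      ((hg.comp measurable_snd).indicator hs).aemeasurable]
    calc ∫⁻ x, ∫⁻ z, s.indicator (fun p => g p.2) (z, x)
        ≤ ∫⁻ x, (Metric.closedBall y' (A * v + ρ)).indicator g x *
            volume (Metric.closedBall (0 : E) (A * v)) := by
          refine lintegral_mono fun x => ?_
          calc ∫⁻ z, s.indicator (fun p => g p.2) (z, x)
              ≤ ∫⁻ z in Metric.closedBall (x - y') (A * v),
                  (Metric.closedBall y' (A * v + ρ)).indicator g x := by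
                rw [← lintegral_indicator measurableSet_closedBall]
                refine lintegral_mono fun z => ?_
                by_cases hz : (z, x) ∈ s
                · have hz1 : ‖x - (y' + z)‖ ≤ A * v := hz.1
                  have hz2 : ‖z‖ < ρ := hz.2
                  have m1 : z ∈ Metric.closedBall (x - y') (A * v) := by
                    rw [Metric.mem_closedBall, dist_eq_norm, norm_sub_rev, sub_sub]
                    exact hz1
                  have m2 : x ∈ Metric.closedBall y' (A * v + ρ) := by
                    rw [Metric.mem_closedBall, dist_eq_norm]
                    have := norm_add_le (x - (y' + z)) z
                    rw [show x - (y' + z) + z = x - y' by abel] at this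
                    linarith
                  rw [indicator_of_mem hz, indicator_of_mem m1, indicator_of_mem m2]
                · rw [indicator_of_notMem hz]
                  exact zero_le
            _ = _ := by
                rw [setLIntegral_const, Measure.addHaar_closedBall_center]
      _ = (∫⁻ x in Metric.closedBall y' (A * v + ρ), g x) *
            volume (Metric.closedBall (0 : E) (A * v)) := by
          rw [lintegral_mul_const _ (hg.indicator measurableSet_closedBall),
            lintegral_indicator measurableSet_closedBall]
      _ ≤ (volume (Metric.ball (0 : E) 1) * ENNReal.ofReal (2 * ((2 * A + 1) * ρ)) ^ D *
            maximalFn volume g y) * (ENNReal.ofReal (((A + 1) * v) ^ D) *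
              volume (Metric.ball (0 : E) 1)) := by
          refine mul_le_mul' (lintegral_closedBall_le_maximalFn volume g (by positivity)
            (Metric.closedBall_subset_closedBall' ?_)) ?_
          · rw [dist_eq_norm]
            nlinarith
          · rw [← Measure.addHaar_closedBall volume (0 : E) (by positivity)]
            gcongr
            linarith
      _ = _ := by
          rw [← mul_assoc 2, ENNReal.ofReal_mul (by positivity), mul_pow,
            ENNReal.ofReal_pow (by positivity), ENNReal.ofReal_mul (p := A + 1) (by positivity),
            mul_pow]
          ring

variable (E) in
/-- If the bump is wider than the kernel, the cancellation of the kernel works against the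
smoothness of the bump. The gain is that of the moment of `m` on the right-hand side. -/
theorem exists_lintegral_conv_dilate_le_of_ge (A : ℝ) :
    ∃ C : ℝ≥0, ∀ (𝕜 : Type*) [RCLike 𝕜] (ψ : E → 𝕜) (m : Measure ℝ) [IsFiniteMeasure m],
      IsRadiallyDominated m ψ → (∀ᵐ r ∂m, 0 < r) →
      ∀ (u v : ℝ) (φ : E → ℝ), 0 < u → u ≤ v → IsBump A v φ →
      ∀ g : E → ℝ≥0∞, Measurable g → ∀ y y' : E, ‖y' - y‖ ≤ A * v →
      ∫⁻ x, ‖conv φ (dilate u ψ) (x - y')‖ₑ * g x ≤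
        C * (∫⁻ r, ENNReal.ofReal (min 1 (u * r / v)) *
          ENNReal.ofReal r ^ Module.finrank ℝ E ∂m) * maximalFn volume g y := by
  set D := Module.finrank ℝ E with hD
  set K : ℝ≥0∞ := volume (Metric.ball (0 : E) 1) ^ 2 * ENNReal.ofReal (2 * (2 * A + 1)) ^ D *
        ENNReal.ofReal (A + 1) ^ D with hK
  have hω : volume (Metric.ball (0 : E) 1) ≠ ⊤ := measure_ball_lt_top.ne
  refine ⟨ENNReal.toNNReal (ENNReal.ofReal (2 * A) * (2 * K)), ?_⟩
  intro 𝕜 _ ψ m _ hψ hm u v φ hu huv hφ g hg y y' hy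
  have hv : 0 < v := hu.trans_le huv
  have hA := hφ.nonneg hv
  rw [ENNReal.coe_toNNReal (by finiteness)]
  set k := dilate u ψ with hk
  have hki : Integrable k := integrable_dilate hψ.integrable hu
  have hφm : Measurable φ := (hφ.continuous hv).measurable
  have hb := hφ.isBoundedBddSupport hv
  set M := maximalFn volume g y
  -- As `k` has mean zero, the increments of `φ` appear.
  have hpt : ∀ x, ‖conv φ k x‖ₑ ≤ ∫⁻ z, ‖φ (x - z) - φ x‖ₑ *
      (ENNReal.ofReal (u ^ D)⁻¹ * m (Ioi (‖z‖ / u))) := by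
    intro x
    have hint : Integrable fun z => φ (x - z) • k z := by
      obtain ⟨B, hB⟩ := hb.exists_bound
      refine (hki.norm.const_mul B).mono' ?_ (Eventually.of_forall fun z => ?_)
      · exact (hb.stronglyMeasurable.comp_measurable (by fun_prop)).aestronglyMeasurable.smul
          hki.aestronglyMeasurable
      · rw [norm_smul]
        exact mul_le_mul_of_nonneg_right (hB _) (norm_nonneg _)
    have e : conv φ k x = ∫ z, (φ (x - z) - φ x) • k z := by
      have hint' : Integrable fun z => φ x • k z := hki.smul (φ x)
      simp only [sub_smul]
      rw [integral_sub hint hint', integral_smul, hk, hψ.integral_dilate, smul_zero,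
        sub_zero, conv, ← integral_sub_left_eq_self _ _ x]
      simp only [sub_sub_cancel]
    rw [e]
    refine (enorm_integral_le_lintegral_enorm _).trans (lintegral_mono fun z => ?_)
    rw [enorm_smul]
    refine mul_le_mul_right ?_ _
    rw [← ofReal_norm, ← ofReal_measureReal (μ := m), ← ENNReal.ofReal_mul (by positivity)]
    exact ENNReal.ofReal_le_ofReal (hψ.norm_dilate_le hu z)
  have hinc : Measurable fun p : E × E => ‖φ (p.1 - y' - p.2) - φ (p.1 - y')‖ₑ * g p.1 := by
    fun_prop
  have hmono : Measurable fun z : E => m (Ioi (‖z‖ / u)) := by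
    have h1 : Antitone fun s : ℝ => m (Ioi s) := fun a b hab => measure_mono (Ioi_subset_Ioi hab)
    exact h1.measurable.comp (by fun_prop)
  -- The increments are small and supported in two balls.
  have hincr : ∀ r, ∀ z : E, ‖z‖ < u * r →
      ∫⁻ x, ‖φ (x - y' - z) - φ (x - y')‖ₑ * g x ≤
        ENNReal.ofReal (2 * A / v ^ D) * ENNReal.ofReal (min 1 (u * r / v)) *
          ((∫⁻ x in Metric.closedBall (y' + z) (A * v), g x) +
            ∫⁻ x in Metric.closedBall y' (A * v), g x) := by
    intro r z hz
    rw [← lintegral_indicator measurableSet_closedBall,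
      ← lintegral_indicator measurableSet_closedBall,
      ← lintegral_add_left (hg.indicator measurableSet_closedBall),
      ← lintegral_const_mul' _ _ (by finiteness)]
    refine lintegral_mono fun x => ?_
    have hb1 : ‖φ (x - y' - z) - φ (x - y')‖ₑ ≤
        ENNReal.ofReal (2 * A / v ^ D) * ENNReal.ofReal (min 1 (u * r / v)) := by
      rw [← ofReal_norm, ← ENNReal.ofReal_mul (by positivity), Real.norm_eq_abs]
      refine ENNReal.ofReal_le_ofReal ?_
      have hur : 0 ≤ u * r / v := div_nonneg ((norm_nonneg z).trans hz.le) hv.le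
      rw [mul_min_of_nonneg _ _ (by positivity)]
      refine le_min ?_ ?_
      · refine (abs_sub _ _).trans ?_
        have h1 := hφ.abs_le (x - y' - z)
        have h2 := hφ.abs_le (x - y')
        rw [mul_one, two_mul, add_div]
        exact add_le_add h1 h2
      · refine (hφ.abs_sub_le _ _).trans ?_
        have h1 : ‖x - y' - z - (x - y')‖ ≤ u * r := by simpa using hz.le
        have h2 : A ≤ 2 * A := by linarith
        gcongr
    by_cases h1 : x ∈ Metric.closedBall (y' + z) (A * v)
    · rw [indicator_of_mem h1]
      exact mul_le_mul' hb1 le_self_add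
    by_cases h2 : x ∈ Metric.closedBall y' (A * v)
    · rw [indicator_of_mem h2]
      exact mul_le_mul' hb1 le_add_self
    · rw [Metric.mem_closedBall, not_le, dist_eq_norm] at h1 h2
      rw [sub_sub, hφ.eq_zero _ h1, hφ.eq_zero _ h2]
      simp
  calc ∫⁻ x, ‖conv φ k (x - y')‖ₑ * g x
      ≤ ∫⁻ x, ∫⁻ z, m (Ioi (‖z‖ / u)) * (ENNReal.ofReal (u ^ D)⁻¹ *
          (‖φ (x - y' - z) - φ (x - y')‖ₑ * g x)) := by
        refine lintegral_mono fun x => ?_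
        refine (mul_le_mul_left (hpt (x - y')) _).trans (le_of_eq ?_)
        have hm1 : Measurable fun z => ‖φ (x - y' - z) - φ (x - y')‖ₑ *
            (ENNReal.ofReal (u ^ D)⁻¹ * m (Ioi (‖z‖ / u))) :=
          ((hφm.comp (measurable_const.sub measurable_id)).sub_const _).enorm.mul
            (hmono.const_mul _)
        rw [← lintegral_mul_const _ hm1]
        refine lintegral_congr fun z => ?_
        ring
    _ = ∫⁻ z, m (Ioi (‖z‖ / u)) * (ENNReal.ofReal (u ^ D)⁻¹ *
          ∫⁻ x, ‖φ (x - y' - z) - φ (x - y')‖ₑ * g x) := by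
        have hm2 : Measurable fun p : E × E => m (Ioi (‖p.2‖ / u)) * (ENNReal.ofReal (u ^ D)⁻¹ *
            (‖φ (p.1 - y' - p.2) - φ (p.1 - y')‖ₑ * g p.1)) :=
          (hmono.comp measurable_snd).mul (hinc.const_mul _)
        rw [lintegral_lintegral_swap hm2.aemeasurable]
        refine lintegral_congr fun z => ?_
        rw [lintegral_const_mul' _ _ (measure_ne_top _ _),
          lintegral_const_mul' _ _ ENNReal.ofReal_ne_top]
    _ = ∫⁻ r, (∫⁻ z in {z : E | ‖z‖ / u < r}, ENNReal.ofReal (u ^ D)⁻¹ *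
          ∫⁻ x, ‖φ (x - y' - z) - φ (x - y')‖ₑ * g x) ∂m := by
        refine lintegral_measure_Ioi_mul (by fun_prop) (Measurable.const_mul ?_ _)
        exact hinc.lintegral_prod_left'
    _ ≤ ∫⁻ r, ENNReal.ofReal (2 * A) * (2 * K) * M * (ENNReal.ofReal (min 1 (u * r / v)) *
          ENNReal.ofReal r ^ D) ∂m := by
        refine lintegral_mono_ae (hm.mono fun r hr => ?_)
        have hρ : 0 < u * r := by positivity
        have hset : {z : E | ‖z‖ / u < r} = Metric.ball 0 (u * r) := by
          ext z
          simp [div_lt_iff₀ hu, mul_comm]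
        have hball2 : ∫⁻ z in Metric.ball (0 : E) (u * r), ∫⁻ x in Metric.closedBall y' (A * v), g x
            ≤ K * ENNReal.ofReal (u * r) ^ D * ENNReal.ofReal v ^ D * M := by
          rw [setLIntegral_const, Measure.addHaar_ball_of_pos _ _ hρ]
          have h1 : ∫⁻ x in Metric.closedBall y' (A * v), g x ≤
              volume (Metric.ball (0 : E) 1) * ENNReal.ofReal (2 * ((2 * A + 1) * v)) ^ D * M := by
            refine lintegral_closedBall_le_maximalFn volume g (by positivity)
              (Metric.closedBall_subset_closedBall' ?_)
            rw [dist_eq_norm]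
            linarith
          have h2 : 1 ≤ ENNReal.ofReal (A + 1) ^ D := by
            refine one_le_pow₀ ?_
            rw [ENNReal.one_le_ofReal]
            linarith
          calc _ ≤ volume (Metric.ball (0 : E) 1) * ENNReal.ofReal (2 * ((2 * A + 1) * v)) ^ D * M *
                (ENNReal.ofReal ((u * r) ^ D) * volume (Metric.ball (0 : E) 1)) := by gcongr
            _ = volume (Metric.ball (0 : E) 1) ^ 2 * ENNReal.ofReal (2 * (2 * A + 1)) ^ D * 1 *
                ENNReal.ofReal (u * r) ^ D * ENNReal.ofReal v ^ D * M := by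
                rw [← mul_assoc 2, ENNReal.ofReal_mul (q := v) (by positivity), mul_pow,
                  ENNReal.ofReal_pow hρ.le]
                ring
            _ ≤ _ := by rw [hK]; gcongr
        rw [hset, lintegral_const_mul' _ _ (by finiteness)]
        calc ENNReal.ofReal (u ^ D)⁻¹ * ∫⁻ z in Metric.ball (0 : E) (u * r),
              ∫⁻ x, ‖φ (x - y' - z) - φ (x - y')‖ₑ * g x
            ≤ ENNReal.ofReal (u ^ D)⁻¹ * ∫⁻ z in Metric.ball (0 : E) (u * r),
              ENNReal.ofReal (2 * A / v ^ D) * ENNReal.ofReal (min 1 (u * r / v)) *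
              ((∫⁻ x in Metric.closedBall (y' + z) (A * v), g x) +
                ∫⁻ x in Metric.closedBall y' (A * v), g x) := by
              refine mul_le_mul_right (setLIntegral_mono_ae' measurableSet_ball
                (Eventually.of_forall fun z hz => hincr r z (by simpa using hz))) _
          _ ≤ ENNReal.ofReal (u ^ D)⁻¹ * (ENNReal.ofReal (2 * A / v ^ D) *
              ENNReal.ofReal (min 1 (u * r / v)) *
              (K * ENNReal.ofReal (u * r) ^ D * ENNReal.ofReal v ^ D * M +
                K * ENNReal.ofReal (u * r) ^ D * ENNReal.ofReal v ^ D * M)) := by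
              rw [lintegral_const_mul' _ _ (by finiteness), lintegral_add_right _ measurable_const]
              exact mul_le_mul_right (mul_le_mul_right (add_le_add
                (lintegral_ball_lintegral_closedBall_le hA hv hρ hg hy) hball2) _) _
          _ = (ENNReal.ofReal (u ^ D)⁻¹ * ENNReal.ofReal (2 * A / v ^ D) *
              ENNReal.ofReal (u * r) ^ D * ENNReal.ofReal v ^ D) * (2 * K) * M *
                ENNReal.ofReal (min 1 (u * r / v)) := by ring
          _ = _ := by
              have : ENNReal.ofReal (u ^ D)⁻¹ * ENNReal.ofReal (2 * A / v ^ D) *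
                  ENNReal.ofReal (u * r) ^ D * ENNReal.ofReal v ^ D =
                  ENNReal.ofReal (2 * A) * ENNReal.ofReal r ^ D := by
                rw [← ENNReal.ofReal_pow hρ.le, ← ENNReal.ofReal_pow hv.le,
                  ← ENNReal.ofReal_pow hr.le, ← ENNReal.ofReal_mul (by positivity),
                  ← ENNReal.ofReal_mul (by positivity), ← ENNReal.ofReal_mul (by positivity),
                  ← ENNReal.ofReal_mul (by positivity)]
                congr 1
                rw [mul_pow]
                field_simp
              rw [this]
              ring
    _ = _ := by
        rw [lintegral_const_mul _ (by fun_prop)]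
        ring

end kernel

/-! ### The weighted inequality for compactly supported kernels -/

section weight

/-- The real inner product space underlying an inner product space over `𝕜`, on top of a given,
compatible real normed space structure. -/
@[reducible] def realInnerProductSpace (𝕜 : Type*) [RCLike 𝕜] (H : Type*) [NormedAddCommGroup H]
    [InnerProductSpace 𝕜 H] [NormedSpace ℝ H] [IsScalarTower ℝ 𝕜 H] : InnerProductSpace ℝ H where
  __ := ‹NormedSpace ℝ H›
  inner x y := RCLike.re (inner 𝕜 x y)
  norm_sq_eq_re_inner x := norm_sq_eq_re_inner (𝕜 := 𝕜) x
  conj_inner_symm x y := inner_re_symm (𝕜 := 𝕜) y x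
  add_left x y z := by simp only [inner_add_left, map_add]
  smul_left x y r := by
    rw [← algebraMap_smul 𝕜 r x, inner_smul_left]
    simp

theorem ofReal_integral_norm_sq {E H : Type*} [MeasureSpace E] [NormedAddCommGroup H]
    {q : E → H} (hq : Integrable fun x => ‖q x‖ ^ 2) :
    ENNReal.ofReal (∫ x, ‖q x‖ ^ 2) = ∫⁻ x, ‖q x‖ₑ ^ 2 := by
  rw [ofReal_integral_eq_lintegral_ofReal hq (Eventually.of_forall fun x => by positivity)]
  refine lintegral_congr fun x => ?_
  rw [ENNReal.ofReal_pow (norm_nonneg _), ofReal_norm]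

/-- The layer cake formula for a single number. -/
theorem lintegral_indicator_ofReal_lt (w : ℝ≥0∞) :
    ∫⁻ l in Ioi (0 : ℝ), {l : ℝ | ENNReal.ofReal l < w}.indicator 1 l = w := by
  have := ofReal_rpow_eq_lintegral zero_lt_one w
  simpa using this

variable {E : Type*} [NormedAddCommGroup E] [NormedSpace ℝ E] [MeasureSpace E] [BorelSpace E]
  [FiniteDimensional ℝ E] [(volume : Measure E).IsAddHaarMeasure]

variable (E) in
/-- A weighted inequality in the spirit of Chang, Wilson and Wolff. At a point where the weight
`W i` exceeds `l`, the function `w` exceeds `l` on the whole ball seen by the kernel, so that `h`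
may be replaced by its restriction to `{w > l}`. The unweighted inequality for these restrictions is
integrated in `l`. -/
theorem exists_tsum_lintegral_conv_sq_mul_le {β : ℝ} (hβ : 1 < β) (A : ℝ) :
    ∃ C : ℝ≥0, ∀ (𝕜 : Type*) [RCLike 𝕜] (H : Type*) [NormedAddCommGroup H]
      [InnerProductSpace 𝕜 H] [CompleteSpace H] [NormedSpace ℝ H] [IsScalarTower ℝ 𝕜 H]
      (φ : ℤ → E → ℝ), (∀ i, IsBump A (β ^ i) (φ i)) → (∀ i, ∫ x, φ i x = 0) →
      (∀ i x, φ i (-x) = φ i x) → ∀ h : E → H, IsBoundedBddSupport h →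
      ∀ (W : ℤ → E → ℝ≥0∞) (w : E → ℝ≥0∞), (∀ i, Measurable (W i)) → Measurable w →
      (∀ i y y', ‖y' - y‖ ≤ A * β ^ i → W i y' ≤ w y) →
      ∑' i, ∫⁻ y, ‖conv (φ i) h y‖ₑ ^ 2 * W i y ≤ C * ∫⁻ y, ‖h y‖ₑ ^ 2 * w y := by
  obtain ⟨C, hC, hmain⟩ := exists_sum_integral_conv_sq_le E hβ A
  refine ⟨C.toNNReal, ?_⟩
  intro 𝕜 _ H _ _ _ _ _ φ hφ hφ0 heven h hh W w hW hw hWw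
  have hL2 : ∀ q : E → H, IsBoundedBddSupport q → ∀ s : Finset ℤ,
      ∑ i ∈ s, ∫⁻ x, ‖conv (φ i) q x‖ₑ ^ 2 ≤ C.toNNReal * ∫⁻ x, ‖q x‖ₑ ^ 2 := by
    intro q hq s
    have h1 : ∑ i ∈ s, ∫ x, ‖conv (φ i) q x‖ ^ 2 ≤ C * ∫ x, ‖q x‖ ^ 2 :=
      letI := realInnerProductSpace 𝕜 H
      hmain H φ hφ hφ0 heven q hq s
    have hpos : ∀ i : ℤ, 0 < β ^ i := fun i => by
      have : 0 < β := by linarith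
      positivity
    have hi : ∀ i, Integrable fun x => ‖conv (φ i) q x‖ ^ 2 := fun i =>
      (((hφ i).isBoundedBddSupport (hpos i)).conv hq).norm_sq.integrable
    have h2 := ENNReal.ofReal_le_ofReal h1
    rw [ENNReal.ofReal_sum_of_nonneg fun i _ => by positivity, ENNReal.ofReal_mul hC.le,
      ofReal_integral_norm_sq hq.norm_sq.integrable] at h2
    simp only [ofReal_integral_norm_sq (hi _)] at h2
    exact h2
  have hpos : ∀ i : ℤ, 0 < β ^ i := fun i => by
    have : 0 < β := by linarith
    positivity
  have hqm : ∀ i, Measurable fun y => ‖conv (φ i) h y‖ₑ := fun i =>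
    (((hφ i).isBoundedBddSupport (hpos i)).conv hh).stronglyMeasurable.enorm
  have hhm : Measurable fun y => ‖h y‖ₑ := hh.stronglyMeasurable.enorm
  -- the restriction of `h` to a level set of `w`
  set hl : ℝ → E → H := fun l => {y | ENNReal.ofReal l < w y}.indicator h
  have hlm : ∀ l, IsBoundedBddSupport (hl l) := fun l =>
    hh.indicator (measurableSet_lt measurable_const hw)
  have hswap : ∀ (q : E → ℝ≥0∞) (w' : E → ℝ≥0∞), Measurable q → Measurable w' →
      ∫⁻ y, q y * w' y = ∫⁻ l in Ioi (0 : ℝ), ∫⁻ y in {y | ENNReal.ofReal l < w' y}, q y := by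
    intro q w' hq hw'
    have hs : MeasurableSet {p : E × ℝ | ENNReal.ofReal p.2 < w' p.1} :=
      measurableSet_lt (by fun_prop) (by fun_prop)
    calc ∫⁻ y, q y * w' y
        = ∫⁻ y, ∫⁻ l in Ioi (0 : ℝ),
            {p : E × ℝ | ENNReal.ofReal p.2 < w' p.1}.indicator (fun p => q p.1) (y, l) := by
          refine lintegral_congr fun y => ?_
          conv_lhs => rw [← lintegral_indicator_ofReal_lt (w' y)]
          have hm : Measurable ({l : ℝ | ENNReal.ofReal l < w' y}.indicator (1 : ℝ → ℝ≥0∞)) :=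
            measurable_one.indicator (measurableSet_lt (by fun_prop) measurable_const)
          rw [← lintegral_const_mul _ hm]
          refine lintegral_congr fun l => ?_
          by_cases hl : ENNReal.ofReal l < w' y <;> simp [indicator, hl]
      _ = ∫⁻ l in Ioi (0 : ℝ), ∫⁻ y,
            {p : E × ℝ | ENNReal.ofReal p.2 < w' p.1}.indicator (fun p => q p.1) (y, l) :=
          lintegral_lintegral_swap
            (f := fun y l => {p : E × ℝ | ENNReal.ofReal p.2 < w' p.1}.indicator
              (fun p => q p.1) (y, l))
            ((hq.comp measurable_fst).indicator hs).aemeasurable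
      _ = _ := by
          refine lintegral_congr fun l => ?_
          rw [← lintegral_indicator (measurableSet_lt measurable_const hw')]
          rfl
  rw [ENNReal.tsum_eq_iSup_sum]
  refine iSup_le fun s => ?_
  calc ∑ i ∈ s, ∫⁻ y, ‖conv (φ i) h y‖ₑ ^ 2 * W i y
      = ∑ i ∈ s, ∫⁻ l in Ioi (0 : ℝ), ∫⁻ y in {y | ENNReal.ofReal l < W i y},
          ‖conv (φ i) h y‖ₑ ^ 2 :=
        Finset.sum_congr rfl fun i _ => hswap _ _ ((hqm i).pow_const 2) (hW i)
    _ ≤ ∑ i ∈ s, ∫⁻ l in Ioi (0 : ℝ), ∫⁻ y, ‖conv (φ i) (hl l) y‖ₑ ^ 2 := by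
        refine Finset.sum_le_sum fun i _ => lintegral_mono fun l => ?_
        rw [← lintegral_indicator (measurableSet_lt measurable_const (hW i))]
        refine lintegral_mono fun y => ?_
        by_cases hy : ENNReal.ofReal l < W i y
        · have hy' : y ∈ {y | ENNReal.ofReal l < W i y} := hy
          rw [indicator_of_mem hy']
          have e : conv (φ i) h y = conv (φ i) (hl l) y := by
            simp only [conv]
            refine integral_congr_ae (Eventually.of_forall fun z => ?_)
            by_cases hz : A * β ^ i < ‖z‖
            · simp [(hφ i).eq_zero z hz]
            · have hmem : y - z ∈ {y | ENNReal.ofReal l < w y} :=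
                hy.trans_le (hWw i (y - z) y (by simpa using hz))
              simp only [hl, indicator_of_mem hmem]
          rw [e]
        · have hy' : y ∉ {y | ENNReal.ofReal l < W i y} := hy
          rw [indicator_of_notMem hy']
          exact zero_le
    _ = ∫⁻ l in Ioi (0 : ℝ), ∑ i ∈ s, ∫⁻ y, ‖conv (φ i) (hl l) y‖ₑ ^ 2 := by
        refine (lintegral_finsetSum s fun i _ => ?_).symm
        have hsm : StronglyMeasurable fun p : (ℝ × E) × E => φ i p.2 • hl p.1.1 (p.1.2 - p.2) := by
          refine (((hφ i).isBoundedBddSupport (hpos i)).stronglyMeasurable.comp_measurable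
            measurable_snd).smul ?_
          have hs : MeasurableSet {p : (ℝ × E) × E | ENNReal.ofReal p.1.1 < w (p.1.2 - p.2)} :=
            measurableSet_lt (by fun_prop) (by fun_prop)
          exact (hh.stronglyMeasurable.comp_measurable
            (g := fun p : (ℝ × E) × E => p.1.2 - p.2) (by fun_prop)).indicator hs
        have h1 : StronglyMeasurable fun p : ℝ × E => conv (φ i) (hl p.1) p.2 :=
          hsm.integral_prod_right
        exact (h1.enorm.pow_const 2).lintegral_prod_right'
    _ ≤ ∫⁻ l in Ioi (0 : ℝ), C.toNNReal * ∫⁻ y, ‖hl l y‖ₑ ^ 2 :=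
        lintegral_mono fun l => hL2 (hl l) (hlm l) s
    _ = C.toNNReal * ∫⁻ l in Ioi (0 : ℝ), ∫⁻ y in {y | ENNReal.ofReal l < w y}, ‖h y‖ₑ ^ 2 := by
        rw [lintegral_const_mul' _ _ ENNReal.coe_ne_top]
        congr 1
        refine lintegral_congr fun l => ?_
        rw [← lintegral_indicator (measurableSet_lt measurable_const hw)]
        refine lintegral_congr fun y => ?_
        by_cases hy : ENNReal.ofReal l < w y <;> simp [hl, indicator, hy]
    _ = _ := by rw [hswap _ _ (hhm.pow_const 2) hw]

end weight

/-! ### Decay across scales and the strong maximal function -/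

section decay

variable {E : Type*} [NormedAddCommGroup E] [NormedSpace ℝ E] [MeasureSpace E] [BorelSpace E]
  [FiniteDimensional ℝ E] [(volume : Measure E).IsAddHaarMeasure]

/-- The measures `m` for which the radial function `x ↦ m (‖x‖, ∞)` on a space of dimension `D` is
integrable, with a tail of order `R ^ (-ε)`: the last condition bounds the moment of order `D` of
`m` beyond `R`, and, on `(0, R)`, the moment of order `D + 1`, divided by `R`. -/
structure IsMajorantMeasure (D : ℕ) (ε : ℝ) (C : ℝ≥0) (m : Measure ℝ) : Prop where
  ae_pos : ∀ᵐ r ∂m, 0 < r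
  lintegral_le : ∫⁻ r, ENNReal.ofReal (1 + r) ^ D ∂m ≤ C
  lintegral_min_le : ∀ R : ℝ, 1 ≤ R →
    ∫⁻ r, ENNReal.ofReal (min 1 (r / R)) * ENNReal.ofReal r ^ D ∂m ≤ C * ENNReal.ofReal (R ^ (-ε))

theorem IsMajorantMeasure.isFiniteMeasure {D : ℕ} {ε : ℝ} {C : ℝ≥0} {m : Measure ℝ}
    (h : IsMajorantMeasure D ε C m) : IsFiniteMeasure m := by
  refine ⟨lt_of_le_of_lt ?_ (h.lintegral_le.trans_lt ENNReal.coe_lt_top)⟩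
  rw [← lintegral_one]
  refine lintegral_mono_ae (h.ae_pos.mono fun r hr => ?_)
  refine one_le_pow₀ ?_
  rw [ENNReal.one_le_ofReal]
  linarith

variable (E) in
/-- Geometric decay, in the ratio of the two scales, of the averages against the mollified
kernel. -/
theorem exists_lintegral_conv_dilate_le {β : ℝ} (hβ : 1 < β) (A : ℝ) {ε : ℝ}
    (hε0 : 0 ≤ ε) (hε1 : ε ≤ 1) (C₀ : ℝ≥0) :
    ∃ C : ℝ≥0, ∀ (𝕜 : Type*) [RCLike 𝕜] (ψ : E → 𝕜) (m : Measure ℝ),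
      IsRadiallyDominated m ψ → IsMajorantMeasure (Module.finrank ℝ E) ε C₀ m →
      ∀ (i k : ℤ) (u : ℝ), u ∈ Ico (β ^ k) (β ^ (k + 1)) →
      ∀ φ : E → ℝ, IsBump A (β ^ i) φ → ∫ x, φ x = 0 →
      ∀ g : E → ℝ≥0∞, Measurable g → ∀ y y' : E, ‖y' - y‖ ≤ A * β ^ i →
      ∫⁻ x, ‖conv φ (dilate u ψ) (x - y')‖ₑ * g x ≤
        C * ENNReal.ofReal ((β ^ (-ε)) ^ (i - k).natAbs) * maximalFn volume g y := by
  obtain ⟨C₁, h₁⟩ := exists_lintegral_conv_dilate_le_of_le E A C₀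
  obtain ⟨C₂, h₂⟩ := exists_lintegral_conv_dilate_le_of_ge E A
  have hβ0 : 0 < β := by linarith
  set θ := β ^ (-ε)
  have hθ : 0 < θ := Real.rpow_pos_of_pos hβ0 _
  refine ⟨C₁ + C₂ * C₀ * θ⁻¹.toNNReal, ?_⟩
  intro 𝕜 _ ψ m hψ hm i k u hu φ hφ hφ0 g hg y y' hy
  have := hm.isFiniteMeasure
  have hvpos : 0 < β ^ i := by positivity
  have hupos : 0 < u := lt_of_lt_of_le (by positivity) hu.1
  rcases le_or_gt i k with hik | hki
  · have hle : β ^ i / u ≤ θ ^ (i - k).natAbs := by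
      have h3 : β ^ i / β ^ k = β⁻¹ ^ (i - k).natAbs := by
        rw [← zpow_sub₀ hβ0.ne', inv_pow, ← zpow_natCast, ← zpow_neg]
        congr 1
        omega
      have h4 : β⁻¹ ≤ θ := by
        rw [← Real.rpow_neg_one]
        exact Real.rpow_le_rpow_of_exponent_le hβ.le (by linarith)
      calc β ^ i / u ≤ β ^ i / β ^ k := by gcongr; exact hu.1
        _ = β⁻¹ ^ (i - k).natAbs := h3
        _ ≤ _ := by gcongr
    refine (h₁ 𝕜 ψ m hψ hm.ae_pos hm.lintegral_le u (β ^ i) φ hvpos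
      ((zpow_le_zpow_right₀ hβ.le hik).trans hu.1) hφ hφ0 g hg y y' hy).trans ?_
    gcongr
    exact_mod_cast le_self_add
  · have huv : u ≤ β ^ i := hu.2.le.trans (zpow_le_zpow_right₀ hβ.le (by omega))
    refine (h₂ 𝕜 ψ m hψ hm.ae_pos u (β ^ i) φ hupos huv hφ g hg y y' hy).trans ?_
    have hR : 1 ≤ β ^ i / u := (one_le_div hupos).2 huv
    have h3 := hm.lintegral_min_le _ hR
    have e : ∀ r, r / (β ^ i / u) = u * r / β ^ i := fun r => by field_simp
    simp only [e] at h3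
    have h4 : (β ^ i / u) ^ (-ε) ≤ θ⁻¹ * θ ^ (i - k).natAbs := by
      have h5 : β ^ (i - k).natAbs / β ≤ β ^ i / u := by
        have h6 : β ^ (i - k).natAbs / β = β ^ i / β ^ (k + 1) := by
          rw [← zpow_natCast, Int.natAbs_of_nonneg (by omega), zpow_sub₀ hβ0.ne',
            zpow_add_one₀ hβ0.ne', div_div]
        rw [h6]
        gcongr
        exact hu.2.le
      refine (Real.rpow_le_rpow_of_nonpos (by positivity) h5 (by linarith)).trans (le_of_eq ?_)
      rw [Real.div_rpow (by positivity) hβ0.le, Real.rpow_pow_comm hβ0.le, div_eq_inv_mul]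
    calc _ ≤ C₂ * (C₀ * ENNReal.ofReal (θ⁻¹ * θ ^ (i - k).natAbs)) * maximalFn volume g y := by
          gcongr
          exact h3.trans (by gcongr)
      _ = ((C₂ * C₀ * θ⁻¹.toNNReal : ℝ≥0) : ℝ≥0∞) * ENNReal.ofReal (θ ^ (i - k).natAbs) *
            maximalFn volume g y := by
          rw [ENNReal.ofReal_mul (by positivity)]
          push_cast
          rw [← ENNReal.ofReal]
          ring
      _ ≤ _ := by
          gcongr
          exact_mod_cast le_add_self

/-- Cauchy–Schwarz for a nonnegative kernel. -/
theorem sq_lintegral_mul_le {X : Type*} [MeasurableSpace X] (μ : Measure X) {k q : X → ℝ≥0∞}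
    (hk : Measurable k) (hq : Measurable q) :
    (∫⁻ x, k x * q x ∂μ) ^ 2 ≤ (∫⁻ x, k x ∂μ) * ∫⁻ x, k x * q x ^ 2 ∂μ := by
  have h := ENNReal.lintegral_mul_le_Lp_mul_Lq μ Real.HolderConjugate.two_two
    (f := fun x => k x ^ (1 / 2 : ℝ)) (g := fun x => k x ^ (1 / 2 : ℝ) * q x)
    (hk.pow_const _).aemeasurable ((hk.pow_const _).mul hq).aemeasurable
  have hhalf : ∀ a : ℝ≥0∞, a ^ (1 / 2 : ℝ) * a ^ (1 / 2 : ℝ) = a := by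
    intro a
    rw [← ENNReal.rpow_add_of_nonneg _ _ (by norm_num) (by norm_num)]
    norm_num
  have hsq : ∀ a : ℝ≥0∞, (a ^ (1 / 2 : ℝ)) ^ (2 : ℝ) = a := by
    intro a
    rw [← ENNReal.rpow_mul]
    norm_num
  have hsq' : ∀ a : ℝ≥0∞, (a ^ (1 / 2 : ℝ)) ^ 2 = a := by
    intro a
    rw [pow_two, hhalf]
  simp only [Pi.mul_apply, ← mul_assoc, hhalf, hsq, ENNReal.mul_rpow_of_nonneg _ _ zero_le_two,
    ENNReal.rpow_two] at h
  calc _ ≤ _ := pow_le_pow_left' h 2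
    _ = _ := by rw [mul_pow, hsq', hsq']

/-- The maximal function in space, followed by the one in time. The two radii are
independent, so that no relation between the scalings in space and in time is needed. -/
noncomputable def strongMaximalFn (G : ℝ × E → ℝ≥0∞) (z : ℝ × E) : ℝ≥0∞ :=
  maximalFn volume (fun t => maximalFn volume (fun x => G (t, x)) z.2) z.1

theorem measurable_strongMaximalFn {G : ℝ × E → ℝ≥0∞} (hG : Measurable G) :
    Measurable fun z => strongMaximalFn G z := by
  have h1 : Measurable fun z : ℝ × E => maximalFn volume (fun x => G (z.1, x)) z.2 :=
    measurable_maximalFn_prod volume hG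
  have h2 : Measurable fun z : E × ℝ => maximalFn volume (fun x => G (z.2, x)) z.1 := by
    have := h1.comp measurable_swap
    simp only [Function.comp_def, Prod.fst_swap, Prod.snd_swap] at this
    exact this
  have h3 := (measurable_maximalFn_prod (X := ℝ) volume h2).comp measurable_swap
  simp only [Function.comp_def, Prod.fst_swap, Prod.snd_swap] at h3
  unfold strongMaximalFn
  exact h3

/-- The logarithmic average of `g` over times `2 ^ k ≤ τ < 2 ^ (k + 1)` after `s` is controlled by
the maximal function at `s`. -/
theorem lintegral_Ico_inv_mul_le (g : ℝ → ℝ≥0∞) (s : ℝ) (k : ℤ) :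
    ∫⁻ τ in Ico ((2 : ℝ) ^ k) (2 ^ (k + 1)), ENNReal.ofReal τ⁻¹ * g (s + τ) ≤
      8 * maximalFn volume g s := by
  have h2 : (0 : ℝ) < 2 ^ k := by positivity
  calc _ ≤ ∫⁻ τ in Ico ((2 : ℝ) ^ k) (2 ^ (k + 1)), ENNReal.ofReal (2 ^ k)⁻¹ * g (s + τ) := by
        refine setLIntegral_mono_ae' measurableSet_Ico (Eventually.of_forall fun τ hτ => ?_)
        gcongr
        exact hτ.1
    _ = ENNReal.ofReal (2 ^ k)⁻¹ * ∫⁻ τ, (Ico ((2 : ℝ) ^ k) (2 ^ (k + 1))).indicator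
          (fun τ => g (s + τ)) τ := by
        rw [lintegral_const_mul' _ _ (by finiteness), lintegral_indicator measurableSet_Ico]
    _ ≤ ENNReal.ofReal (2 ^ k)⁻¹ * ∫⁻ τ, (Metric.closedBall s (2 ^ (k + 1))).indicator
          g (s + τ) := by
        refine mul_le_mul_right (lintegral_mono fun τ => ?_) _
        by_cases hτ : τ ∈ Ico ((2 : ℝ) ^ k) (2 ^ (k + 1))
        · have : s + τ ∈ Metric.closedBall s (2 ^ (k + 1)) := by
            rw [Metric.mem_closedBall, Real.dist_eq, add_sub_cancel_left,
              abs_of_pos (h2.trans_le hτ.1)]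
            exact hτ.2.le
          rw [indicator_of_mem hτ, indicator_of_mem this]
        · rw [indicator_of_notMem hτ]
          exact zero_le
    _ = ENNReal.ofReal (2 ^ k)⁻¹ * ∫⁻ t in Metric.closedBall s (2 ^ (k + 1)), g t := by
        rw [lintegral_add_left_eq_self, lintegral_indicator measurableSet_closedBall]
    _ ≤ ENNReal.ofReal (2 ^ k)⁻¹ * (volume (Metric.ball (0 : ℝ) 1) *
          ENNReal.ofReal (2 * 2 ^ (k + 1)) ^ Module.finrank ℝ ℝ * maximalFn volume g s) :=
        mul_le_mul_right
          (lintegral_closedBall_le_maximalFn volume g (by positivity) subset_rfl) _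
    _ = _ := by
        rw [Module.finrank_self, pow_one, Real.volume_ball, ← mul_assoc, ← mul_assoc,
          ← ENNReal.ofReal_mul (by positivity), ← ENNReal.ofReal_mul (by positivity),
          zpow_add_one₀ two_ne_zero]
        congr 1
        rw [← ENNReal.ofReal_ofNat 8]
        congr 1
        field_simp
        norm_num

end decay

/-! ### The weighted inequality at a fixed source time -/

section fixedTime

variable {E : Type*} [NormedAddCommGroup E] [NormedSpace ℝ E] [MeasureSpace E] [BorelSpace E]
  [FiniteDimensional ℝ E] [(volume : Measure E).IsAddHaarMeasure]

theorem measurable_dilate_rpow {𝕜 : Type*} [RCLike 𝕜] {ψ : E → 𝕜} (hψ : Continuous ψ) (γ : ℝ)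
    {Y : Type*} [MeasurableSpace Y] {τ : Y → ℝ} {x : Y → E} (hτ : Measurable τ)
    (hx : Measurable x) : Measurable fun y => dilate (τ y ^ γ) ψ (x y) := by
  unfold dilate
  exact ((hτ.pow_const γ).pow_const _).inv.smul
    (hψ.measurable.comp ((hτ.pow_const γ).inv.smul hx))

theorem measurable_enorm_conv_dilate {𝕜 : Type*} [RCLike 𝕜] {ψ : E → 𝕜} (hψ : Continuous ψ)
    (γ : ℝ) {φ : E → ℝ} (hφ : IsBoundedBddSupport φ) :
    Measurable fun p : ℝ × E => ‖conv φ (dilate (p.1 ^ γ) ψ) p.2‖ₑ := by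
  have h : StronglyMeasurable fun p : (ℝ × E) × E =>
      φ p.2 • dilate (p.1.1 ^ γ) ψ (p.1.2 - p.2) :=
    (hφ.stronglyMeasurable.comp_measurable measurable_snd).smul
      (measurable_dilate_rpow hψ γ (by fun_prop) (by fun_prop)).stronglyMeasurable
  have h2 : StronglyMeasurable fun p : ℝ × E => conv φ (dilate (p.1 ^ γ) ψ) p.2 :=
    h.integral_prod_right
  exact h2.enorm

/-- Logarithmic integration over dyadic time intervals. -/
theorem lintegral_inv_mul_le {κ : ℝ → ℝ≥0∞} {g : ℝ → ℝ≥0∞} {c : ℤ → ℝ≥0∞} (s : ℝ)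
    (hg : Measurable g)
    (h : ∀ k : ℤ, ∀ τ ∈ Ico ((2 : ℝ) ^ k) (2 ^ (k + 1)), κ τ ≤ c k * g (s + τ)) :
    ∫⁻ τ in Ioi (0 : ℝ), ENNReal.ofReal τ⁻¹ * κ τ ≤ 8 * (∑' k, c k) * maximalFn volume g s := by
  have hcov : Ioi (0 : ℝ) ⊆ ⋃ k : ℤ, Ico ((2 : ℝ) ^ k) (2 ^ (k + 1)) := fun τ hτ => by
    obtain ⟨k, hk⟩ := exists_mem_Ico_zpow (mem_Ioi.1 hτ) (one_lt_two (α := ℝ))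
    exact mem_iUnion.2 ⟨k, hk⟩
  calc ∫⁻ τ in Ioi (0 : ℝ), ENNReal.ofReal τ⁻¹ * κ τ
      ≤ ∑' k : ℤ, ∫⁻ τ in Ico ((2 : ℝ) ^ k) (2 ^ (k + 1)), ENNReal.ofReal τ⁻¹ * κ τ :=
        (lintegral_mono_set hcov).trans (lintegral_iUnion_le _ _)
    _ ≤ ∑' k : ℤ, c k * (8 * maximalFn volume g s) := by
        refine ENNReal.tsum_le_tsum fun k => ?_
        calc _ ≤ ∫⁻ τ in Ico ((2 : ℝ) ^ k) (2 ^ (k + 1)),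
                c k * (ENNReal.ofReal τ⁻¹ * g (s + τ)) := by
              refine setLIntegral_mono_ae' measurableSet_Ico (Eventually.of_forall fun τ hτ => ?_)
              rw [mul_left_comm]
              exact mul_le_mul_right (h k τ hτ) _
          _ = c k * ∫⁻ τ in Ico ((2 : ℝ) ^ k) (2 ^ (k + 1)), ENNReal.ofReal τ⁻¹ * g (s + τ) :=
              lintegral_const_mul _ (by fun_prop)
          _ ≤ _ := mul_le_mul_right (lintegral_Ico_inv_mul_le g s k) _
    _ = _ := by
        rw [ENNReal.tsum_mul_right]
        ring

theorem tsum_ofReal_pow_natAbs {r : ℝ} (h0 : 0 ≤ r) (h1 : r < 1) (i : ℤ) :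
    ∑' k : ℤ, ENNReal.ofReal (r ^ (i - k).natAbs) = ENNReal.ofReal (∑' n : ℤ, r ^ n.natAbs) := by
  rw [ENNReal.ofReal_tsum_of_nonneg (fun n => by positivity) (summable_pow_natAbs h0 h1)]
  exact (Equiv.subLeft i).tsum_eq fun n : ℤ => ENNReal.ofReal (r ^ n.natAbs)

theorem tsum_ofReal_pow_natAbs' {r : ℝ} (h0 : 0 ≤ r) (h1 : r < 1) (k : ℤ) :
    ∑' i : ℤ, ENNReal.ofReal (r ^ (i - k).natAbs) = ENNReal.ofReal (∑' n : ℤ, r ^ n.natAbs) := by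
  rw [← tsum_ofReal_pow_natAbs h0 h1 k]
  refine tsum_congr fun i => ?_
  rw [← Int.natAbs_neg, neg_sub]

theorem rpow_mem_Ico_of_mem_Ico {γ τ : ℝ} (hγ : 0 < γ) {k : ℤ}
    (hτ : τ ∈ Ico ((2 : ℝ) ^ k) (2 ^ (k + 1))) :
    τ ^ γ ∈ Ico (((2 : ℝ) ^ γ) ^ k) (((2 : ℝ) ^ γ) ^ (k + 1)) := by
  have e : ∀ n : ℤ, ((2 : ℝ) ^ γ) ^ n = ((2 : ℝ) ^ n) ^ γ := fun n => by
    rw [← Real.rpow_intCast, ← Real.rpow_intCast, ← Real.rpow_mul zero_le_two,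
      ← Real.rpow_mul zero_le_two, mul_comm]
  have h2 : (0 : ℝ) < 2 ^ k := by positivity
  rw [e, e]
  exact ⟨Real.rpow_le_rpow h2.le hτ.1 hγ.le, Real.rpow_lt_rpow (h2.le.trans hτ.1) hτ.2 hγ⟩

/-- Cauchy–Schwarz for a nonnegative kernel on `ι × E`. -/
theorem sq_tsum_lintegral_mul_le {ι : Type*} [Countable ι] {k q : ι → E → ℝ≥0∞}
    (hk : ∀ i, Measurable (k i)) (hq : ∀ i, Measurable (q i)) :
    (∑' i, ∫⁻ y, k i y * q i y) ^ 2 ≤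
      (∑' i, ∫⁻ y, k i y) * ∑' i, ∫⁻ y, k i y * q i y ^ 2 := by
  let _ : MeasurableSpace ι := ⊤
  have hprod : ∀ f : ι → E → ℝ≥0∞, (∀ i, Measurable (f i)) →
      ∑' i, ∫⁻ y, f i y = ∫⁻ p : ι × E, f p.1 p.2 ∂(Measure.count.prod volume) := by
    intro f hf
    rw [lintegral_prod _ (measurable_from_prod_countable_right hf).aemeasurable, lintegral_count]
  rw [hprod _ hk, hprod (fun i y => k i y * q i y) fun i => (hk i).mul (hq i),
    hprod (fun i y => k i y * q i y ^ 2) fun i => (hk i).mul ((hq i).pow_const 2)]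
  exact sq_lintegral_mul_le _ (measurable_from_prod_countable_right hk)
    (measurable_from_prod_countable_right hq)

theorem measurable_maximalFn_left {G : ℝ × E → ℝ≥0∞} (hG : Measurable G) (y : E) :
    Measurable fun t => maximalFn volume (fun x => G (t, x)) y := by
  have h := (measurable_maximalFn_prod volume hG).comp
    (measurable_id.prodMk (measurable_const (a := y)))
  simp only [Function.comp_def, id] at h
  exact h

theorem measurable_strongMaximalFn_right {G : ℝ × E → ℝ≥0∞} (hG : Measurable G) (s : ℝ) :
    Measurable fun y => strongMaximalFn G (s, y) := by
  have h := (measurable_strongMaximalFn hG).comp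
    ((measurable_const (a := s)).prodMk measurable_id)
  simp only [Function.comp_def, id] at h
  exact h

set_option maxHeartbeats 1000000 in
variable (E) in
/-- The weighted inequality for a source `h` at time `s`. The reproducing formula and Cauchy–Schwarz
reduce it to the pieces `conv (tentDiff β i) h`, with weights `W i` that average `G` against the
mollified kernels. By the decay of these in the ratio of `τ ^ γ` to `β ^ i`, the logarithmic
integral over `τ` converges, and `W i` is dominated by the strong maximal function on balls of
radius `A * β ^ i`. -/
theorem exists_lintegral_sq_mul_le [Nontrivial E] {γ : ℝ} (hγ : 0 < γ) {ε : ℝ} (hε0 : 0 < ε)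
    (hε1 : ε ≤ 1) (C₀ : ℝ≥0) :
    ∃ C : ℝ≥0, ∀ (𝕜 : Type*) [RCLike 𝕜] (H : Type*) [NormedAddCommGroup H]
      [InnerProductSpace 𝕜 H] [CompleteSpace H] [NormedSpace ℝ H] [IsScalarTower ℝ 𝕜 H]
      (ψ : E → 𝕜) (m : Measure ℝ),
      IsRadiallyDominated m ψ → IsMajorantMeasure (Module.finrank ℝ E) ε C₀ m →
      ∀ h : E → H, Continuous h → HasCompactSupport h →
      ∀ G : ℝ × E → ℝ≥0∞, Measurable G → ∀ s : ℝ,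
      ∫⁻ τ in Ioi (0 : ℝ), ENNReal.ofReal τ⁻¹ *
          ∫⁻ x, ‖∫ y, dilate (τ ^ γ) ψ (x - y) • h y‖ₑ ^ 2 * G (s + τ, x) ≤
        C * ∫⁻ y, ‖h y‖ₑ ^ 2 * strongMaximalFn G (s, y) := by
  -- With this ratio of scales, `τ ^ γ` runs through the `k`-th one while `2 ^ k ≤ τ < 2 ^ (k + 1)`.
  set β : ℝ := 2 ^ γ with hβ_def
  have hβ : 1 < β := Real.one_lt_rpow one_lt_two hγ
  have hβ0 : 0 < β := by linarith
  have hpos : ∀ i : ℤ, (0 : ℝ) < β ^ i := fun i => by positivity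
  obtain ⟨A₁, hA₁⟩ := exists_isBump_tentDiff E hβ
  obtain ⟨A₂, hA₂⟩ := exists_isBump_tentDual E hβ
  set A := max A₁ A₂
  have hdiff : ∀ i : ℤ, IsBump A (β ^ i) (tentDiff β i : E → ℝ) := fun i =>
    (hA₁ i).mono (hpos i) (le_max_left _ _)
  have hdual : ∀ i : ℤ, IsBump A (β ^ i) (tentDual β i : E → ℝ) := fun i =>
    (hA₂ i).mono (hpos i) (le_max_right _ _)
  have hA : 0 ≤ A := (hdiff 0).nonneg (hpos 0)
  obtain ⟨C₁, h₁⟩ := exists_lintegral_conv_dilate_le E hβ A hε0.le hε1 C₀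
  obtain ⟨C₂, h₂⟩ := exists_tsum_lintegral_conv_sq_mul_le E hβ A
  set θ := β ^ (-ε)
  have hθ0 : 0 ≤ θ := Real.rpow_nonneg hβ0.le _
  have hθ1 : θ < 1 := Real.rpow_lt_one_of_one_lt_of_neg hβ (by linarith)
  set Θ : ℝ≥0 := (∑' n : ℤ, θ ^ n.natAbs).toNNReal
  refine ⟨(C₁ * Θ) * (C₂ * (8 * (C₁ * Θ))), ?_⟩
  intro 𝕜 _ H _ _ _ _ _ ψ m hψ hm h hc hs G hG s
  have hh := hc.isBoundedBddSupport hs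
  have hψc := hψ.contDiff.continuous
  set κ : ℤ → ℝ → E → ℝ≥0∞ := fun i τ x => ‖conv (tentDual β i) (dilate (τ ^ γ) ψ) x‖ₑ with hκ
  set q : ℤ → E → ℝ≥0∞ := fun i y => ‖conv (tentDiff β i) h y‖ₑ with hq
  have hκm : ∀ i, Measurable fun p : ℝ × E => κ i p.1 p.2 := fun i =>
    measurable_enorm_conv_dilate hψc γ ((hdual i).isBoundedBddSupport (hpos i))
  have hκm' : ∀ i τ, Measurable (κ i τ) := fun i τ =>
    (hκm i).comp (measurable_const.prodMk measurable_id)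
  have hqm : ∀ i, Measurable (q i) := fun i =>
    (((hdiff i).isBoundedBddSupport (hpos i)).conv hh).stronglyMeasurable.enorm
  have hdecay : ∀ (i k : ℤ), ∀ τ ∈ Ico ((2 : ℝ) ^ k) (2 ^ (k + 1)), ∀ g : E → ℝ≥0∞, Measurable g →
      ∀ y y' : E, ‖y' - y‖ ≤ A * β ^ i → ∫⁻ x, κ i τ (x - y') * g x ≤
        C₁ * ENNReal.ofReal (θ ^ (i - k).natAbs) * maximalFn volume g y :=
    fun i k τ hτ g hg y y' hy => h₁ 𝕜 ψ m hψ hm i k _ (rpow_mem_Ico_of_mem_Ico hγ hτ) _ (hdual i)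
      (integral_tentDual hβ0 i) g hg y y' hy
  -- the total mass of the kernels of all pieces
  have hmass : ∀ τ : ℝ, 0 < τ → ∀ x, ∑' i : ℤ, ∫⁻ y, κ i τ (x - y) ≤ C₁ * Θ := by
    intro τ hτ x
    obtain ⟨k, hk⟩ := exists_mem_Ico_zpow hτ (one_lt_two (α := ℝ))
    calc ∑' i : ℤ, ∫⁻ y, κ i τ (x - y)
        ≤ ∑' i : ℤ, C₁ * ENNReal.ofReal (θ ^ (i - k).natAbs) := by
          refine ENNReal.tsum_le_tsum fun i => ?_
          rw [lintegral_sub_left_eq_self (fun y => κ i τ y) x]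
          have h3 := hdecay i k τ hk (fun _ => 1) measurable_const 0 0
            (by simpa using mul_nonneg hA (hpos i).le)
          simp only [sub_zero, mul_one] at h3
          exact h3.trans (mul_le_of_le_one_right' (maximalFn_const_le volume 1 0))
      _ = C₁ * Θ := by
          rw [ENNReal.tsum_mul_left, tsum_ofReal_pow_natAbs' hθ0 hθ1]
          rfl
  have hpt : ∀ τ : ℝ, 0 < τ → ∀ x, ‖∫ y, dilate (τ ^ γ) ψ (x - y) • h y‖ₑ ^ 2 ≤
      C₁ * Θ * ∑' i : ℤ, ∫⁻ y, κ i τ (x - y) * q i y ^ 2 := by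
    intro τ hτ x
    have hu : 0 < τ ^ γ := Real.rpow_pos_of_pos hτ γ
    have h3 := enorm_integral_smul_le_tsum hβ (integrable_dilate hψ.integrable hu)
      (hψ.continuous_dilate _).stronglyMeasurable hc hs x
    calc _ ≤ (∑' i : ℤ, ∫⁻ y, κ i τ (x - y) * q i y) ^ 2 := pow_le_pow_left' h3 2
      _ ≤ (∑' i : ℤ, ∫⁻ y, κ i τ (x - y)) * ∑' i : ℤ, ∫⁻ y, κ i τ (x - y) * q i y ^ 2 :=
           sq_tsum_lintegral_mul_le (k := fun i y => κ i τ (x - y))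
            (fun i => (hκm' i τ).comp (measurable_const.sub measurable_id)) hqm
      _ ≤ _ := mul_le_mul_left (hmass τ hτ x) _
  set W : ℤ → E → ℝ≥0∞ := fun i y' =>
    ∫⁻ τ in Ioi (0 : ℝ), ENNReal.ofReal τ⁻¹ * ∫⁻ x, κ i τ (x - y') * G (s + τ, x) with hW
  have hm3 : ∀ i, Measurable fun p : (E × ℝ) × E =>
      κ i p.1.2 (p.2 - p.1.1) * G (s + p.1.2, p.2) := fun i =>
    ((hκm i).comp (f := fun p : (E × ℝ) × E => (p.1.2, p.2 - p.1.1)) (by fun_prop)).mul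
      (hG.comp (by fun_prop))
  have hWm : ∀ i, Measurable (W i) := by
    intro i
    have h4 : Measurable fun p : E × ℝ => ENNReal.ofReal p.2⁻¹ *
        ∫⁻ x, κ i p.2 (x - p.1) * G (s + p.2, x) :=
      Measurable.mul (by fun_prop) (hm3 i).lintegral_prod_right'
    exact h4.lintegral_prod_right'
  set w : E → ℝ≥0∞ := fun y => 8 * (C₁ * Θ) * strongMaximalFn G (s, y)
  have hwm : Measurable w := by
    have h5 : Measurable fun y : E => strongMaximalFn G (s, y) :=
      measurable_strongMaximalFn_right hG s
    exact h5.const_mul _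
  have hWw : ∀ i y y', ‖y' - y‖ ≤ A * β ^ i → W i y' ≤ w y := by
    intro i y y' hy
    have hg1 : Measurable fun t => maximalFn volume (fun x => G (t, x)) y :=
      measurable_maximalFn_left hG y
    have h6 := lintegral_inv_mul_le (κ := fun τ => ∫⁻ x, κ i τ (x - y') * G (s + τ, x))
      (g := fun t => maximalFn volume (fun x => G (t, x)) y)
      (c := fun k => C₁ * ENNReal.ofReal (θ ^ (i - k).natAbs)) s hg1
      (fun k τ hτ => hdecay i k τ hτ (fun x => G (s + τ, x))
        (hG.comp (measurable_const.prodMk measurable_id)) y y' hy)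
    rw [ENNReal.tsum_mul_left, tsum_ofReal_pow_natAbs hθ0 hθ1] at h6
    exact h6
  have hm4 : ∀ i, Measurable fun p : (ℝ × E) × E =>
      κ i p.1.1 (p.1.2 - p.2) * q i p.2 ^ 2 * G (s + p.1.1, p.1.2) := fun i =>
    (((hκm i).comp (f := fun p : (ℝ × E) × E => (p.1.1, p.1.2 - p.2)) (by fun_prop)).mul
      (((hqm i).comp measurable_snd).pow_const 2)).mul (hG.comp (by fun_prop))
  calc ∫⁻ τ in Ioi (0 : ℝ), ENNReal.ofReal τ⁻¹ *
          ∫⁻ x, ‖∫ y, dilate (τ ^ γ) ψ (x - y) • h y‖ₑ ^ 2 * G (s + τ, x)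
      ≤ ∫⁻ τ in Ioi (0 : ℝ), ENNReal.ofReal τ⁻¹ *
          ∫⁻ x, C₁ * Θ * ∑' i : ℤ, ∫⁻ y, κ i τ (x - y) * q i y ^ 2 * G (s + τ, x) := by
        refine setLIntegral_mono_ae' measurableSet_Ioi (Eventually.of_forall fun τ hτ => ?_)
        refine mul_le_mul_right (lintegral_mono fun x => ?_) _
        refine (mul_le_mul_left (hpt τ hτ x) _).trans (le_of_eq ?_)
        rw [mul_assoc, ← ENNReal.tsum_mul_right]
        congr 2 with i
        exact (lintegral_mul_const _ (((hκm' i τ).comp (measurable_const.sub measurable_id)).mul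
          ((hqm i).pow_const 2))).symm
    _ = C₁ * Θ * ∑' i : ℤ, ∫⁻ τ in Ioi (0 : ℝ), ENNReal.ofReal τ⁻¹ *
          ∫⁻ x, ∫⁻ y, κ i τ (x - y) * q i y ^ 2 * G (s + τ, x) := by
        have hm5 : ∀ i, Measurable fun p : ℝ × E =>
            ∫⁻ y, κ i p.1 (p.2 - y) * q i y ^ 2 * G (s + p.1, p.2) := fun i =>
          (hm4 i).lintegral_prod_right'
        rw [← lintegral_tsum, ← lintegral_const_mul' _ _ (by finiteness)]
        · refine lintegral_congr fun τ => ?_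
          rw [lintegral_const_mul' _ _ (by finiteness), lintegral_tsum, ENNReal.tsum_mul_left]
          · ring
          · exact fun i => ((hm5 i).comp (measurable_const.prodMk measurable_id)).aemeasurable
        · intro i
          exact (Measurable.mul (by fun_prop) (hm5 i).lintegral_prod_right').aemeasurable
    _ = C₁ * Θ * ∑' i : ℤ, ∫⁻ y, q i y ^ 2 * W i y := by
        congr 2 with i
        simp only [hW]
        have e1 : ∀ y, q i y ^ 2 * ∫⁻ τ in Ioi (0 : ℝ), ENNReal.ofReal τ⁻¹ *
            ∫⁻ x, κ i τ (x - y) * G (s + τ, x) = ∫⁻ τ in Ioi (0 : ℝ), ENNReal.ofReal τ⁻¹ *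
            ∫⁻ x, κ i τ (x - y) * q i y ^ 2 * G (s + τ, x) := by
          intro y
          have hfin : q i y ^ 2 ≠ ⊤ := ENNReal.pow_ne_top enorm_ne_top
          rw [← lintegral_const_mul' _ _ hfin]
          refine lintegral_congr fun τ => ?_
          rw [mul_left_comm, ← lintegral_const_mul' _ _ hfin]
          congr 2 with x
          ring
        simp only [e1]
        have hm6 : Measurable fun p : E × ℝ => ENNReal.ofReal p.2⁻¹ *
            ∫⁻ x, κ i p.2 (x - p.1) * q i p.1 ^ 2 * G (s + p.2, x) := by
          refine Measurable.mul (by fun_prop) ?_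
          exact ((hm4 i).comp (f := fun p : (E × ℝ) × E => ((p.1.2, p.2), p.1.1))
            (by fun_prop)).lintegral_prod_right'
        rw [lintegral_lintegral_swap hm6.aemeasurable]
        refine lintegral_congr fun τ => ?_
        rw [lintegral_const_mul' _ _ (by finiteness), lintegral_lintegral_swap]
        exact ((hm4 i).comp (f := fun p : E × E => ((τ, p.1), p.2)) (by fun_prop)).aemeasurable
    _ ≤ C₁ * Θ * (C₂ * ∫⁻ y, ‖h y‖ₑ ^ 2 * w y) :=
        mul_le_mul_right (h₂ 𝕜 H _ hdiff (integral_tentDiff hβ0) (tentDiff_neg β) h hh W w hWm hwm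
          hWw) _
    _ = _ := by
        have e2 : ∀ y, ‖h y‖ₑ ^ 2 * w y =
            8 * (C₁ * Θ) * (‖h y‖ₑ ^ 2 * strongMaximalFn G (s, y)) := fun y => by
          simp only [w]
          ring
        simp only [e2]
        rw [lintegral_const_mul' _ _ (by finiteness)]
        push_cast
        ring

end fixedTime

/-! ### The measure of a radial majorant -/

section majorant

/-- The measure `|ψbar'(r)| dr` on `(0, ∞)`. -/
noncomputable def derivMeasure (ψbar : ℝ → ℝ) : Measure ℝ :=
  (volume.restrict (Ioi 0)).withDensity fun r => ENNReal.ofReal |deriv ψbar r|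

theorem measurable_ofReal_abs_deriv (ψbar : ℝ → ℝ) :
    Measurable fun r => ENNReal.ofReal |deriv ψbar r| :=
  (measurable_deriv ψbar).abs.ennreal_ofReal

theorem setLIntegral_derivMeasure (ψbar : ℝ → ℝ) {ρ : ℝ} (hρ : 0 ≤ ρ) {g : ℝ → ℝ≥0∞}
    (hg : Measurable g) :
    ∫⁻ r in Ioi ρ, g r ∂(derivMeasure ψbar) =
      ∫⁻ r in Ioi ρ, ENNReal.ofReal |deriv ψbar r| * g r := by
  rw [derivMeasure, setLIntegral_withDensity_eq_setLIntegral_mul _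
    (measurable_ofReal_abs_deriv ψbar) hg measurableSet_Ioi,
    Measure.restrict_restrict measurableSet_Ioi, inter_eq_left.2 (Ioi_subset_Ioi hρ)]
  rfl

theorem ae_derivMeasure_pos (ψbar : ℝ → ℝ) : ∀ᵐ r ∂(derivMeasure ψbar), 0 < r :=
  (withDensity_absolutelyContinuous _ _).ae_le (ae_restrict_mem measurableSet_Ioi)

variable {𝕜 : Type*} [RCLike 𝕜] {d : ℕ} {α δ K : ℝ} {ψ : EuclideanSpace ℝ (Fin d) → 𝕜}
  {ψbar : ℝ → ℝ}

theorem IsRadialMajorant.derivMeasure_Ioi_le (h : IsRadialMajorant α δ K ψ ψbar) {ρ : ℝ}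
    (hρ : 0 ≤ ρ) : derivMeasure ψbar (Ioi ρ) ≤ ENNReal.ofReal K := by
  rw [← setLIntegral_one, setLIntegral_derivMeasure ψbar hρ measurable_const]
  simp only [mul_one]
  exact (lintegral_mono_set (Ioi_subset_Ioi hρ)).trans h.lintegral_deriv_le

/-- The radial majorant is dominated by a superposition of indicator functions of balls, as it
vanishes at infinity. -/
theorem IsRadialMajorant.le_derivMeasure (h : IsRadialMajorant α δ K ψ ψbar) {ρ : ℝ}
    (hρ : 0 ≤ ρ) : ψbar ρ ≤ (derivMeasure ψbar).real (Ioi ρ) := by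
  have hm : derivMeasure ψbar (Ioi ρ) = ∫⁻ r in Ioi ρ, ENNReal.ofReal |deriv ψbar r| := by
    rw [← setLIntegral_one, setLIntegral_derivMeasure ψbar hρ measurable_const]
    simp only [mul_one]
  have hfin : ∫⁻ r in Ioi ρ, ‖deriv ψbar r‖ₑ < ⊤ := by
    simp only [← ofReal_norm, Real.norm_eq_abs]
    rw [← hm]
    exact (h.derivMeasure_Ioi_le hρ).trans_lt ENNReal.ofReal_lt_top
  have hint : IntegrableOn (deriv ψbar) (Ioi ρ) :=
    ⟨(measurable_deriv ψbar).aestronglyMeasurable, hfin⟩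
  have hderiv : ∀ r ∈ Ioi ρ, HasDerivAt ψbar (deriv ψbar r) r := fun r hr =>
    ((h.contDiffOn.differentiableOn one_ne_zero).differentiableAt
      (Ici_mem_nhds (hρ.trans_lt hr))).hasDerivAt
  have hcont : ContinuousWithinAt ψbar (Ici ρ) ρ :=
    (h.contDiffOn.continuousOn ρ hρ).mono (Ici_subset_Ici.2 hρ)
  have hftc := integral_Ioi_of_hasDerivAt_of_tendsto hcont hderiv hint h.tendsto_zero
  have hreal : (derivMeasure ψbar).real (Ioi ρ) = ∫ r in Ioi ρ, ‖deriv ψbar r‖ := by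
    rw [measureReal_def, hm, integral_norm_eq_lintegral_enorm hint.aestronglyMeasurable]
    simp only [← ofReal_norm, Real.norm_eq_abs]
  calc ψbar ρ = -∫ r in Ioi ρ, deriv ψbar r := by rw [hftc]; ring
    _ ≤ ‖∫ r in Ioi ρ, deriv ψbar r‖ := neg_le_abs _
    _ ≤ _ := (norm_integral_le_integral_norm _).trans_eq hreal.symm

theorem IsRadialMajorant.setLIntegral_pow_le (h : IsRadialMajorant α δ K ψ ψbar) (hα : 0 < α)
    {r : ℝ} (hr : 1 ≤ r) :
    ∫⁻ ρ in Ioi r, ENNReal.ofReal ρ ^ d ∂(derivMeasure ψbar) ≤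
      K.toNNReal * ENNReal.ofReal (r ^ (-δ)) := by
  have h10 : (10 : ℝ) ^ (-1 / α) ≤ r :=
    (Real.rpow_le_one_of_one_le_of_nonpos (by norm_num)
      (div_nonpos_of_nonpos_of_nonneg (by norm_num) hα.le)).trans hr
  rw [setLIntegral_derivMeasure ψbar (zero_le_one.trans hr) (by fun_prop)]
  calc _ = ∫⁻ ρ in Ioi r, ENNReal.ofReal (|deriv ψbar ρ| * ρ ^ d) := by
        refine setLIntegral_congr_fun measurableSet_Ioi fun ρ hρ => ?_
        have : 0 ≤ ρ := by linarith [mem_Ioi.1 hρ]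
        rw [ENNReal.ofReal_mul (abs_nonneg _), ENNReal.ofReal_pow this]
    _ ≤ ENNReal.ofReal (K / r ^ δ) := h.lintegral_tail_le r h10
    _ = _ := by
        rw [div_eq_mul_inv, ← Real.rpow_neg (by linarith), mul_comm,
          ENNReal.ofReal_mul (by positivity), mul_comm]
        rfl

theorem IsRadialMajorant.lintegral_one_add_pow_le (h : IsRadialMajorant α δ K ψ ψbar)
    (hα : 0 < α) :
    ∫⁻ r, ENNReal.ofReal (1 + r) ^ d ∂(derivMeasure ψbar) ≤ 2 ^ d * (2 * K.toNNReal) := by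
  have hsplit : ∀ᵐ r ∂(derivMeasure ψbar), ENNReal.ofReal (1 + r) ^ d ≤
      2 ^ d * ((Ioi (0 : ℝ)).indicator 1 r +
        (Ioi (1 : ℝ)).indicator (fun r => ENNReal.ofReal r ^ d) r) := by
    refine (ae_derivMeasure_pos ψbar).mono fun r hr => ?_
    rcases le_or_gt r 1 with h1 | h1
    · rw [indicator_of_mem (mem_Ioi.2 hr), indicator_of_notMem (by simpa using h1)]
      simp only [Pi.one_apply, add_zero, mul_one]
      gcongr
      rw [← ENNReal.ofReal_ofNat]
      exact ENNReal.ofReal_le_ofReal (by linarith)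
    · rw [indicator_of_mem (mem_Ioi.2 hr), indicator_of_mem (mem_Ioi.2 h1), mul_add, ← mul_pow]
      refine le_trans ?_ le_add_self
      gcongr
      rw [← ENNReal.ofReal_ofNat, ← ENNReal.ofReal_mul zero_le_two]
      exact ENNReal.ofReal_le_ofReal (by linarith)
  refine (lintegral_mono_ae hsplit).trans ?_
  rw [lintegral_const_mul' _ _ (by finiteness), lintegral_add_left
    (measurable_one.indicator measurableSet_Ioi), lintegral_indicator_one measurableSet_Ioi,
    lintegral_indicator measurableSet_Ioi, two_mul]
  gcongr
  · exact h.derivMeasure_Ioi_le le_rfl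
  · simpa using h.setLIntegral_pow_le hα le_rfl

/-- The exponent comes from a splitting of the moment at `√R`, where the two parts are of order
`R ^ (-1 / 2)` and `R ^ (-δ / 2)`. -/
theorem IsRadialMajorant.isMajorantMeasure (h : IsRadialMajorant α δ K ψ ψbar) (hα : 0 < α) :
    IsMajorantMeasure d (min 1 δ / 2) (2 ^ d * (2 * K.toNNReal) + K.toNNReal)
      (derivMeasure ψbar) where
  ae_pos := ae_derivMeasure_pos ψbar
  lintegral_le := by
    refine (h.lintegral_one_add_pow_le hα).trans ?_
    push_cast
    exact le_self_add
  lintegral_min_le := by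
    intro R hR
    have hR0 : 0 < R := by linarith
    set ε := min 1 δ / 2 with hε
    have hsq : 1 ≤ √R := Real.one_le_sqrt.2 hR
    have hsplit : ∀ᵐ r ∂(derivMeasure ψbar),
        ENNReal.ofReal (min 1 (r / R)) * ENNReal.ofReal r ^ d ≤
        ENNReal.ofReal (R ^ (-ε)) * ENNReal.ofReal (1 + r) ^ d +
          (Ioi (√R)).indicator (fun r => ENNReal.ofReal r ^ d) r := by
      refine (ae_derivMeasure_pos ψbar).mono fun r hr => ?_
      rcases le_or_gt r (√R) with h1 | h1
      · refine le_trans ?_ le_self_add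
        gcongr ENNReal.ofReal ?_ * ENNReal.ofReal ?_ ^ d
        · calc min 1 (r / R) ≤ √R / R := (min_le_right _ _).trans (by gcongr)
            _ = R ^ (-(1 / 2) : ℝ) := by
              rw [Real.sqrt_div_self, Real.sqrt_eq_rpow, ← Real.rpow_neg hR0.le, one_div]
            _ ≤ R ^ (-ε) := by
              refine Real.rpow_le_rpow_of_exponent_le hR ?_
              linarith [min_le_left 1 δ]
        · linarith
      · rw [indicator_of_mem (mem_Ioi.2 h1)]
        refine le_trans (mul_le_of_le_one_left' ?_) le_add_self
        rw [ENNReal.ofReal_le_one]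
        exact min_le_left _ _
    have htail : (√R) ^ (-δ) ≤ R ^ (-ε) := by
      rw [Real.sqrt_eq_rpow, ← Real.rpow_mul hR0.le]
      refine Real.rpow_le_rpow_of_exponent_le hR ?_
      linarith [min_le_right 1 δ]
    calc _ ≤ ∫⁻ r, ENNReal.ofReal (R ^ (-ε)) * ENNReal.ofReal (1 + r) ^ d +
          (Ioi (√R)).indicator (fun r => ENNReal.ofReal r ^ d) r ∂(derivMeasure ψbar) :=
          lintegral_mono_ae hsplit
      _ = ENNReal.ofReal (R ^ (-ε)) * ∫⁻ r, ENNReal.ofReal (1 + r) ^ d ∂(derivMeasure ψbar) +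
          ∫⁻ r in Ioi (√R), ENNReal.ofReal r ^ d ∂(derivMeasure ψbar) := by
          rw [lintegral_add_left (by fun_prop), lintegral_const_mul' _ _ (by finiteness),
            lintegral_indicator measurableSet_Ioi]
      _ ≤ ENNReal.ofReal (R ^ (-ε)) * (2 ^ d * (2 * K.toNNReal)) +
          K.toNNReal * ENNReal.ofReal (R ^ (-ε)) := by
          gcongr
          · exact h.lintegral_one_add_pow_le hα
          · exact (h.setLIntegral_pow_le hα hsq).trans (by gcongr)
      _ = _ := by
          push_cast
          ring

theorem IsRadialMajorant.norm_le (h : IsRadialMajorant α δ K ψ ψbar)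
    (x : EuclideanSpace ℝ (Fin d)) :
    ‖ψ x‖ ≤ (derivMeasure ψbar).real (Ioi ‖x‖) ∧
      ‖fderiv ℝ ψ x‖ ≤ (derivMeasure ψbar).real (Ioi ‖x‖) := by
  have h1 := (h.le_majorant x).trans (h.le_derivMeasure (norm_nonneg x))
  have h2 : 0 ≤ ‖x‖ * ‖fderiv ℝ ψ x‖ := by positivity
  constructor <;> linarith [norm_nonneg (ψ x), norm_nonneg (fderiv ℝ ψ x)]

theorem IsRadialMajorant.integrable (h : IsRadialMajorant α δ K ψ ψbar) (hα : 0 < α)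
    (hψ : Continuous ψ) : Integrable ψ := by
  refine ⟨hψ.aestronglyMeasurable, ?_⟩
  have hfin := (h.isMajorantMeasure hα).isFiniteMeasure
  calc ∫⁻ x, ‖ψ x‖ₑ ≤ ∫⁻ x, derivMeasure ψbar (Ioi ‖x‖) * 1 := by
        refine lintegral_mono fun x => ?_
        rw [mul_one, ← ofReal_norm]
        exact (ENNReal.ofReal_le_ofReal (h.norm_le x).1).trans_eq (ofReal_measureReal)
    _ = ∫⁻ r, volume (Metric.ball (0 : EuclideanSpace ℝ (Fin d)) r) ∂(derivMeasure ψbar) := by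
        rw [lintegral_measure_Ioi_mul measurable_norm measurable_const]
        refine lintegral_congr fun r => ?_
        rw [setLIntegral_one, Metric.ball]
        simp only [dist_zero_right]
    _ ≤ ∫⁻ r, ENNReal.ofReal (1 + r) ^ d *
          volume (Metric.ball (0 : EuclideanSpace ℝ (Fin d)) 1) ∂(derivMeasure ψbar) := by
        refine lintegral_mono_ae ((ae_derivMeasure_pos ψbar).mono fun r hr => ?_)
        rw [Measure.addHaar_ball_of_pos _ _ hr, finrank_euclideanSpace_fin,
          ENNReal.ofReal_pow hr.le]
        gcongr
        linarith
    _ < ⊤ := by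
        rw [lintegral_mul_const' _ _ measure_ball_lt_top.ne]
        exact ENNReal.mul_lt_top
          ((h.isMajorantMeasure hα).lintegral_le.trans_lt ENNReal.coe_lt_top) measure_ball_lt_top

/-- The bound on the Fourier transform near the origin is used through the vanishing of the mean
only. -/
theorem IsAdmissibleKernel.integral_eq_zero {ν lam : ℝ} (h : IsAdmissibleKernel α ν lam δ K ψ)
    (hν : 0 < ν) (hψ : Integrable ψ) : ∫ x, ψ x = 0 := by
  have h0 : fourierHat ψ 0 = 0 := by
    have := h.fourier_le 0
    rwa [norm_zero, Real.zero_rpow hν.ne', mul_zero, norm_le_zero_iff] at this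
  have h1 : RCLike.map 𝕜 ℂ (∫ x, ψ x) = 0 := by
    rw [← ContinuousLinearMap.integral_comp_comm _ hψ]
    have hpi : ((2 * Real.pi : ℝ) : ℂ)⁻¹ ^ d ≠ 0 := by
      refine pow_ne_zero _ (inv_ne_zero ?_)
      exact_mod_cast (by positivity : (2 * Real.pi : ℝ) ≠ 0)
    have h2 := (mul_eq_zero.1 h0).resolve_left hpi
    simpa using h2
  rw [RCLike.map_apply] at h1
  refine RCLike.ext ?_ ?_
  · simpa using congrArg Complex.re h1
  · simpa using congrArg Complex.im h1

theorem IsAdmissibleKernel.exists_isRadiallyDominated {ν lam : ℝ}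
    (h : IsAdmissibleKernel α ν lam δ K ψ) (hα : 0 < α) (hν : 0 < ν) :
    ∃ m : Measure ℝ, IsRadiallyDominated m ψ ∧
      IsMajorantMeasure (Module.finrank ℝ (EuclideanSpace ℝ (Fin d))) (min 1 δ / 2)
        (2 ^ d * (2 * K.toNNReal) + K.toNNReal) m := by
  obtain ⟨ψbar, hbar⟩ := h.exists_majorant
  have hint := hbar.integrable hα h.contDiff.continuous
  refine ⟨derivMeasure ψbar, ⟨h.contDiff, fun x => (hbar.norm_le x).1, fun x => (hbar.norm_le x).2,
    hint, h.integral_eq_zero hν hint⟩, ?_⟩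
  rw [finrank_euclideanSpace_fin]
  exact hbar.isMajorantMeasure hα

end majorant

/-! ### The weighted inequality and duality -/

/-- Duality between `L^r` and `L^r'`, without an integrability hypothesis on `F`: the extremizer
`F ^ (r - 1)` is truncated in height and to sets of finite measure. -/
theorem lintegral_rpow_le_of_forall_lintegral_mul_le {Z : Type*} [MeasurableSpace Z]
    (μ : Measure Z) [SigmaFinite μ] {r r' : ℝ} (hr : r.HolderConjugate r') {F : Z → ℝ≥0∞}
    (hF : Measurable F) {B : ℝ≥0∞}
    (h : ∀ G : Z → ℝ≥0∞, Measurable G → ∫⁻ z, F z * G z ∂μ ≤ B * (∫⁻ z, G z ^ r' ∂μ) ^ (1 / r')) :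
    ∫⁻ z, F z ^ r ∂μ ≤ B ^ r := by
  have hr0 := hr.pos
  have hr1 := hr.sub_one_pos
  set T : ℕ → Z → ℝ≥0∞ := fun n =>
    (spanningSets μ n).indicator fun z => min (F z) n ^ r with hT
  have hTm : ∀ n, Measurable (T n) := fun n =>
    ((hF.min measurable_const).pow_const r).indicator (measurableSet_spanningSets μ n)
  have hbound : ∀ n, ∫⁻ z, T n z ∂μ ≤ B ^ r := by
    intro n
    set G : Z → ℝ≥0∞ := (spanningSets μ n).indicator fun z => min (F z) n ^ (r - 1) with hG
    have hGm : Measurable G :=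
      ((hF.min measurable_const).pow_const _).indicator (measurableSet_spanningSets μ n)
    have hGr : ∀ z, G z ^ r' = T n z := by
      intro z
      by_cases hz : z ∈ spanningSets μ n
      · rw [hG, hT]
        simp only [indicator_of_mem hz]
        rw [← ENNReal.rpow_mul, hr.sub_one_mul_conj]
      · rw [hG, hT]
        simp only [indicator_of_notMem hz]
        exact ENNReal.zero_rpow_of_pos hr.symm.pos
    have hTG : ∀ z, T n z ≤ F z * G z := by
      intro z
      by_cases hz : z ∈ spanningSets μ n
      · rw [hG, hT]
        simp only [indicator_of_mem hz]
        calc min (F z) n ^ r = min (F z) n ^ (1 + (r - 1)) := by rw [add_sub_cancel]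
          _ = min (F z) n * min (F z) n ^ (r - 1) := by
            rw [ENNReal.rpow_add_of_nonneg _ _ zero_le_one hr1.le, ENNReal.rpow_one]
          _ ≤ _ := mul_le_mul_left (min_le_left _ _) _
      · rw [hT]
        simp only [indicator_of_notMem hz]
        exact zero_le
    set I := ∫⁻ z, T n z ∂μ with hI
    have hIfin : I ≠ ⊤ := by
      refine ne_of_lt ?_
      calc I ≤ ∫⁻ z, (spanningSets μ n).indicator (fun _ => (n : ℝ≥0∞) ^ r) z ∂μ := by
            refine lintegral_mono fun z => indicator_le_indicator ?_
            exact ENNReal.rpow_le_rpow (min_le_right _ _) hr0.le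
        _ = (n : ℝ≥0∞) ^ r * μ (spanningSets μ n) := by
            rw [lintegral_indicator (measurableSet_spanningSets μ n), setLIntegral_const]
        _ < ⊤ := ENNReal.mul_lt_top
            (ENNReal.rpow_lt_top_of_nonneg hr0.le (ENNReal.natCast_ne_top n))
            (measure_spanningSets_lt_top μ n)
    have hI1 : I ≤ B * I ^ (1 / r') := by
      have h2 := h G hGm
      simp only [hGr] at h2
      exact (lintegral_mono hTG).trans h2
    rcases eq_or_ne I 0 with h0 | h0
    · rw [h0]
      exact zero_le
    · have hsplit : I = I ^ (1 / r) * I ^ (1 / r') := by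
        rw [← ENNReal.rpow_add _ _ h0 hIfin, one_div, one_div, hr.inv_add_inv_eq_one,
          ENNReal.rpow_one]
      have hne : I ^ (1 / r') ≠ 0 := by
        simp [ENNReal.rpow_eq_zero_iff, h0, hIfin]
      have hnt : I ^ (1 / r') ≠ ⊤ :=
        ENNReal.rpow_ne_top_of_nonneg (by have := hr.symm.pos; positivity) hIfin
      have h3 : I ^ (1 / r) ≤ B := by
        rw [hsplit] at hI1
        refine (ENNReal.mul_le_mul_iff_left hne hnt).1 ?_
        rwa [← hsplit] at hI1 ⊢
      calc I = (I ^ (1 / r)) ^ r := by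
            rw [← ENNReal.rpow_mul, one_div, inv_mul_cancel₀ hr0.ne', ENNReal.rpow_one]
        _ ≤ B ^ r := ENNReal.rpow_le_rpow h3 hr0.le
  have hlim : ∀ z, Tendsto (fun n => T n z) atTop (𝓝 (F z ^ r)) := by
    intro z
    have h1 : Tendsto (fun n : ℕ => min (F z) (n : ℝ≥0∞) ^ r) atTop (𝓝 (F z ^ r)) := by
      have h2 : Tendsto (fun n : ℕ => min (F z) (n : ℝ≥0∞)) atTop (𝓝 (min (F z) ⊤)) :=
        tendsto_const_nhds.min ENNReal.tendsto_nat_nhds_top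
      rw [min_top_right] at h2
      exact (ENNReal.continuous_rpow_const.tendsto _).comp h2
    refine h1.congr' ?_
    filter_upwards [eventually_ge_atTop (spanningSetsIndex μ z)] with n hn
    rw [hT]
    simp only []
    rw [indicator_of_mem (mem_spanningSets_of_index_le μ z hn)]
  calc ∫⁻ z, F z ^ r ∂μ = ∫⁻ z, liminf (fun n => T n z) atTop ∂μ :=
        lintegral_congr fun z => (hlim z).liminf_eq.symm
    _ ≤ liminf (fun n => ∫⁻ z, T n z ∂μ) atTop := lintegral_liminf_le hTm
    _ ≤ liminf (fun _ : ℕ => B ^ r) atTop := liminf_le_liminf (Eventually.of_forall hbound)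
    _ = B ^ r := liminf_const _

section squareFunction

variable {E : Type*} [NormedAddCommGroup E] [NormedSpace ℝ E] [MeasureSpace E] [BorelSpace E]
  [FiniteDimensional ℝ E] [(volume : Measure E).IsAddHaarMeasure]

variable (E) in
theorem exists_lintegral_strongMaximalFn_rpow_le [Nontrivial E] {q : ℝ} (hq : 1 < q) :
    ∃ C : ℝ≥0, ∀ G : ℝ × E → ℝ≥0∞, Measurable G →
      ∫⁻ z, strongMaximalFn G z ^ q ≤ C * ∫⁻ z, G z ^ q := by
  obtain ⟨C₁, h₁⟩ := exists_lintegral_maximalFn_rpow_le (volume : Measure ℝ) hq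
  obtain ⟨C₂, h₂⟩ := exists_lintegral_maximalFn_rpow_le (volume : Measure E) hq
  refine ⟨C₁ * C₂, fun G hG => ?_⟩
  have hM : Measurable fun z : ℝ × E => maximalFn volume (fun x => G (z.1, x)) z.2 :=
    measurable_maximalFn_prod volume hG
  have hMq : Measurable fun z : ℝ × E => maximalFn volume (fun x => G (z.1, x)) z.2 ^ q :=
    hM.pow_const q
  rw [Measure.volume_eq_prod]
  calc ∫⁻ z, strongMaximalFn G z ^ q ∂(volume.prod volume)
      = ∫⁻ x : E, ∫⁻ t : ℝ, strongMaximalFn G (t, x) ^ q :=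
        lintegral_prod_symm _ ((measurable_strongMaximalFn hG).pow_const q).aemeasurable
    _ ≤ ∫⁻ x : E, C₁ * ∫⁻ t : ℝ, maximalFn volume (fun x => G (t, x)) x ^ q :=
        lintegral_mono fun x => h₁ _ (measurable_maximalFn_left hG x)
    _ = C₁ * ∫⁻ x : E, ∫⁻ t : ℝ, maximalFn volume (fun x => G (t, x)) x ^ q :=
        lintegral_const_mul' _ _ ENNReal.coe_ne_top
    _ = C₁ * ∫⁻ t : ℝ, ∫⁻ x : E, maximalFn volume (fun x => G (t, x)) x ^ q := by
        rw [← lintegral_prod_symm _ hMq.aemeasurable, lintegral_prod _ hMq.aemeasurable]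
    _ ≤ C₁ * ∫⁻ t : ℝ, C₂ * ∫⁻ x : E, G (t, x) ^ q :=
        mul_le_mul_right (lintegral_mono fun t => h₂ _ (hG.comp measurable_prodMk_left)) _
    _ = _ := by
        rw [lintegral_const_mul' _ _ ENNReal.coe_ne_top,
          lintegral_prod _ (hG.pow_const q).aemeasurable, ← mul_assoc, ENNReal.coe_mul]

theorem strongMaximalFn_one_le (z : ℝ × E) : strongMaximalFn (fun _ => 1) z ≤ 1 := by
  unfold strongMaximalFn
  refine (maximalFn_mono (g₂ := fun _ => 1) volume (fun t => ?_) z.1).trans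
    (maximalFn_const_le volume 1 z.1)
  exact maximalFn_const_le volume 1 z.2

variable {𝕜 : Type*} [RCLike 𝕜] {H : Type*} [NormedAddCommGroup H] [InnerProductSpace 𝕜 H]
  [CompleteSpace H] [NormedSpace ℝ H] [IsScalarTower ℝ 𝕜 H]

/-- The square of the parabolic square function over all source times `s`. The times `s ≥ t` do
not contribute, because `ENNReal.ofReal (t - s)⁻¹ = 0` there. -/
noncomputable def parabolicSquare (γ : ℝ) (ψ : E → 𝕜) (f : ℝ × E → H) (z : ℝ × E) : ℝ≥0∞ :=
  ∫⁻ s, ENNReal.ofReal (z.1 - s)⁻¹ *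
    ‖∫ y, dilate ((z.1 - s) ^ γ) ψ (z.2 - y) • f (s, y)‖ₑ ^ 2

theorem measurable_parabolicSquare_integrand (γ : ℝ) {ψ : E → 𝕜} (hψ : Continuous ψ)
    {f : ℝ × E → H} (hf : Continuous f) :
    Measurable fun p : (ℝ × E) × ℝ => ENNReal.ofReal (p.1.1 - p.2)⁻¹ *
      ‖∫ y, dilate ((p.1.1 - p.2) ^ γ) ψ (p.1.2 - y) • f (p.2, y)‖ₑ ^ 2 := by
  have h1 : StronglyMeasurable fun p : ((ℝ × E) × ℝ) × E =>
      dilate ((p.1.1.1 - p.1.2) ^ γ) ψ (p.1.1.2 - p.2) • f (p.1.2, p.2) :=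
    (measurable_dilate_rpow hψ γ (by fun_prop) (by fun_prop)).stronglyMeasurable.smul
      (hf.comp (by fun_prop)).stronglyMeasurable
  exact Measurable.mul (by fun_prop) ((h1.integral_prod_right).enorm.pow_const 2)

theorem measurable_parabolicSquare (γ : ℝ) {ψ : E → 𝕜} (hψ : Continuous ψ)
    {f : ℝ × E → H} (hf : Continuous f) : Measurable (parabolicSquare γ ψ f) :=
  (measurable_parabolicSquare_integrand γ hψ hf).lintegral_prod_right'

theorem lintegral_ofReal_inv_mul (g : ℝ → ℝ≥0∞) :
    ∫⁻ τ, ENNReal.ofReal τ⁻¹ * g τ = ∫⁻ τ in Ioi (0 : ℝ), ENNReal.ofReal τ⁻¹ * g τ := by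
  rw [← lintegral_indicator measurableSet_Ioi]
  refine lintegral_congr fun τ => ?_
  by_cases hτ : τ ∈ Ioi (0 : ℝ)
  · rw [indicator_of_mem hτ]
  · rw [indicator_of_notMem hτ, ENNReal.ofReal_of_nonpos (inv_nonpos.2 (not_lt.1 hτ)), zero_mul]

variable (E) in
/-- The weighted `L²` inequality. In the time variable `t`, it is the one at a fixed source time `s`
with `τ = t - s`. -/
theorem exists_lintegral_parabolicSquare_mul_le [Nontrivial E] {γ : ℝ} (hγ : 0 < γ) {ε : ℝ}
    (hε0 : 0 < ε) (hε1 : ε ≤ 1) (C₀ : ℝ≥0) :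
    ∃ C : ℝ≥0, ∀ (𝕜 : Type*) [RCLike 𝕜] (H : Type*) [NormedAddCommGroup H]
      [InnerProductSpace 𝕜 H] [CompleteSpace H] [NormedSpace ℝ H] [IsScalarTower ℝ 𝕜 H]
      (ψ : E → 𝕜) (m : Measure ℝ),
      IsRadiallyDominated m ψ → IsMajorantMeasure (Module.finrank ℝ E) ε C₀ m →
      ∀ f : ℝ × E → H, Continuous f → HasCompactSupport f →
      ∀ G : ℝ × E → ℝ≥0∞, Measurable G →
      ∫⁻ z, parabolicSquare γ ψ f z * G z ≤ C * ∫⁻ z, ‖f z‖ₑ ^ 2 * strongMaximalFn G z := by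
  obtain ⟨C, hC⟩ := exists_lintegral_sq_mul_le E hγ hε0 hε1 C₀
  refine ⟨C, ?_⟩
  intro 𝕜 _ H _ _ _ _ _ ψ m hψ hm f hf hfc G hG
  set Q : ℝ → ℝ → E → ℝ≥0∞ := fun s τ x =>
    ‖∫ y, dilate (τ ^ γ) ψ (x - y) • f (s, y)‖ₑ ^ 2 with hQ
  have hmeas : Measurable fun p : (ℝ × E) × ℝ =>
      ENNReal.ofReal (p.1.1 - p.2)⁻¹ * Q p.2 (p.1.1 - p.2) p.1.2 :=
    measurable_parabolicSquare_integrand γ hψ.contDiff.continuous hf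
  have hmG : Measurable fun p : (ℝ × E) × ℝ =>
      ENNReal.ofReal (p.1.1 - p.2)⁻¹ * Q p.2 (p.1.1 - p.2) p.1.2 * G p.1 :=
    hmeas.mul (hG.comp measurable_fst)
  have hslice : ∀ s, ∫⁻ z : ℝ × E, ENNReal.ofReal (z.1 - s)⁻¹ * Q s (z.1 - s) z.2 * G z ≤
      C * ∫⁻ y, ‖f (s, y)‖ₑ ^ 2 * strongMaximalFn G (s, y) := by
    intro s
    have hms : Measurable fun z : ℝ × E =>
        ENNReal.ofReal (z.1 - s)⁻¹ * Q s (z.1 - s) z.2 * G z :=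
      hmG.comp (measurable_id.prodMk measurable_const)
    rw [Measure.volume_eq_prod, lintegral_prod _ hms.aemeasurable,
      ← lintegral_add_left_eq_self _ s]
    simp only [add_sub_cancel_left, mul_assoc]
    simp only [lintegral_const_mul' _ _ ENNReal.ofReal_ne_top]
    rw [lintegral_ofReal_inv_mul]
    refine hC 𝕜 H ψ m hψ hm (fun y => f (s, y)) (by fun_prop) ?_ G hG s
    exact HasCompactSupport.intro (hfc.isCompact.image continuous_snd) fun y hy =>
      image_eq_zero_of_notMem_tsupport fun h => hy ⟨(s, y), h, rfl⟩
  have hmf : Measurable fun z : ℝ × E => ‖f z‖ₑ ^ 2 * strongMaximalFn G z :=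
    (hf.enorm.measurable.pow_const 2).mul (measurable_strongMaximalFn hG)
  calc ∫⁻ z, parabolicSquare γ ψ f z * G z
      = ∫⁻ z : ℝ × E, ∫⁻ s, ENNReal.ofReal (z.1 - s)⁻¹ * Q s (z.1 - s) z.2 * G z := by
        refine lintegral_congr fun z => ?_
        exact (lintegral_mul_const _ (hmeas.comp measurable_prodMk_left)).symm
    _ = ∫⁻ s, ∫⁻ z : ℝ × E, ENNReal.ofReal (z.1 - s)⁻¹ * Q s (z.1 - s) z.2 * G z :=
        lintegral_lintegral_swap hmG.aemeasurable
    _ ≤ ∫⁻ s, C * ∫⁻ y, ‖f (s, y)‖ₑ ^ 2 * strongMaximalFn G (s, y) := lintegral_mono hslice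
    _ = _ := by
        rw [lintegral_const_mul' _ _ ENNReal.coe_ne_top, Measure.volume_eq_prod,
          lintegral_prod _ hmf.aemeasurable]

/-- In dimension zero, the vanishing mean leaves no kernel but zero. -/
theorem IsRadiallyDominated.eq_zero_of_subsingleton [Subsingleton E] {m : Measure ℝ} {ψ : E → 𝕜}
    (hψ : IsRadiallyDominated m ψ) (x : E) : ψ x = 0 := by
  have h := hψ.integral_eq_zero
  have e : ψ = fun _ => ψ x := funext fun y => congrArg ψ (Subsingleton.elim y x)
  rw [e, integral_const] at h
  refine (smul_eq_zero.1 h).resolve_left ?_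
  refine ENNReal.toReal_ne_zero.2 ?_
  exact ⟨isOpen_univ.measure_ne_zero _ univ_nonempty,
    (Set.subsingleton_univ.finite.isCompact.measure_lt_top).ne⟩

variable (E) in
/-- The case `r = 1` is the weighted inequality with weight one, and the case `r > 1` follows by
duality from the boundedness of the strong maximal function on `L^r'`. -/
theorem exists_lintegral_parabolicSquare_rpow_le {γ : ℝ} (hγ : 0 < γ) {ε : ℝ}
    (hε0 : 0 < ε) (hε1 : ε ≤ 1) (C₀ : ℝ≥0) {r : ℝ} (hr : 1 ≤ r) :
    ∃ C : ℝ≥0, ∀ (𝕜 : Type*) [RCLike 𝕜] (H : Type*) [NormedAddCommGroup H]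
      [InnerProductSpace 𝕜 H] [CompleteSpace H] [NormedSpace ℝ H] [IsScalarTower ℝ 𝕜 H]
      (ψ : E → 𝕜) (m : Measure ℝ),
      IsRadiallyDominated m ψ → IsMajorantMeasure (Module.finrank ℝ E) ε C₀ m →
      ∀ f : ℝ × E → H, Continuous f → HasCompactSupport f →
      ∫⁻ z, parabolicSquare γ ψ f z ^ r ≤ C * ∫⁻ z, (‖f z‖ₑ ^ 2) ^ r := by
  rcases subsingleton_or_nontrivial E with hE | hE
  · refine ⟨0, ?_⟩
    intro 𝕜 _ H _ _ _ _ _ ψ m hψ hm f hf hfc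
    have h0 : ∀ z, parabolicSquare γ ψ f z = 0 := fun z => by
      simp [parabolicSquare, dilate, hψ.eq_zero_of_subsingleton]
    simp [h0, ENNReal.zero_rpow_of_pos (zero_lt_one.trans_le hr)]
  obtain ⟨C, hC⟩ := exists_lintegral_parabolicSquare_mul_le E hγ hε0 hε1 C₀
  rcases hr.eq_or_lt with rfl | hr1
  · refine ⟨C, ?_⟩
    intro 𝕜 _ H _ _ _ _ _ ψ m hψ hm f hf hfc
    have h := hC 𝕜 H ψ m hψ hm f hf hfc (fun _ => 1) measurable_const
    simp only [mul_one] at h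
    simp only [ENNReal.rpow_one]
    refine h.trans (mul_le_mul_right (lintegral_mono fun z => ?_) _)
    exact mul_le_of_le_one_right' (strongMaximalFn_one_le z)
  · have hrr := Real.HolderConjugate.conjExponent hr1
    set r' := r.conjExponent
    have hr'0 : 0 < r' := hrr.symm.pos
    obtain ⟨C', hC'⟩ := exists_lintegral_strongMaximalFn_rpow_le E hrr.symm.lt
    refine ⟨(C * C' ^ (1 / r')) ^ r, ?_⟩
    intro 𝕜 _ H _ _ _ _ _ ψ m hψ hm f hf hfc
    have hfm : Measurable fun z => ‖f z‖ₑ ^ 2 := hf.enorm.measurable.pow_const 2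
    have hdual : ∀ G : ℝ × E → ℝ≥0∞, Measurable G → ∫⁻ z, parabolicSquare γ ψ f z * G z ≤
        (C * C' ^ (1 / r') * (∫⁻ z, (‖f z‖ₑ ^ 2) ^ r) ^ (1 / r)) *
          (∫⁻ z, G z ^ r') ^ (1 / r') := by
      intro G hG
      have hH := ENNReal.lintegral_mul_le_Lp_mul_Lq volume hrr hfm.aemeasurable
        (measurable_strongMaximalFn hG).aemeasurable
      simp only [Pi.mul_apply] at hH
      calc _ ≤ _ := hC 𝕜 H ψ m hψ hm f hf hfc G hG
        _ ≤ C * ((∫⁻ z, (‖f z‖ₑ ^ 2) ^ r) ^ (1 / r) *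
              (C' * ∫⁻ z, G z ^ r') ^ (1 / r')) := by
            refine mul_le_mul_right (hH.trans (mul_le_mul_right ?_ _)) _
            exact ENNReal.rpow_le_rpow (hC' G hG) (by positivity)
        _ = _ := by
            rw [ENNReal.mul_rpow_of_nonneg _ _ (by positivity)]
            ring
    refine (lintegral_rpow_le_of_forall_lintegral_mul_le volume hrr
      (measurable_parabolicSquare γ hψ.contDiff.continuous hf) hdual).trans (le_of_eq ?_)
    rw [ENNReal.mul_rpow_of_nonneg _ _ hrr.nonneg, ← ENNReal.rpow_mul,
      one_div_mul_cancel hrr.ne_zero, ENNReal.rpow_one, ENNReal.coe_rpow_of_nonneg _ hrr.nonneg,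
      ENNReal.coe_mul, ENNReal.coe_rpow_of_nonneg _ (by positivity)]

end squareFunction

/-- The square function over source times `a < s < t` is dominated by the one over all `s`. -/
theorem squareFunction_rpow_le {𝕜 : Type*} [RCLike 𝕜] {H : Type*} [NormedAddCommGroup H]
    [InnerProductSpace 𝕜 H] [NormedSpace ℝ H] [IsScalarTower ℝ 𝕜 H] {d : ℕ} {p α : ℝ} (hp : 0 ≤ p)
    (ψ : EuclideanSpace ℝ (Fin d) → 𝕜) (a : EReal) (f : ℝ × EuclideanSpace ℝ (Fin d) → H)
    (t : ℝ) (x : EuclideanSpace ℝ (Fin d)) :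
    squareFunction α ψ a f t x ^ p ≤ parabolicSquare (1 / α) ψ f (t, x) ^ (p / 2) := by
  rw [squareFunction, ← ENNReal.rpow_mul, one_div_mul_eq_div]
  refine ENNReal.rpow_le_rpow ?_ (by positivity)
  have hsub : {s : ℝ | a < (s : EReal) ∧ s < t} ⊆ Iio t := fun s hs => hs.2
  refine (lintegral_mono_set hsub).trans ((le_of_eq ?_).trans (setLIntegral_le_lintegral (Iio t) _))
  refine setLIntegral_congr_fun measurableSet_Iio fun s hs => ?_
  have hts : 0 < t - s := sub_pos.2 hs
  have hconv : scaledConv α ψ (t - s) (fun y => f (s, y)) x =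
      ∫ y, dilate ((t - s) ^ (1 / α)) ψ (x - y) • f (s, y) := by
    simp only [scaledConv, dilate, smul_assoc]
    rw [integral_smul, finrank_euclideanSpace_fin]
    congr 1
    rw [← Real.rpow_natCast, ← Real.rpow_mul hts.le, ← Real.rpow_neg hts.le]
    congr 1
    ring
  simp only [hconv]
  rw [div_eq_inv_mul, ENNReal.ofReal_mul (by positivity), ENNReal.ofReal_pow (norm_nonneg _),
    ofReal_norm]

end LittlewoodPaley

theorem mainTheorem1 (d : ℕ) (p α ν lam δ K : ℝ) (hp : 2 ≤ p) (hα₀ : 0 < α) (hα₂ : α < 2)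
    (hν : 0 < ν) (hlam : 0 < lam) (hδ : α / 2 ≤ δ) :
    ∃ N : ℝ≥0,
      ∀ (𝕜 : Type*) [RCLike 𝕜]
        (H : Type*) [NormedAddCommGroup H] [InnerProductSpace 𝕜 H] [CompleteSpace H]
        [NormedSpace ℝ H] [IsScalarTower ℝ 𝕜 H]
        (ψ : EuclideanSpace ℝ (Fin d) → 𝕜),
        LittlewoodPaley.IsAdmissibleKernel α ν lam δ K ψ →
        ∀ (a b : EReal), a < b →
        ∀ f : ℝ × EuclideanSpace ℝ (Fin d) → H,
          ContDiff ℝ ∞ f → HasCompactSupport f →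
          tsupport f ⊆ {z | a < (z.1 : EReal) ∧ (z.1 : EReal) < b} →
          ∫⁻ x, ∫⁻ t in {t : ℝ | a < (t : EReal) ∧ (t : EReal) < b},
              LittlewoodPaley.squareFunction α ψ a f t x ^ p
            ≤ N * ∫⁻ x, ∫⁻ t in {t : ℝ | a < (t : EReal) ∧ (t : EReal) < b},
              ‖f (t, x)‖ₑ ^ p := by
  have hδ0 : 0 < δ := by linarith
  have hε0 : 0 < min 1 δ / 2 := by positivity
  have hε1 : min 1 δ / 2 ≤ 1 := by linarith [min_le_left 1 δ]
  obtain ⟨N, hN⟩ := LittlewoodPaley.exists_lintegral_parabolicSquare_rpow_le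
    (EuclideanSpace ℝ (Fin d)) (one_div_pos.2 hα₀) hε0 hε1 (2 ^ d * (2 * K.toNNReal) + K.toNNReal)
    (r := p / 2) (by linarith)
  refine ⟨N, ?_⟩
  intro 𝕜 _ H _ _ _ _ _ ψ hψ a b _ f hf hfc hsupp
  obtain ⟨m, hm₁, hm₂⟩ := hψ.exists_isRadiallyDominated hα₀ hν
  have hPm := LittlewoodPaley.measurable_parabolicSquare (1 / α) hψ.contDiff.continuous
    hf.continuous
  have hI : MeasurableSet {t : ℝ | a < (t : EReal) ∧ (t : EReal) < b} :=
    (measurableSet_lt measurable_const measurable_coe_real_ereal).inter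
      (measurableSet_lt measurable_coe_real_ereal measurable_const)
  have hfp : ∀ z, (‖f z‖ₑ ^ 2) ^ (p / 2) = ‖f z‖ₑ ^ p := fun z => by
    rw [← ENNReal.rpow_natCast, ← ENNReal.rpow_mul]
    congr 1
    push_cast
    ring
  calc _ ≤ ∫⁻ x, ∫⁻ t, LittlewoodPaley.parabolicSquare (1 / α) ψ f (t, x) ^ (p / 2) :=
        lintegral_mono fun x => (setLIntegral_le_lintegral _ _).trans
          (lintegral_mono fun t =>
            LittlewoodPaley.squareFunction_rpow_le (by linarith) ψ a f t x)
    _ = ∫⁻ z, LittlewoodPaley.parabolicSquare (1 / α) ψ f z ^ (p / 2) := by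
        rw [Measure.volume_eq_prod, lintegral_prod_symm _ (hPm.pow_const _).aemeasurable]
    _ ≤ N * ∫⁻ z, ‖f z‖ₑ ^ p := by
        simpa only [hfp] using hN 𝕜 H ψ m hm₁ hm₂ f hf.continuous hfc
    _ = N * ∫⁻ x, ∫⁻ t, ‖f (t, x)‖ₑ ^ p := by
        rw [Measure.volume_eq_prod, lintegral_prod_symm _
          (hf.continuous.enorm.measurable.pow_const p).aemeasurable]
    _ = _ := by
        congr 2 with x
        rw [← lintegral_indicator hI]
        refine lintegral_congr fun t => ?_
        by_cases ht : t ∈ {t : ℝ | a < (t : EReal) ∧ (t : EReal) < b}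
        · rw [indicator_of_mem ht]
        · have h0 : f (t, x) = 0 :=
            image_eq_zero_of_notMem_tsupport fun h => ht (hsupp h)
          rw [indicator_of_notMem ht, h0, enorm_zero, ENNReal.zero_rpow_of_pos (by linarith)]
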